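/- **Setting.** The finite types are $0$ and, with $\sigma,\tau$, also $\sigma\to\tau$; put $1=0\to0$, $2=1\to0$, $3=2\to0$. The language $\mathsf L_\omega$ has variables of all finite types, constants $0,1,+,\times$, the relations $<_0,=_0$ on type $0$, the combinators $\Pi,\Sigma$ and the recursors $\mathbf R_\sigma$; equality and $\le$ at higher types are defined pointwise from $=_0$ and $\le_0$. The theory $\mathsf{RCA}_0^\omega$, in classical many-sorted logic, consists of the axioms of a discretely ordered semi-ring on type $0$, the defining axioms of $\Pi$, $\Sigma$ and $\mathbf R_0$ (i.e. $\mathbf R_0(f,m,0)=m$, $\mathbf R_0(f,m,n+1)=f(n,\mathbf R_0(f,m,n))$), the axiom of extensionality at all types, induction for quantifier-free formulas, and $\mathsf{QF\text{-}AC}^{1,0}$: $(\forall x^1)(\exists y^0)A(x,y)\to(\exists Y^{1\to 0})(\forall x^1)A(x,Y(x))$ for quantifier-free $A$ (parameters of any type are allowed in the last two). Real numbers are objects $x^1$ coding sequences of rationals with $|x_n-x_{n+i}|<2^{-n}$ for all $n,i$; $x=_{\mathbb R}y$ means $(\forall n)(|x_n-y_n|\le 2^{-n+1})$, $x<_{\mathbb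 R}y$ means $(\exists n)(y_n-x_n>2^{-n+1})$, and $x\le_{\mathbb R}y$ means $\neg(y<_{\mathbb R}x)$. A function $\Psi:\mathbb R\to\mathbb R^+$ is an object of type $1\to1$ mapping reals to positive reals and equal reals to equal reals. Cantor space $C$ is $\{f^1: f\le_1 1\}$, and $f\in[\overline g n]$ means $f(m)=g(m)$ for all $m<n$. Finite sequences of objects of type $1$ are given by a length and an object of type $0\to1$. Consider the following principles. * $(\exists^3)$: $(\exists E^3\le_3 1)(\forall Y^2)\big[(\exists f^1)(Y(f)=0)\leftrightarrow E(Y)=0\big]$. * $\mathsf{LUB}$ (a scheme): for every second-order formula $\varphi(x^1)$, i.e. every formula of $\mathsf L_\omega$ whose quantifiers all range over objects of type $0$ or $1$, with parameters of any finite type: if $\varphi$ is extensional on $\mathbb R$, that is, $x=_{\mathbb R}y\to(\varphi(x)\leftrightarrow\varphi(y))$ for all $x,y\in\mathbb R$, and if $\varphi(0)\wedge\neg\varphi(1)$, then there is a least $y\in[0,1]$ such that $(\forall z\in(y,1])\,\neg\varphi(z)$. * $\mathsf{HBU}$: for every $\Psi:\mathbb R\to\mathbb R^+$ there is a finite sequence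 $\langle y_1,\dots,y_k\rangle$ in $[0,1]$ such that $(\forall x\in[0,1])(\exists i\le k)\big(y_i-\Psi(y_i)<x<y_i+\Psi(y_i)\big)$. * $\mathsf{HBU}_{\mathsf c}$: for every $G^2$ there is a finite sequence $\langle f_1,\dots,f_k\rangle$ in $C$ such that $(\forall f\in C)(\exists i\le k)\big(f\in[\overline{f_i}G(f_i)]\big)$. * $\mathsf{PIT}_{\mathsf u}$ (uniform Pincherle's theorem): $(\forall G^2)(\exists N^0)(\forall F^2)\big[\mathsf{LOC}(F,G)\to(\forall g\in C)(F(g)\le N)\big]$, where $\mathsf{LOC}(F,G)$ is $(\forall f,g\in C)\big[g\in[\overline fG(f)]\to F(g)\le G(f)\big]$. **Theorem.** $\mathsf{RCA}_0^\omega$ proves the chain of implications $$(\exists^3)\to\mathsf{LUB}\to\mathsf{HBU}\to\mathsf{HBU}_{\mathsf c}\to\mathsf{PIT}_{\mathsf u}.$$ That is: $\mathsf{RCA}_0^\omega$ proves $(\exists^3)\to\psi$ for every instance $\psi$ of $\mathsf{LUB}$; $\mathsf{RCA}_0^\omega$ together with all instances of $\mathsf{LUB}$ proves $\mathsf{HBU}$;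 and $\mathsf{RCA}_0^\omega$ proves $\mathsf{HBU}\to\mathsf{HBU}_{\mathsf c}$ and $\mathsf{HBU}_{\mathsf c}\to\mathsf{PIT}_{\mathsf u}$. In particular $\mathsf Z_2^\Omega:=\mathsf{RCA}_0^\omega+(\exists^3)$, which does not include the countable choice scheme $\mathsf{QF\text{-}AC}^{0,1}$, proves $\mathsf{PIT}_{\mathsf u}$. -/

import Mathlib

/-! # The higher-order base theory `RCA₀^ω`: syntax, deduction, axioms, and the principles studied -/

namespace HigherOrderRM

/-! ## Finite types, terms and formulas of the language `L_ω` -/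

/-- The finite types: `0` (natural numbers), and `σ → τ`. -/
inductive Ty : Type
  | nat : Ty
  | arr : Ty → Ty → Ty

infixr:60 " ⇒ " => Ty.arr

/-- The pure type `1 = 0 → 0`. -/
abbrev Ty.one : Ty := Ty.nat ⇒ Ty.nat
/-- The pure type `2 = 1 → 0`. -/
abbrev Ty.two : Ty := Ty.one ⇒ Ty.nat
/-- The pure type `3 = 2 → 0`. -/
abbrev Ty.three : Ty := Ty.two ⇒ Ty.nat

/-- A context lists the types of the free variables, the most recently bound one first. -/
abbrev Ctx : Type := List Ty

/-- Typed de Bruijn variables: positions in a context. -/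
inductive Var : Ctx → Ty → Type
  | zero {Γ : Ctx} {τ : Ty} : Var (τ :: Γ) τ
  | succ {Γ : Ctx} {σ τ : Ty} : Var Γ τ → Var (σ :: Γ) τ

/-- The constants of `L_ω` (`<₀` and `=₀` are the relation symbols of `Form`): `0`, `1`, `+`, `×`,
the combinators `Π` and `Σ` (also known as `K` and `S`), and the recursors `R_σ`. -/
inductive Const : Ty → Type
  | zero : Const Ty.nat
  | one : Const Ty.nat
  | add : Const (Ty.nat ⇒ Ty.nat ⇒ Ty.nat)
  | mul : Const (Ty.nat ⇒ Ty.nat ⇒ Ty.nat)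
  | combK (ρ σ : Ty) : Const (ρ ⇒ σ ⇒ ρ)
  | combS (ρ σ τ : Ty) : Const ((ρ ⇒ σ ⇒ τ) ⇒ (ρ ⇒ σ) ⇒ ρ ⇒ τ)
  | recursor (σ : Ty) : Const ((Ty.nat ⇒ σ ⇒ σ) ⇒ σ ⇒ Ty.nat ⇒ σ)

/-- Terms with free variables in the context `Γ`. -/
inductive Term (Γ : Ctx) : Ty → Type
  | var {τ : Ty} : Var Γ τ → Term Γ τ
  | const {τ : Ty} : Const τ → Term Γ τ
  | app {σ τ : Ty} : Term Γ (σ ⇒ τ) → Term Γ σ → Term Γ τ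

infixl:80 " ⬝ " => Term.app

/-- Formulas with free variables in the context `Γ`. The logic is classical, so the remaining
connectives and the existential quantifier are abbreviations. -/
inductive Form : Ctx → Type
  | eq {Γ : Ctx} : Term Γ Ty.nat → Term Γ Ty.nat → Form Γ
  | lt {Γ : Ctx} : Term Γ Ty.nat → Term Γ Ty.nat → Form Γ
  | falsum {Γ : Ctx} : Form Γ
  | imp {Γ : Ctx} : Form Γ → Form Γ → Form Γ
  | all {Γ : Ctx} (σ : Ty) : Form (σ :: Γ) → Form Γ

/-- Sentences are formulas without free variables. -/
abbrev Sentence : Type := Form []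

infix:50 " =₀ " => Form.eq
infix:50 " <₀ " => Form.lt
infixr:25 " ⟹ " => Form.imp

namespace Form

variable {Γ : Ctx}

def neg (φ : Form Γ) : Form Γ := φ ⟹ falsum
def conj (φ ψ : Form Γ) : Form Γ := neg (φ ⟹ neg ψ)
def disj (φ ψ : Form Γ) : Form Γ := neg φ ⟹ ψ
def iff (φ ψ : Form Γ) : Form Γ := conj (φ ⟹ ψ) (ψ ⟹ φ)
def ex (σ : Ty) (φ : Form (σ :: Γ)) : Form Γ := neg (all σ (neg φ))

end Form

infixr:35 " ⩑ " => Form.conj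
infixr:30 " ⩒ " => Form.disj
infix:20 " ⟺ " => Form.iff

/-! ## Renaming and substitution -/

/-- Renamings of variables. -/
abbrev Ren (Γ Δ : Ctx) : Type := ∀ τ : Ty, Var Γ τ → Var Δ τ

/-- Simultaneous substitutions. -/
abbrev Subst (Γ Δ : Ctx) : Type := ∀ τ : Ty, Var Γ τ → Term Δ τ

/-- Push a renaming under a binder. -/
def Ren.lift {Γ Δ : Ctx} {σ : Ty} (r : Ren Γ Δ) : Ren (σ :: Γ) (σ :: Δ)
  | _, Var.zero => Var.zero
  | _, Var.succ v => Var.succ (r _ v)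

def Term.rename {Γ Δ : Ctx} (r : Ren Γ Δ) {τ : Ty} : Term Γ τ → Term Δ τ
  | Term.var v => Term.var (r _ v)
  | Term.const c => Term.const c
  | Term.app s t => (s.rename r) ⬝ (t.rename r)

def Form.rename : {Γ Δ : Ctx} → Ren Γ Δ → Form Γ → Form Δ
  | _, _, r, Form.eq s t => s.rename r =₀ t.rename r
  | _, _, r, Form.lt s t => s.rename r <₀ t.rename r
  | _, _, _, Form.falsum => Form.falsum
  | _, _, r, Form.imp φ ψ => φ.rename r ⟹ ψ.rename r
  | _, _, r, Form.all σ φ => Form.all σ (φ.rename (Ren.lift r))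

/-- The renaming that inserts one fresh variable. -/
def Ren.weaken {Γ : Ctx} {σ : Ty} : Ren Γ (σ :: Γ) := fun _ v => Var.succ v

/-- The renaming of the empty context. -/
def Ren.empty {Γ : Ctx} : Ren [] Γ
  | _, v => nomatch v

/-- Weakening of a term by one fresh variable. -/
def Term.wk {Γ : Ctx} {σ τ : Ty} (t : Term Γ τ) : Term (σ :: Γ) τ := t.rename Ren.weaken

/-- Weakening of a formula by one fresh variable. -/
def Form.wk {Γ : Ctx} {σ : Ty} (φ : Form Γ) : Form (σ :: Γ) := φ.rename Ren.weaken

/-- Weakening by one fresh variable that sits just below the most recently bound one. -/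
def Form.wkUnder {Γ : Ctx} {ρ σ : Ty} (φ : Form (ρ :: Γ)) : Form (ρ :: σ :: Γ) :=
  φ.rename (Ren.lift Ren.weaken)

/-- Push a substitution under a binder. -/
def Subst.lift {Γ Δ : Ctx} {σ : Ty} (s : Subst Γ Δ) : Subst (σ :: Γ) (σ :: Δ)
  | _, Var.zero => Term.var Var.zero
  | _, Var.succ v => (s _ v).wk

def Term.subst {Γ Δ : Ctx} (s : Subst Γ Δ) {τ : Ty} : Term Γ τ → Term Δ τ
  | Term.var v => s _ v
  | Term.const c => Term.const c
  | Term.app t u => (t.subst s) ⬝ (u.subst s)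

def Form.subst : {Γ Δ : Ctx} → Subst Γ Δ → Form Γ → Form Δ
  | _, _, s, Form.eq t u => t.subst s =₀ u.subst s
  | _, _, s, Form.lt t u => t.subst s <₀ u.subst s
  | _, _, _, Form.falsum => Form.falsum
  | _, _, s, Form.imp φ ψ => φ.subst s ⟹ ψ.subst s
  | _, _, s, Form.all σ φ => Form.all σ (φ.subst (Subst.lift s))

/-- The substitution that replaces the most recent variable by `t` and fixes the others. -/
def Subst.single {Γ : Ctx} {σ : Ty} (t : Term Γ σ) : Subst (σ :: Γ) Γ
  | _, Var.zero => t
  | _, Var.succ v => Term.var v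

/-- `φ.inst t` is `φ(t)`, for `φ = φ(x)` with `x` the most recent variable. -/
def Form.inst {Γ : Ctx} {σ : Ty} (φ : Form (σ :: Γ)) (t : Term Γ σ) : Form Γ :=
  φ.subst (Subst.single t)

/-- A sentence, seen as a formula in any context. -/
def Form.ofSentence {Γ : Ctx} (φ : Sentence) : Form Γ := φ.rename Ren.empty

/-- The universal closure. -/
def Form.close : (Γ : Ctx) → Form Γ → Sentence
  | [], φ => φ
  | σ :: Γ, φ => Form.close Γ (Form.all σ φ)

/-- No quantifiers at all; the free variables may have any finite type. -/
def Form.QuantifierFree : {Γ : Ctx} → Form Γ → Prop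
  | _, Form.eq _ _ => True
  | _, Form.lt _ _ => True
  | _, Form.falsum => True
  | _, Form.imp φ ψ => φ.QuantifierFree ∧ ψ.QuantifierFree
  | _, Form.all _ _ => False

/-- All quantifiers range over objects of type `0` or `1`; the free variables (the parameters) may
have any finite type. -/
def Form.SecondOrder : {Γ : Ctx} → Form Γ → Prop
  | _, Form.eq _ _ => True
  | _, Form.lt _ _ => True
  | _, Form.falsum => True
  | _, Form.imp φ ψ => φ.SecondOrder ∧ ψ.SecondOrder
  | _, Form.all σ φ => (σ = Ty.nat ∨ σ = Ty.one) ∧ φ.SecondOrder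

/-! ## Derivability -/

/-- Natural deduction for classical many-sorted first-order logic with equality at type `0`:
`Derives T H φ` says that `φ` is derivable from the axioms `T` and the open assumptions `H`. -/
inductive Derives (T : Set Sentence) : {Γ : Ctx} → List (Form Γ) → Form Γ → Prop
  | ax {Γ : Ctx} {H : List (Form Γ)} {φ : Sentence} : φ ∈ T → Derives T H φ.ofSentence
  | hyp {Γ : Ctx} {H : List (Form Γ)} {φ : Form Γ} : φ ∈ H → Derives T H φ
  | impI {Γ : Ctx} {H : List (Form Γ)} {φ ψ : Form Γ} : Derives T (φ :: H) ψ → Derives T H (φ ⟹ ψ)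
  | impE {Γ : Ctx} {H : List (Form Γ)} {φ ψ : Form Γ} :
      Derives T H (φ ⟹ ψ) → Derives T H φ → Derives T H ψ
  | raa {Γ : Ctx} {H : List (Form Γ)} {φ : Form Γ} :
      Derives T (Form.neg φ :: H) Form.falsum → Derives T H φ
  | allI {Γ : Ctx} {H : List (Form Γ)} {σ : Ty} {φ : Form (σ :: Γ)} :
      Derives T (H.map Form.wk) φ → Derives T H (Form.all σ φ)
  | allE {Γ : Ctx} {H : List (Form Γ)} {σ : Ty} {φ : Form (σ :: Γ)} (t : Term Γ σ) :
      Derives T H (Form.all σ φ) → Derives T H (φ.inst t)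
  | eqRefl {Γ : Ctx} {H : List (Form Γ)} (t : Term Γ Ty.nat) : Derives T H (t =₀ t)
  | eqSubst {Γ : Ctx} {H : List (Form Γ)} {s t : Term Γ Ty.nat} (φ : Form (Ty.nat :: Γ)) :
      Derives T H (s =₀ t) → Derives T H (φ.inst s) → Derives T H (φ.inst t)

/-- The theory `T` proves the sentence `φ`. -/
def Proves (T : Set Sentence) (φ : Sentence) : Prop := Derives T [] φ

/-! ## Basic terms and abbreviations -/

section Abbreviations

variable {Γ : Ctx}

/-- The variables, counted from the most recently bound one. -/
abbrev v0 {σ : Ty} : Term (σ :: Γ) σ := Term.var Var.zero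
abbrev v1 {σ ρ : Ty} : Term (ρ :: σ :: Γ) σ := Term.var Var.zero.succ
abbrev v2 {σ ρ ρ' : Ty} : Term (ρ' :: ρ :: σ :: Γ) σ := Term.var Var.zero.succ.succ
abbrev v4 {σ ρ ρ' ρ'' ρ''' : Ty} : Term (ρ''' :: ρ'' :: ρ' :: ρ :: σ :: Γ) σ :=
  Term.var Var.zero.succ.succ.succ.succ

def zero : Term Γ Ty.nat := Term.const Const.zero
def one : Term Γ Ty.nat := Term.const Const.one
def add (s t : Term Γ Ty.nat) : Term Γ Ty.nat := Term.const Const.add ⬝ s ⬝ t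
def mul (s t : Term Γ Ty.nat) : Term Γ Ty.nat := Term.const Const.mul ⬝ s ⬝ t
def succ (t : Term Γ Ty.nat) : Term Γ Ty.nat := add t one
def two : Term Γ Ty.nat := succ one

def combK {ρ σ : Ty} : Term Γ (ρ ⇒ σ ⇒ ρ) := Term.const (Const.combK ρ σ)
def combS {ρ σ τ : Ty} : Term Γ ((ρ ⇒ σ ⇒ τ) ⇒ (ρ ⇒ σ) ⇒ ρ ⇒ τ) :=
  Term.const (Const.combS ρ σ τ)

/-- Lambda abstraction over the most recent variable, by means of the combinators. -/
def lam {σ : Ty} : {τ : Ty} → Term (σ :: Γ) τ → Term Γ (σ ⇒ τ)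
  | _, Term.var Var.zero => combS ⬝ combK ⬝ (combK (σ := σ))
  | _, Term.var (Var.succ v) => combK ⬝ Term.var v
  | _, Term.const c => combK ⬝ Term.const c
  | _, Term.app s t => combS ⬝ lam s ⬝ lam t

/-- `x ≤₀ y`. -/
def le (s t : Term Γ Ty.nat) : Form Γ := (s <₀ t) ⩒ (s =₀ t)

/-- `x =_τ y`: `x z₁ … z_k =₀ y z₁ … z_k` for all `z₁, …, z_k`. -/
def eqT : {Γ : Ctx} → (τ : Ty) → Term Γ τ → Term Γ τ → Form Γ
  | _, Ty.nat, s, t => s =₀ t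
  | _, Ty.arr σ τ, s, t => Form.all σ (eqT τ (s.wk ⬝ v0) (t.wk ⬝ v0))

/-- `x ≤_τ y`: `x z₁ … z_k ≤₀ y z₁ … z_k` for all `z₁, …, z_k`. -/
def leT : {Γ : Ctx} → (τ : Ty) → Term Γ τ → Term Γ τ → Form Γ
  | _, Ty.nat, s, t => le s t
  | _, Ty.arr σ τ, s, t => Form.all σ (leT τ (s.wk ⬝ v0) (t.wk ⬝ v0))

/-- The functional of type `τ` that is constantly `1`. -/
def oneT : (τ : Ty) → Term Γ τ
  | Ty.nat => one
  | Ty.arr _ τ => combK ⬝ oneT τ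

/-- `∃ i < n, φ(i)`. -/
def exLt (n : Term Γ Ty.nat) (φ : Form (Ty.nat :: Γ)) : Form Γ := Form.ex Ty.nat ((v0 <₀ n.wk) ⩑ φ)

/-- `∀ i < n, φ(i)`. -/
def allLt (n : Term Γ Ty.nat) (φ : Form (Ty.nat :: Γ)) : Form Γ :=
  Form.all Ty.nat ((v0 <₀ n.wk) ⟹ φ)

end Abbreviations

/-! ## The base theory `RCA₀^ω` -/

/-- The axioms saying that `ℕ` is a (discretely) ordered commutative semi-ring. -/
inductive IsArithmeticAxiom : Sentence → Prop
  | add_assoc : IsArithmeticAxiom (Form.all Ty.nat (Form.all Ty.nat (Form.all Ty.nat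
      (add (add v2 v1) v0 =₀ add v2 (add v1 v0)))))
  | add_comm : IsArithmeticAxiom (Form.all Ty.nat (Form.all Ty.nat (add v1 v0 =₀ add v0 v1)))
  | add_zero : IsArithmeticAxiom (Form.all Ty.nat (add v0 zero =₀ v0))
  | mul_assoc : IsArithmeticAxiom (Form.all Ty.nat (Form.all Ty.nat (Form.all Ty.nat
      (mul (mul v2 v1) v0 =₀ mul v2 (mul v1 v0)))))
  | mul_comm : IsArithmeticAxiom (Form.all Ty.nat (Form.all Ty.nat (mul v1 v0 =₀ mul v0 v1)))
  | mul_one : IsArithmeticAxiom (Form.all Ty.nat (mul v0 one =₀ v0))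
  | mul_zero : IsArithmeticAxiom (Form.all Ty.nat (mul v0 zero =₀ zero))
  | mul_add : IsArithmeticAxiom (Form.all Ty.nat (Form.all Ty.nat (Form.all Ty.nat
      (mul v2 (add v1 v0) =₀ add (mul v2 v1) (mul v2 v0)))))
  | lt_irrefl : IsArithmeticAxiom (Form.all Ty.nat (Form.neg (v0 <₀ v0)))
  | lt_trans : IsArithmeticAxiom (Form.all Ty.nat (Form.all Ty.nat (Form.all Ty.nat
      ((v2 <₀ v1) ⟹ (v1 <₀ v0) ⟹ (v2 <₀ v0)))))
  | lt_total : IsArithmeticAxiom (Form.all Ty.nat (Form.all Ty.nat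
      ((v1 <₀ v0) ⩒ (v1 =₀ v0) ⩒ (v0 <₀ v1))))
  | add_lt_add : IsArithmeticAxiom (Form.all Ty.nat (Form.all Ty.nat (Form.all Ty.nat
      ((v2 <₀ v1) ⟹ (add v2 v0 <₀ add v1 v0)))))
  | mul_lt_mul : IsArithmeticAxiom (Form.all Ty.nat (Form.all Ty.nat (Form.all Ty.nat
      ((v2 <₀ v1) ⟹ (zero <₀ v0) ⟹ (mul v2 v0 <₀ mul v1 v0)))))
  | zero_lt_one : IsArithmeticAxiom (zero <₀ one)
  | zero_le : IsArithmeticAxiom (Form.all Ty.nat (le zero v0))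
  | discrete : IsArithmeticAxiom (Form.all Ty.nat ((zero <₀ v0) ⟹ le one v0))

/-- The axioms of `RCA₀^ω`. -/
inductive IsRCAAxiom : Sentence → Prop
  | arithmetic {φ : Sentence} : IsArithmeticAxiom φ → IsRCAAxiom φ
  /-- `Π x y = x`. -/
  | combK (ρ σ : Ty) : IsRCAAxiom (Form.all ρ (Form.all σ (eqT ρ (combK ⬝ v1 ⬝ v0) v1)))
  /-- `Σ x y z = x z (y z)`. -/
  | combS (ρ σ τ : Ty) : IsRCAAxiom
      (Form.all (ρ ⇒ σ ⇒ τ) (Form.all (ρ ⇒ σ) (Form.all ρ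
        (eqT τ (combS ⬝ v2 ⬝ v1 ⬝ v0) (v2 ⬝ v0 ⬝ (v1 ⬝ v0))))))
  /-- `R₀(f, m, 0) = m`. -/
  | rec_zero : IsRCAAxiom (Form.all (Ty.nat ⇒ Ty.nat ⇒ Ty.nat) (Form.all Ty.nat
      (Term.const (Const.recursor Ty.nat) ⬝ v1 ⬝ v0 ⬝ zero =₀ v0)))
  /-- `R₀(f, m, n + 1) = f(n, R₀(f, m, n))`. -/
  | rec_succ : IsRCAAxiom (Form.all (Ty.nat ⇒ Ty.nat ⇒ Ty.nat) (Form.all Ty.nat (Form.all Ty.nat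
      (Term.const (Const.recursor Ty.nat) ⬝ v2 ⬝ v1 ⬝ succ v0 =₀
        v2 ⬝ v0 ⬝ (Term.const (Const.recursor Ty.nat) ⬝ v2 ⬝ v1 ⬝ v0)))))
  /-- Extensionality: `x =_ρ y → f(x) =_τ f(y)`. -/
  | ext (ρ τ : Ty) : IsRCAAxiom (Form.all ρ (Form.all ρ (Form.all (ρ ⇒ τ)
      (eqT ρ v2 v1 ⟹ eqT τ (v0 ⬝ v2) (v0 ⬝ v1)))))
  /-- Induction for quantifier-free formulas, with parameters of any type. -/
  | induction (Γ : Ctx) (A : Form (Ty.nat :: Γ)) : A.QuantifierFree → IsRCAAxiom (Form.close Γ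
      (A.inst zero ⟹ Form.all Ty.nat (A ⟹ A.wkUnder.inst (succ v0)) ⟹ Form.all Ty.nat A))
  /-- `QF-AC^{1,0}`, with parameters of any type: in `A`, the variable `v1` is `x` of type `1` and
  `v0` is `y` of type `0`. -/
  | choice (Γ : Ctx) (A : Form (Ty.nat :: Ty.one :: Γ)) : A.QuantifierFree → IsRCAAxiom
      (Form.close Γ (Form.all Ty.one (Form.ex Ty.nat A) ⟹
        Form.ex Ty.two (Form.all Ty.one
          ((A.rename (Ren.lift (Ren.lift Ren.weaken))).inst (v1 ⬝ v0)))))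

/-- The theory `RCA₀^ω`. -/
def RCA0omega : Set Sentence := {φ | IsRCAAxiom φ}

/-- `(∃³)`: there is `E ≤₃ 1` of type `3` with `(∃ f) Y(f) = 0 ↔ E(Y) = 0` for all `Y` of
type `2`. -/
def exists3 : Sentence :=
  Form.ex Ty.three (leT Ty.three v0 (oneT Ty.three) ⩑
    Form.all Ty.two (Form.ex Ty.one (v1 ⬝ v0 =₀ zero) ⟺ (v1 ⬝ v0 =₀ zero)))

/-- The theory `Z₂^Ω = RCA₀^ω + (∃³)`. -/
def Z2Omega : Set Sentence := RCA0omega ∪ {exists3}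

/-! ## Primitive recursive arithmetic and rational numbers -/

section Rationals

variable {Γ : Ctx}

/-- The value at `n` of the function given by `g(0) = m` and `g(k + 1) = f(k, g(k))`. In `f`, the
variable `v1` is `k` and `v0` is `g(k)`. -/
def recNat (m : Term Γ Ty.nat) (f : Term (Ty.nat :: Ty.nat :: Γ) Ty.nat) (n : Term Γ Ty.nat) :
    Term Γ Ty.nat :=
  Term.const (Const.recursor Ty.nat) ⬝ lam (lam f) ⬝ m ⬝ n

def pred (n : Term Γ Ty.nat) : Term Γ Ty.nat := recNat zero v1 n
/-- Truncated subtraction. -/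
def monus (a b : Term Γ Ty.nat) : Term Γ Ty.nat := recNat a (pred v0) b
/-- `1` if `a ≤ b`, and `0` otherwise. -/
def leInd (a b : Term Γ Ty.nat) : Term Γ Ty.nat := monus one (monus a b)
/-- `⌊n / 2⌋`. -/
def half (n : Term Γ Ty.nat) : Term Γ Ty.nat := recNat zero (monus v1 v0) n
/-- The remainder of `n` modulo `2`. -/
def parity (n : Term Γ Ty.nat) : Term Γ Ty.nat := monus n (mul two (half n))
/-- `2 ^ n`. -/
def twoPow (n : Term Γ Ty.nat) : Term Γ Ty.nat := recNat one (add v0 v0) n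
/-- `w (w + 1) / 2`. -/
def triangle (w : Term Γ Ty.nat) : Term Γ Ty.nat := half (mul w (succ w))
/-- The largest `w` with `w (w + 1) / 2 ≤ z`. -/
def triangleRoot (z : Term Γ Ty.nat) : Term Γ Ty.nat :=
  recNat zero (add v0 (leInd (triangle (succ v0)) (succ v1))) z

/-- The Cantor pairing `(a + b) (a + b + 1) / 2 + a` and its two inverses. -/
def pair (a b : Term Γ Ty.nat) : Term Γ Ty.nat := add (triangle (add a b)) a
def fst (z : Term Γ Ty.nat) : Term Γ Ty.nat := monus z (triangle (triangleRoot z))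
def snd (z : Term Γ Ty.nat) : Term Γ Ty.nat := monus (triangleRoot z) (fst z)

/-! Every number codes a rational: `pair (2 k) d` codes `k / (d + 1)`, and `pair (2 k + 1) d` codes
`- (k + 1) / (d + 1)`. So `q` has the value `(ratPos q - ratNeg q) / ratDen q`. -/

def ratDen (q : Term Γ Ty.nat) : Term Γ Ty.nat := succ (snd q)
def ratPos (q : Term Γ Ty.nat) : Term Γ Ty.nat :=
  mul (monus one (parity (fst q))) (half (fst q))
def ratNeg (q : Term Γ Ty.nat) : Term Γ Ty.nat := mul (parity (fst q)) (succ (half (fst q)))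

/-- A code of `(p - m) / d`, where `d` is positive. -/
def ratMk (p m d : Term Γ Ty.nat) : Term Γ Ty.nat :=
  pair (add (mul two (monus p m)) (pred (mul two (monus m p)))) (pred d)

def ratAdd (q r : Term Γ Ty.nat) : Term Γ Ty.nat :=
  ratMk (add (mul (ratPos q) (ratDen r)) (mul (ratPos r) (ratDen q)))
    (add (mul (ratNeg q) (ratDen r)) (mul (ratNeg r) (ratDen q))) (mul (ratDen q) (ratDen r))
def ratSub (q r : Term Γ Ty.nat) : Term Γ Ty.nat :=
  ratMk (add (mul (ratPos q) (ratDen r)) (mul (ratNeg r) (ratDen q)))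
    (add (mul (ratNeg q) (ratDen r)) (mul (ratPos r) (ratDen q))) (mul (ratDen q) (ratDen r))
/-- The absolute value. -/
def ratAbs (q : Term Γ Ty.nat) : Term Γ Ty.nat := ratMk (add (ratPos q) (ratNeg q)) zero (ratDen q)
/-- `q < r` for rationals. -/
def ratLt (q r : Term Γ Ty.nat) : Form Γ :=
  add (mul (ratPos q) (ratDen r)) (mul (ratNeg r) (ratDen q)) <₀
    add (mul (ratPos r) (ratDen q)) (mul (ratNeg q) (ratDen r))
/-- `q ≤ r` for rationals. -/
def ratLe (q r : Term Γ Ty.nat) : Form Γ := Form.neg (ratLt r q)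

end Rationals

/-! ## Real numbers -/

section Reals

variable {Γ : Ctx}

/-- `x ∈ ℝ`: `|x_n - x_{n+i}| < 2^{-n}` for all `n` and `i`. -/
def isReal (x : Term Γ Ty.one) : Form Γ :=
  Form.all Ty.nat (Form.all Ty.nat
    (ratLt (ratAbs (ratSub (x.wk.wk ⬝ v1) (x.wk.wk ⬝ add v1 v0))) (ratMk one zero (twoPow v1))))

/-- Equality of reals: `|x_n - y_n| ≤ 2^{-n+1}` for all `n`. -/
def realEq (x y : Term Γ Ty.one) : Form Γ :=
  Form.all Ty.nat (ratLe (ratAbs (ratSub (x.wk ⬝ v0) (y.wk ⬝ v0))) (ratMk two zero (twoPow v0)))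

/-- `x < y` for reals: `y_n - x_n > 2^{-n+1}` for some `n`. -/
def realLt (x y : Term Γ Ty.one) : Form Γ :=
  Form.ex Ty.nat (ratLt (ratMk two zero (twoPow v0)) (ratSub (y.wk ⬝ v0) (x.wk ⬝ v0)))

/-- `x ≤ y` for reals. -/
def realLe (x y : Term Γ Ty.one) : Form Γ := Form.neg (realLt y x)

/-- `(x + y)_n = x_{n+1} + y_{n+1}`. -/
def realAdd (x y : Term Γ Ty.one) : Term Γ Ty.one :=
  lam (ratAdd (x.wk ⬝ succ v0) (y.wk ⬝ succ v0))
/-- `(x - y)_n = x_{n+1} - y_{n+1}`. -/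
def realSub (x y : Term Γ Ty.one) : Term Γ Ty.one :=
  lam (ratSub (x.wk ⬝ succ v0) (y.wk ⬝ succ v0))
def realZero : Term Γ Ty.one := lam (ratMk zero zero one)
def realOne : Term Γ Ty.one := lam (ratMk one zero one)

/-- `x ∈ [0, 1]`. -/
def inUnitInterval (x : Term Γ Ty.one) : Form Γ :=
  isReal x ⩑ realLe realZero x ⩑ realLe x realOne

/-- `Ψ : ℝ → ℝ⁺`: a functional of type `1 → 1` that maps reals to positive reals, and equal reals
to equal reals. -/
def isPositiveRealFunction (Ψ : Term Γ (Ty.one ⇒ Ty.one)) : Form Γ :=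
  Form.all Ty.one (isReal v0 ⟹ (isReal (Ψ.wk ⬝ v0) ⩑ realLt realZero (Ψ.wk ⬝ v0))) ⩑
  Form.all Ty.one (Form.all Ty.one (isReal v1 ⟹ isReal v0 ⟹ realEq v1 v0 ⟹
    realEq (Ψ.wk.wk ⬝ v1) (Ψ.wk.wk ⬝ v0)))

/-- `x ∈ (y - Ψ(y), y + Ψ(y))`. -/
def inInterval (Ψ : Term Γ (Ty.one ⇒ Ty.one)) (x y : Term Γ Ty.one) : Form Γ :=
  realLt (realSub y (Ψ ⬝ y)) x ⩑ realLt x (realAdd y (Ψ ⬝ y))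

end Reals

/-! ## The principles -/

section Principles

variable {Γ : Ctx}

/-- `φ(x)` is extensional on `ℝ`: `x = y → (φ(x) ↔ φ(y))` for all reals `x`, `y`. -/
def isExtensional (φ : Form (Ty.one :: Γ)) : Form Γ :=
  Form.all Ty.one (Form.all Ty.one (isReal v1 ⟹ isReal v0 ⟹ realEq v1 v0 ⟹
    (φ.wk ⟺ φ.wkUnder)))

/-- `(∀ z ∈ (y, 1]) ¬ φ(z)`. -/
def noneAbove (φ : Form (Ty.one :: Γ)) (y : Term Γ Ty.one) : Form Γ :=
  Form.all Ty.one ((isReal v0 ⩑ realLt y.wk v0 ⩑ realLe v0 realOne) ⟹ Form.neg φ)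

/-- If `φ` is extensional, `φ(0)` and `¬ φ(1)`, then there is a least `y ∈ [0, 1]` such that
`(∀ z ∈ (y, 1]) ¬ φ(z)`. -/
def lubFormula (φ : Form (Ty.one :: Γ)) : Form Γ :=
  (isExtensional φ ⩑ φ.inst realZero ⩑ Form.neg (φ.inst realOne)) ⟹
    Form.ex Ty.one (inUnitInterval v0 ⩑ noneAbove φ.wkUnder v0 ⩑
      Form.all Ty.one ((inUnitInterval v0 ⩑ noneAbove φ.wkUnder.wkUnder v0) ⟹ realLe v1 v0))

/-- The axiom scheme `LUB`, over all second-order formulas `φ` with parameters of any type. -/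
def LUB : Set Sentence :=
  {ψ | ∃ (Γ : Ctx) (φ : Form (Ty.one :: Γ)), φ.SecondOrder ∧ ψ = Form.close Γ (lubFormula φ)}

/-- `HBU`: for every `Ψ : ℝ → ℝ⁺`, the covering of `[0, 1]` by the intervals
`(y - Ψ(y), y + Ψ(y))` with `y ∈ [0, 1]` has a finite sub-covering. Here and below, a finite
sequence of objects of type `1` is given by its length `k` and an object `w` of type `0 → 1`. -/
def HBU : Sentence :=
  Form.all (Ty.one ⇒ Ty.one) (isPositiveRealFunction v0 ⟹
    Form.ex Ty.nat (Form.ex (Ty.nat ⇒ Ty.one)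
      (allLt v1 (inUnitInterval (v1 ⬝ v0)) ⩑
        Form.all Ty.one (inUnitInterval v0 ⟹
          exLt v2 (inInterval v4 v1 (v2 ⬝ v0))))))

/-- `f ∈ C`, i.e. `f ≤₁ 1`. -/
def inCantor (f : Term Γ Ty.one) : Form Γ := leT Ty.one f (oneT Ty.one)

/-- `f ∈ [ḡn]`: `f(m) = g(m)` for all `m < n`. -/
def inCylinder (f g : Term Γ Ty.one) (n : Term Γ Ty.nat) : Form Γ :=
  allLt n (f.wk ⬝ v0 =₀ g.wk ⬝ v0)

/-- `HBU_c`: for every `G` of type `2`, the covering of Cantor space by the cylinders `[f̄G(f)]`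
with `f ∈ C` has a finite sub-covering. -/
def HBUc : Sentence :=
  Form.all Ty.two (Form.ex Ty.nat (Form.ex (Ty.nat ⇒ Ty.one)
    (allLt v1 (inCantor (v1 ⬝ v0)) ⩑
      Form.all Ty.one (inCantor v0 ⟹
        exLt v2 (inCylinder v1 (v2 ⬝ v0)
          (v4 ⬝ (v2 ⬝ v0)))))))

/-- `LOC(F, G)`: for all `f, g ∈ C`, if `g ∈ [f̄G(f)]` then `F(g) ≤ G(f)`. -/
def LOC (F G : Term Γ Ty.two) : Form Γ :=
  Form.all Ty.one (Form.all Ty.one (inCantor v1 ⟹ inCantor v0 ⟹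
    inCylinder v0 v1 (G.wk.wk ⬝ v1) ⟹ le (F.wk.wk ⬝ v0) (G.wk.wk ⬝ v1)))

/-- `PIT_u`: for every `G` there is `N` such that every `F` with `LOC(F, G)` is bounded by `N` on
Cantor space. -/
def PITu : Sentence :=
  Form.all Ty.two (Form.ex Ty.nat (Form.all Ty.two
    (LOC v0 v2 ⟹ Form.all Ty.one (inCantor v0 ⟹ le (v1 ⬝ v0) v2))))

end Principles

end HigherOrderRM

namespace HigherOrderRM

/-! ## Renaming and substitution calculus -/

/-! Derivability is reduced to truth. By a completeness theorem (`Proves.of_models`) it suffices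
that the sentence holds in every extensional model of the theory. The models needed are Henkin term
models, with terms identified when they are provably equal at their type; the extensionality axiom
lets application pass to classes. What remains is mathematics inside an arbitrary model, whose
numbers `M.N` may be nonstandard. Induction, recursion and choice apply there only to predicates
with a characteristic function in the model; `Def` expresses this and is closed under the usual
operations because of the combinators. The rationals form the ordered fraction field `K` of `M.N`.
Reals are compared through `st`, their germ in an ultrapower `L` of `K`: equal reals have germs that
differ by at most every `epsL n`, and estimates become linear arithmetic.

`(∃³) → LUB`: the functional `E` gives every second-order formula a characteristic function
(`Def.sat`). So for each `n` one can choose the largest `a` such that some element of the set in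
`[0,1]` is at least `a 2⁻ⁿ`. The rationals `a 2⁻ⁿ` converge to the supremum (`exists_lub`). The
choice runs over numbers only, and `QF-AC^{1,0}` suffices for it.

`LUB → HBU`: take for `φ(x)` that finitely many of the intervals cover `[0,x]`. This is second-order
because one function codes a finite sequence of reals. The interval around the supremum `y` begins
below some covered point and ends beyond `y`, which is absurd unless `1` has been reached
(`covered_of_isLub`).

`HBU → HBU_c`: Cantor space embeds in `[0,1]` by `f ↦ ∑ 3 f(i) 4^(-i-1)`. The difficulty is to
define a radius that respects equality of reals although membership in the Cantor set cannot be
decided. A real is read back as two digit sequences, `lowPath` and `highPath`, with thresholds `5/8`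
and `3/8`. They depend on the representation of the real, but where two admissible sequences split,
the real lies in the middle of the current interval and all later digits are forced, so no third
sequence is possible. The radius interpolates between the radii of the two paths according to the
position of the real in that middle zone (`IsRadius`), and the result depends on the real alone
(`IsRadius.near`). A point of the Cantor set in the interval around `y` lies in the cylinder of one
of the two paths of `y` (`IsRadius.mem_cylinder`), so the paths of the finitely many centres give
the finite sub-covering.

`HBU_c → PIT_u`: each `g` lies in a cylinder of the finite sub-covering, with centre `f` say, and
locality gives `F(g) ≤ G(f)`. A common bound of these finitely many values of `G` does not involve
`F`. -/

theorem Ren.lift_comp {Γ Δ Θ : Ctx} {σ : Ty} (r : Ren Γ Δ) (q : Ren Δ Θ) :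
    (fun τ v => Ren.lift (σ := σ) q τ (Ren.lift r τ v)) = Ren.lift (fun τ v => q τ (r τ v)) := by
  funext τ v; cases v <;> rfl

theorem Ren.lift_id {Γ : Ctx} {σ : Ty} :
    Ren.lift (σ := σ) (fun τ (v : Var Γ τ) => v) = fun _ v => v := by
  funext τ v; cases v <;> rfl

theorem Term.rename_rename {Γ Δ Θ : Ctx} (r : Ren Γ Δ) (q : Ren Δ Θ) {τ : Ty} (t : Term Γ τ) :
    (t.rename r).rename q = t.rename (fun τ v => q τ (r τ v)) := by
  induction t with
  | var v => rfl
  | const c => rfl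
  | app s t hs ht => simp [Term.rename, hs, ht]

theorem Form.rename_rename {Γ Δ Θ : Ctx} (r : Ren Γ Δ) (q : Ren Δ Θ) (φ : Form Γ) :
    (φ.rename r).rename q = φ.rename (fun τ v => q τ (r τ v)) := by
  induction φ generalizing Δ Θ with
  | eq s t => simp [Form.rename, Term.rename_rename]
  | lt s t => simp [Form.rename, Term.rename_rename]
  | falsum => rfl
  | imp φ ψ hφ hψ => simp [Form.rename, hφ, hψ]
  | all σ φ hφ => simp [Form.rename, hφ, Ren.lift_comp]

theorem Term.rename_id {Γ : Ctx} {τ : Ty} (t : Term Γ τ) : t.rename (fun _ v => v) = t := by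
  induction t with
  | var v => rfl
  | const c => rfl
  | app s t hs ht => simp [Term.rename, hs, ht]

theorem Form.rename_id {Γ : Ctx} (φ : Form Γ) : φ.rename (fun _ v => v) = φ := by
  induction φ with
  | eq s t => simp [Form.rename, Term.rename_id]
  | lt s t => simp [Form.rename, Term.rename_id]
  | falsum => rfl
  | imp φ ψ hφ hψ => simp [Form.rename, hφ, hψ]
  | all σ φ hφ => simp [Form.rename, hφ, Ren.lift_id]

theorem Term.subst_rename {Γ Δ Θ : Ctx} (r : Ren Γ Δ) (s : Subst Δ Θ) {τ : Ty} (t : Term Γ τ) :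
    (t.rename r).subst s = t.subst (fun τ v => s τ (r τ v)) := by
  induction t with
  | var v => rfl
  | const c => rfl
  | app s t hs ht => simp [Term.rename, Term.subst, hs, ht]

theorem Subst.lift_ren {Γ Δ Θ : Ctx} {σ : Ty} (r : Ren Γ Δ) (s : Subst Δ Θ) :
    (fun τ v => Subst.lift (σ := σ) s τ (Ren.lift r τ v)) =
      Subst.lift (fun τ v => s τ (r τ v)) := by
  funext τ v; cases v <;> rfl

theorem Form.subst_rename {Γ Δ Θ : Ctx} (r : Ren Γ Δ) (s : Subst Δ Θ) (φ : Form Γ) :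
    (φ.rename r).subst s = φ.subst (fun τ v => s τ (r τ v)) := by
  induction φ generalizing Δ Θ with
  | eq s t => simp [Form.rename, Form.subst, Term.subst_rename]
  | lt s t => simp [Form.rename, Form.subst, Term.subst_rename]
  | falsum => rfl
  | imp φ ψ hφ hψ => simp [Form.rename, Form.subst, hφ, hψ]
  | all σ φ hφ => simp [Form.rename, Form.subst, hφ, Subst.lift_ren]

theorem Term.rename_subst {Γ Δ Θ : Ctx} (s : Subst Γ Δ) (r : Ren Δ Θ) {τ : Ty} (t : Term Γ τ) :
    (t.subst s).rename r = t.subst (fun τ v => (s τ v).rename r) := by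
  induction t with
  | var v => rfl
  | const c => rfl
  | app s t hs ht => simp [Term.rename, Term.subst, hs, ht]

theorem Term.wk_rename {Γ Δ : Ctx} {σ τ : Ty} (r : Ren Γ Δ) (t : Term Γ τ) :
    (t.wk (σ := σ)).rename (Ren.lift r) = (t.rename r).wk := by
  simp only [Term.wk, Term.rename_rename]; rfl

theorem Subst.lift_rename {Γ Δ Θ : Ctx} {σ : Ty} (s : Subst Γ Δ) (r : Ren Δ Θ) :
    (fun τ v => (Subst.lift (σ := σ) s τ v).rename (Ren.lift r)) =
      Subst.lift (fun τ v => (s τ v).rename r) := by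
  funext τ v
  cases v with
  | zero => rfl
  | succ v => exact Term.wk_rename r _

theorem Form.rename_subst {Γ Δ Θ : Ctx} (s : Subst Γ Δ) (r : Ren Δ Θ) (φ : Form Γ) :
    (φ.subst s).rename r = φ.subst (fun τ v => (s τ v).rename r) := by
  induction φ generalizing Δ Θ with
  | eq s t => simp [Form.rename, Form.subst, Term.rename_subst]
  | lt s t => simp [Form.rename, Form.subst, Term.rename_subst]
  | falsum => rfl
  | imp φ ψ hφ hψ => simp [Form.rename, Form.subst, hφ, hψ]
  | all σ φ hφ => simp [Form.rename, Form.subst, hφ, Subst.lift_rename]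

theorem Term.subst_subst {Γ Δ Θ : Ctx} (s : Subst Γ Δ) (q : Subst Δ Θ) {τ : Ty} (t : Term Γ τ) :
    (t.subst s).subst q = t.subst (fun τ v => (s τ v).subst q) := by
  induction t with
  | var v => rfl
  | const c => rfl
  | app s t hs ht => simp [Term.subst, hs, ht]

theorem Subst.lift_subst {Γ Δ Θ : Ctx} {σ : Ty} (s : Subst Γ Δ) (q : Subst Δ Θ) :
    (fun τ v => (Subst.lift (σ := σ) s τ v).subst (Subst.lift q)) =
      Subst.lift (fun τ v => (s τ v).subst q) := by
  funext τ v
  cases v with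
  | zero => rfl
  | succ v => simp [Subst.lift, Term.wk, Term.subst_rename, Term.rename_subst, Ren.weaken]

theorem Form.subst_subst {Γ Δ Θ : Ctx} (s : Subst Γ Δ) (q : Subst Δ Θ) (φ : Form Γ) :
    (φ.subst s).subst q = φ.subst (fun τ v => (s τ v).subst q) := by
  induction φ generalizing Δ Θ with
  | eq s t => simp [Form.subst, Term.subst_subst]
  | lt s t => simp [Form.subst, Term.subst_subst]
  | falsum => rfl
  | imp φ ψ hφ hψ => simp [Form.subst, hφ, hψ]
  | all σ φ hφ => simp [Form.subst, hφ, Subst.lift_subst]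

theorem Term.subst_var {Γ : Ctx} {τ : Ty} (t : Term Γ τ) :
    t.subst (fun _ v => Term.var v) = t := by
  induction t with
  | var v => rfl
  | const c => rfl
  | app s t hs ht => simp [Term.subst, hs, ht]

theorem Form.subst_var {Γ : Ctx} (φ : Form Γ) : φ.subst (fun _ v => Term.var v) = φ := by
  induction φ with
  | eq s t => simp [Form.subst, Term.subst_var]
  | lt s t => simp [Form.subst, Term.subst_var]
  | falsum => rfl
  | imp φ ψ hφ hψ => simp [Form.subst, hφ, hψ]
  | @all Γ σ φ hφ =>
    have : Subst.lift (σ := σ) (fun τ (v : Var Γ τ) => Term.var v) = fun _ v => Term.var v := by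
      funext τ v; cases v <;> rfl
    simp [Form.subst, this, hφ]

theorem Form.inst_rename {Γ Δ : Ctx} {σ : Ty} (r : Ren Γ Δ) (φ : Form (σ :: Γ)) (t : Term Γ σ) :
    (φ.inst t).rename r = (φ.rename (Ren.lift r)).inst (t.rename r) := by
  simp only [Form.inst, Form.rename_subst, Form.subst_rename]
  congr 1; funext τ v; cases v <;> rfl

theorem Form.ofSentence_rename {Γ Δ : Ctx} (r : Ren Γ Δ) (φ : Sentence) :
    (Form.ofSentence φ : Form Γ).rename r = Form.ofSentence φ := by
  simp only [Form.ofSentence, Form.rename_rename]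
  congr 1; funext τ v; cases v

/-- The substitution that sends the most recent variable to `t` and the others along `s`. -/
def Subst.cons {Γ Δ : Ctx} {σ : Ty} (t : Term Δ σ) (s : Subst Γ Δ) : Subst (σ :: Γ) Δ
  | _, Var.zero => t
  | _, Var.succ v => s _ v

/-- This is the shape in which the quantifier case of the truth lemma extends an assignment by one
value. -/
theorem Form.lift_inst {Γ Δ : Ctx} {σ : Ty} (s : Subst Γ Δ) (φ : Form (σ :: Γ)) (t : Term Δ σ) :
    (φ.subst (Subst.lift s)).inst t = φ.subst (Subst.cons t s) := by
  simp only [Form.inst, Form.subst_subst]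
  congr 1; funext τ v
  cases v with
  | zero => rfl
  | succ v =>
    simp only [Subst.lift, Subst.cons, Term.wk, Term.subst_rename]
    exact Term.subst_var _

/-! ## Structural rules -/

namespace Derives

variable {T : Set Sentence}

/-- The renaming must be arbitrary: below a universal introduction the induction hypothesis is used
at the lifted renaming. -/
theorem rename {Γ Δ : Ctx} {H : List (Form Γ)} {φ : Form Γ} (h : Derives T H φ) (r : Ren Γ Δ) :
    Derives T (H.map (Form.rename r)) (φ.rename r) := by
  induction h generalizing Δ with
  | ax h => rw [Form.ofSentence_rename]; exact ax h
  | hyp h => exact hyp (List.mem_map_of_mem h)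
  | impI _ ih => exact impI (ih r)
  | impE _ _ ih ih' => exact impE (ih r) (ih' r)
  | raa _ ih => exact raa (ih r)
  | @allI Γ H σ φ _ ih =>
    refine allI ?_
    have := ih (Ren.lift (σ := σ) r)
    convert this using 1
    simp only [List.map_map]
    congr 1; funext ψ
    simp only [Function.comp, Form.wk, Form.rename_rename]; rfl
  | allE t _ ih => rw [Form.inst_rename]; exact allE _ (ih r)
  | eqRefl t => exact eqRefl _
  | eqSubst φ _ _ ih ih' =>
    rw [Form.inst_rename]
    refine eqSubst _ (ih r) ?_
    rw [← Form.inst_rename]; exact ih' r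

theorem mono {Γ : Ctx} {H H' : List (Form Γ)} {φ : Form Γ} (h : Derives T H φ) (hH : H ⊆ H') :
    Derives T H' φ := by
  induction h with
  | ax h => exact ax h
  | hyp h => exact hyp (hH h)
  | impI _ ih => exact impI (ih (List.cons_subset_cons _ hH))
  | impE _ _ ih ih' => exact impE (ih hH) (ih' hH)
  | raa _ ih => exact raa (ih (List.cons_subset_cons _ hH))
  | allI _ ih => exact allI (ih (List.map_subset _ hH))
  | allE t _ ih => exact allE t (ih hH)
  | eqRefl t => exact eqRefl _
  | eqSubst φ _ _ ih ih' => exact eqSubst φ (ih hH) (ih' hH)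

theorem wk {Γ : Ctx} {H : List (Form Γ)} {φ : Form Γ} {σ : Ty} (h : Derives T H φ) :
    Derives T (H.map (Form.wk (σ := σ))) φ.wk := h.rename _

theorem exfalso {Γ : Ctx} {H : List (Form Γ)} {φ : Form Γ} (h : Derives T H Form.falsum) :
    Derives T H φ := raa (h.mono (List.subset_cons_self _ _))

end Derives

/-! ## Countability of the syntax -/

def Ty.code : Ty → ℕ
  | Ty.nat => 0
  | Ty.arr σ τ => Nat.pair σ.code τ.code + 1

theorem Ty.code_injective : Function.Injective Ty.code := by
  intro σ τ h
  induction σ generalizing τ with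
  | nat => cases τ <;> simp_all [Ty.code]
  | arr σ₁ σ₂ h₁ h₂ =>
    cases τ with
    | nat => simp [Ty.code] at h
    | arr τ₁ τ₂ =>
      simp only [Ty.code, add_left_inj, Nat.pair_eq_pair] at h
      rw [h₁ h.1, h₂ h.2]

instance : Countable Ty := Ty.code_injective.countable

def Var.code : {Γ : Ctx} → {τ : Ty} → Var Γ τ → ℕ
  | _, _, Var.zero => 0
  | _, _, Var.succ v => v.code + 1

theorem Var.code_injective {Γ : Ctx} {τ : Ty} : Function.Injective (Var.code (Γ := Γ) (τ := τ)) := by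
  intro v w h
  induction v with
  | zero => cases w <;> simp_all [Var.code]
  | succ v ih =>
    cases w with
    | zero => simp [Var.code] at h
    | succ w => simp only [Var.code, add_left_inj] at h; rw [ih h]

/-- Within a fixed type the constructor determines the constant, since its type parameters can be
read off from `τ`; they need not be coded. -/
def Const.code : {τ : Ty} → Const τ → ℕ
  | _, Const.zero => 0
  | _, Const.one => 1
  | _, Const.add => 2
  | _, Const.mul => 3
  | _, Const.combK _ _ => 4
  | _, Const.combS _ _ _ => 5
  | _, Const.recursor _ => 6

theorem Const.code_injective {τ : Ty} : Function.Injective (Const.code (τ := τ)) := by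
  intro c d h
  cases c <;> cases d <;> first | rfl | simp [Const.code] at h

/-- The argument type of an application is invisible in the type of the result, so it has to be part
of the code for injectivity. -/
def Term.code {Γ : Ctx} : {τ : Ty} → Term Γ τ → ℕ
  | _, Term.var v => Nat.pair 0 v.code
  | _, Term.const c => Nat.pair 1 c.code
  | _, @Term.app _ σ _ s t => Nat.pair 2 (Nat.pair σ.code (Nat.pair s.code t.code))

theorem Term.code_injective {Γ : Ctx} {τ : Ty} :
    Function.Injective (Term.code (Γ := Γ) (τ := τ)) := by
  intro s t h
  induction s with
  | var v => cases t <;> simp_all [Term.code, Nat.pair_eq_pair, Var.code_injective.eq_iff]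
  | const c => cases t <;> simp_all [Term.code, Nat.pair_eq_pair, Const.code_injective.eq_iff]
  | app a b ha hb =>
    cases t with
    | var _ => simp [Term.code, Nat.pair_eq_pair] at h
    | const _ => simp [Term.code, Nat.pair_eq_pair] at h
    | app c d =>
      simp only [Term.code, Nat.pair_eq_pair, true_and] at h
      obtain ⟨h₁, h₂, h₃⟩ := h
      obtain rfl := Ty.code_injective h₁
      rw [ha h₂, hb h₃]

def Form.code : {Γ : Ctx} → Form Γ → ℕ
  | _, Form.eq s t => Nat.pair 0 (Nat.pair s.code t.code)
  | _, Form.lt s t => Nat.pair 1 (Nat.pair s.code t.code)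
  | _, Form.falsum => Nat.pair 2 0
  | _, Form.imp φ ψ => Nat.pair 3 (Nat.pair φ.code ψ.code)
  | _, Form.all σ φ => Nat.pair 4 (Nat.pair σ.code φ.code)

theorem Form.code_injective {Γ : Ctx} : Function.Injective (Form.code (Γ := Γ)) := by
  intro φ ψ h
  induction φ with
  | eq s t => cases ψ <;> simp_all [Form.code, Nat.pair_eq_pair, Term.code_injective.eq_iff]
  | lt s t => cases ψ <;> simp_all [Form.code, Nat.pair_eq_pair, Term.code_injective.eq_iff]
  | falsum => cases ψ <;> simp_all [Form.code, Nat.pair_eq_pair]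
  | imp a b ha hb =>
    cases ψ with
    | imp c d =>
      simp only [Form.code, Nat.pair_eq_pair, true_and] at h
      rw [ha h.1, hb h.2]
    | _ => simp [Form.code, Nat.pair_eq_pair] at h
  | all σ a ha =>
    cases ψ with
    | all τ c =>
      simp only [Form.code, Nat.pair_eq_pair, true_and] at h
      obtain rfl := Ty.code_injective h.1
      rw [ha h.2]
    | _ => simp [Form.code, Nat.pair_eq_pair] at h

instance {Γ : Ctx} : Countable (Form Γ) := Form.code_injective.countable

end HigherOrderRM

namespace HigherOrderRM

/-! ## Extensional models -/

/-- A structure for `L_ω` in which equality at type `0` is true equality and application is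
extensional. -/
structure Model where
  carrier : Ty → Type
  app {σ τ : Ty} : carrier (σ ⇒ τ) → carrier σ → carrier τ
  const {τ : Ty} : Const τ → carrier τ
  lt : carrier Ty.nat → carrier Ty.nat → Prop
  ext {σ τ : Ty} (f g : carrier (σ ⇒ τ)) : (∀ x, app f x = app g x) → f = g

namespace Model

/-- Assignments of values to the variables of a context. -/
abbrev Env (M : Model) (Γ : Ctx) : Type := ∀ τ : Ty, Var Γ τ → M.carrier τ

variable {M : Model}

def Env.nil : M.Env [] := fun _ v => nomatch v

def Env.cons {Γ : Ctx} {σ : Ty} (x : M.carrier σ) (e : M.Env Γ) : M.Env (σ :: Γ)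
  | _, Var.zero => x
  | _, Var.succ v => e _ v

def Env.tail {Γ : Ctx} {σ : Ty} (e : M.Env (σ :: Γ)) : M.Env Γ := fun _ v => e _ v.succ

@[simp] theorem Env.cons_zero {Γ : Ctx} {σ : Ty} (x : M.carrier σ) (e : M.Env Γ) :
    Env.cons x e σ Var.zero = x := rfl

@[simp] theorem Env.cons_succ {Γ : Ctx} {σ τ : Ty} (x : M.carrier σ) (e : M.Env Γ) (v : Var Γ τ) :
    Env.cons x e τ v.succ = e τ v := rfl

@[simp] theorem Env.tail_cons {Γ : Ctx} {σ : Ty} (x : M.carrier σ) (e : M.Env Γ) :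
    (Env.cons x e).tail = e := rfl

theorem Env.eta {Γ : Ctx} {σ : Ty} (e : M.Env (σ :: Γ)) :
    Env.cons (e σ Var.zero) e.tail = e := by
  funext τ v; cases v <;> rfl

theorem Env.eq_nil (e : M.Env []) : e = Env.nil := by funext τ v; cases v

def eval {Γ : Ctx} (e : M.Env Γ) : {τ : Ty} → Term Γ τ → M.carrier τ
  | _, Term.var v => e _ v
  | _, Term.const c => M.const c
  | _, Term.app s t => M.app (eval e s) (eval e t)

def Sat : {Γ : Ctx} → M.Env Γ → Form Γ → Prop
  | _, e, Form.eq s t => eval e s = eval e t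
  | _, e, Form.lt s t => M.lt (eval e s) (eval e t)
  | _, _, Form.falsum => False
  | _, e, Form.imp φ ψ => Sat e φ → Sat e ψ
  | _, e, Form.all σ φ => ∀ x : M.carrier σ, Sat (Env.cons x e) φ

/-- Truth of a sentence. -/
def Holds (M : Model) (φ : Sentence) : Prop := Sat (M := M) Env.nil φ

section Sat

variable {Γ Δ : Ctx} (e : M.Env Γ)

@[simp] theorem eval_var {τ : Ty} (v : Var Γ τ) : eval e (Term.var v) = e τ v := rfl
@[simp] theorem eval_const {τ : Ty} (c : Const τ) : eval e (Term.const c) = M.const c := rfl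
@[simp] theorem eval_app {σ τ : Ty} (s : Term Γ (σ ⇒ τ)) (t : Term Γ σ) :
    eval e (s ⬝ t) = M.app (eval e s) (eval e t) := rfl

@[simp] theorem sat_eq (s t : Term Γ Ty.nat) : Sat e (s =₀ t) ↔ eval e s = eval e t := Iff.rfl
@[simp] theorem sat_lt (s t : Term Γ Ty.nat) : Sat e (s <₀ t) ↔ M.lt (eval e s) (eval e t) :=
  Iff.rfl
@[simp] theorem sat_falsum : Sat e Form.falsum ↔ False := Iff.rfl
@[simp] theorem sat_imp (φ ψ : Form Γ) : Sat e (φ ⟹ ψ) ↔ (Sat e φ → Sat e ψ) := Iff.rfl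
@[simp] theorem sat_all {σ : Ty} (φ : Form (σ :: Γ)) :
    Sat e (Form.all σ φ) ↔ ∀ x, Sat (Env.cons x e) φ := Iff.rfl
@[simp] theorem sat_neg (φ : Form Γ) : Sat e φ.neg ↔ ¬ Sat e φ := Iff.rfl
@[simp] theorem sat_conj (φ ψ : Form Γ) : Sat e (φ ⩑ ψ) ↔ Sat e φ ∧ Sat e ψ := by
  simp [Form.conj]
@[simp] theorem sat_disj (φ ψ : Form Γ) : Sat e (φ ⩒ ψ) ↔ Sat e φ ∨ Sat e ψ := by
  simp [Form.disj, or_iff_not_imp_left]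
@[simp] theorem sat_iff (φ ψ : Form Γ) : Sat e (φ ⟺ ψ) ↔ (Sat e φ ↔ Sat e ψ) := by
  simp [Form.iff, iff_def]
@[simp] theorem sat_ex {σ : Ty} (φ : Form (σ :: Γ)) :
    Sat e (Form.ex σ φ) ↔ ∃ x, Sat (Env.cons x e) φ := by
  simp [Form.ex]

theorem eval_rename (r : Ren Δ Γ) {τ : Ty} (t : Term Δ τ) :
    eval e (t.rename r) = eval (fun τ v => e τ (r τ v)) t := by
  induction t with
  | var v => rfl
  | const c => rfl
  | app s t hs ht => simp [Term.rename, hs, ht]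

theorem Env.cons_lift {σ : Ty} (r : Ren Δ Γ) (x : M.carrier σ) :
    (fun τ v => Env.cons x e τ (Ren.lift r τ v)) = Env.cons x (fun τ v => e τ (r τ v)) := by
  funext τ v; cases v <;> rfl

theorem sat_rename (r : Ren Δ Γ) (φ : Form Δ) :
    Sat e (φ.rename r) ↔ Sat (fun τ v => e τ (r τ v)) φ := by
  induction φ generalizing Γ with
  | eq s t => simp [Form.rename, eval_rename]
  | lt s t => simp [Form.rename, eval_rename]
  | falsum => rfl
  | imp φ ψ hφ hψ => simp [Form.rename, hφ, hψ]
  | all σ φ hφ => simp [Form.rename, hφ, Env.cons_lift]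

theorem eval_subst (s : Subst Δ Γ) {τ : Ty} (t : Term Δ τ) :
    eval e (t.subst s) = eval (fun τ v => eval e (s τ v)) t := by
  induction t with
  | var v => rfl
  | const c => rfl
  | app s t hs ht => simp [Term.subst, hs, ht]

@[simp] theorem eval_wk {σ τ : Ty} (t : Term Γ τ) (e : M.Env (σ :: Γ)) :
    eval e t.wk = eval e.tail t := eval_rename _ _ _

@[simp] theorem sat_wk {σ : Ty} (φ : Form Γ) (e : M.Env (σ :: Γ)) :
    Sat e φ.wk ↔ Sat e.tail φ := sat_rename _ _ _

@[simp] theorem sat_wkUnder {ρ σ : Ty} (φ : Form (ρ :: Γ)) (x : M.carrier ρ)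
    (e : M.Env (σ :: Γ)) : Sat (Env.cons x e) φ.wkUnder ↔ Sat (Env.cons x e.tail) φ := by
  rw [Form.wkUnder, sat_rename, Env.cons_lift]; rfl

theorem Env.cons_lift_subst {σ : Ty} (s : Subst Δ Γ) (x : M.carrier σ) :
    (fun τ v => eval (Env.cons x e) (Subst.lift s τ v)) =
      Env.cons x (fun τ v => eval e (s τ v)) := by
  funext τ v
  cases v with
  | zero => rfl
  | succ v => simp [Subst.lift]

theorem sat_subst (s : Subst Δ Γ) (φ : Form Δ) :
    Sat e (φ.subst s) ↔ Sat (fun τ v => eval e (s τ v)) φ := by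
  induction φ generalizing Γ with
  | eq s t => simp [Form.subst, eval_subst]
  | lt s t => simp [Form.subst, eval_subst]
  | falsum => rfl
  | imp φ ψ hφ hψ => simp [Form.subst, hφ, hψ]
  | all σ φ hφ => simp [Form.subst, hφ, Env.cons_lift_subst]

@[simp] theorem sat_inst {σ : Ty} (φ : Form (σ :: Γ)) (t : Term Γ σ) :
    Sat e (φ.inst t) ↔ Sat (Env.cons (eval e t) e) φ := by
  rw [Form.inst, sat_subst]
  have : (fun τ v => eval e (Subst.single t τ v)) = Env.cons (eval e t) e := by
    funext τ v; cases v <;> rfl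
  rw [this]

theorem holds_close (φ : Form Γ) : M.Holds (Form.close Γ φ) ↔ ∀ e : M.Env Γ, Sat e φ := by
  induction Γ with
  | nil => exact ⟨fun h e => Env.eq_nil e ▸ h, fun h => h _⟩
  | cons σ Γ ih =>
    rw [Form.close, ih]
    exact ⟨fun h e => Env.eta e ▸ h e.tail (e σ Var.zero), fun h e x => h (Env.cons x e)⟩

/-- Extensionality of the model enters here: pointwise equality is identity, so the axioms for the
combinators become true equations. -/
theorem sat_eqT (τ : Ty) (s t : Term Γ τ) : Sat e (eqT τ s t) ↔ eval e s = eval e t := by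
  induction τ generalizing Γ with
  | nat => rfl
  | arr σ τ _ ih =>
    simp only [eqT, sat_all, ih, eval_app, eval_wk, eval_var, Env.cons_zero, Env.tail_cons]
    exact ⟨M.ext _ _, fun h x => by rw [h]⟩

end Sat

end Model

theorem eqT_subst {Γ Δ : Ctx} (τ : Ty) (a b : Term Γ τ) (s : Subst Γ Δ) :
    (eqT τ a b).subst s = eqT τ (a.subst s) (b.subst s) := by
  induction τ generalizing Γ Δ with
  | nat => rfl
  | arr σ τ _ ih =>
    simp only [eqT, Form.subst, ih, Term.subst, Term.wk, Term.subst_rename, Term.rename_subst]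
    rfl

theorem Term.rename_eq_subst {Γ Δ : Ctx} {τ : Ty} (r : Ren Γ Δ) (t : Term Γ τ) :
    t.rename r = t.subst (fun τ v => Term.var (r τ v)) := by
  induction t with
  | var v => rfl
  | const c => rfl
  | app s t hs ht => simp [Term.rename, Term.subst, hs, ht]

theorem Form.rename_eq_subst {Γ Δ : Ctx} (r : Ren Γ Δ) (φ : Form Γ) :
    φ.rename r = φ.subst (fun τ v => Term.var (r τ v)) := by
  conv_lhs => rw [← Form.subst_var (φ.rename r), Form.subst_rename]

theorem eqT_rename {Γ Δ : Ctx} (τ : Ty) (a b : Term Γ τ) (r : Ren Γ Δ) :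
    (eqT τ a b).rename r = eqT τ (a.rename r) (b.rename r) := by
  simp only [Form.rename_eq_subst, Term.rename_eq_subst, eqT_subst]

namespace Henkin

/-! ## The Henkin construction -/

/-- The context of the first `n` Henkin variables. -/
def ctx (σ : ℕ → Ty) : ℕ → Ctx
  | 0 => []
  | n + 1 => σ n :: ctx σ n

variable {σ : ℕ → Ty}

/-- Each new Henkin variable becomes the most recent one, so earlier variables are shifted once per
stage. -/
def up {n m : ℕ} (h : n ≤ m) : Ren (ctx σ n) (ctx σ m) :=
  fun τ v => Nat.leRecOn (C := fun k => Var (ctx σ k) τ) h (fun w => w.succ) v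

theorem up_self (n : ℕ) : up (σ := σ) (le_refl n) = fun _ v => v := by
  funext τ v; exact Nat.leRecOn_self (C := fun k => Var (ctx σ k) τ) v

theorem up_succ {n m : ℕ} (h : n ≤ m) :
    up (σ := σ) (h.trans m.le_succ) = fun τ v => Ren.weaken τ (up h τ v) := by
  funext τ v; exact Nat.leRecOn_succ (C := fun k => Var (ctx σ k) τ) h v

theorem up_trans {n m k : ℕ} (h : n ≤ m) (h' : m ≤ k) :
    (fun τ v => up (σ := σ) h' τ (up h τ v)) = up (h.trans h') := by
  funext τ v; exact (Nat.leRecOn_trans (C := fun k => Var (ctx σ k) τ) h h' v).symm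

/-- Weakening of formulas along the chain of contexts. -/
def lift {n m : ℕ} (h : n ≤ m) (φ : Form (ctx σ n)) : Form (ctx σ m) := φ.rename (up h)

def liftT {n m : ℕ} (h : n ≤ m) {τ : Ty} (t : Term (ctx σ n) τ) : Term (ctx σ m) τ :=
  t.rename (up h)

theorem lift_self {n : ℕ} (φ : Form (ctx σ n)) : lift (le_refl n) φ = φ := by
  rw [lift, up_self, Form.rename_id]

theorem lift_lift {n m k : ℕ} (h : n ≤ m) (h' : m ≤ k) (φ : Form (ctx σ n)) :
    lift h' (lift h φ) = lift (h.trans h') φ := by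
  simp only [lift, Form.rename_rename, up_trans]

theorem lift_succ {n m : ℕ} (h : n ≤ m) (φ : Form (ctx σ n)) :
    lift (h.trans m.le_succ) φ = (lift h φ).wk := by
  rw [lift, lift, Form.wk, Form.rename_rename, up_succ h]; rfl

theorem liftT_self {n : ℕ} {τ : Ty} (t : Term (ctx σ n) τ) : liftT (le_refl n) t = t := by
  rw [liftT, up_self, Term.rename_id]

theorem liftT_liftT {n m k : ℕ} (h : n ≤ m) (h' : m ≤ k) {τ : Ty} (t : Term (ctx σ n) τ) :
    liftT h' (liftT h t) = liftT (h.trans h') t := by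
  simp only [liftT, Term.rename_rename, up_trans]

open scoped Classical in
/-- Lift a formula to level `n`, if it lives at a level `k ≤ n`. -/
noncomputable def liftAny (n : ℕ) (x : Σ k, Form (ctx σ k)) : Form (ctx σ n) :=
  if h : x.1 ≤ n then lift h x.2 else Form.falsum

open scoped Classical in
noncomputable def liftAnyUnder (n : ℕ) (τ : Ty) (x : Σ k, Form (τ :: ctx σ k)) :
    Form (τ :: ctx σ n) :=
  if h : x.1 ≤ n then x.2.rename (Ren.lift (up h)) else Form.falsum

/-- A sequence `σ` of types, with formulas to be decided and universal formulas to be witnessed,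
that treats every formula along the chain of contexts. -/
theorem exists_schedule : ∃ (σ : ℕ → Ty) (task : ∀ n, Form (ctx σ n))
    (wit : ∀ n, Form (σ n :: ctx σ n)),
    (∀ k (φ : Form (ctx σ k)), ∃ n, ∃ h : k ≤ n, task n = lift h φ) ∧
    (∀ k τ (φ : Form (τ :: ctx σ k)), ∃ n, ∃ h : k ≤ n, ∃ e : τ = σ n,
      wit n = (e ▸ φ).rename (Ren.lift (up h))) := by
  have : Nonempty Ty := ⟨Ty.nat⟩
  obtain ⟨f, hf⟩ := exists_surjective_nat Ty
  -- The stage number is decoded by pairing: its first component fixes the type of the new variable,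
  -- inner components select formulas. The last component is the level `k` of the formula and serves
  -- only to make the stage at least `k`.
  let σ : ℕ → Ty := fun n => f n.unpair.1
  have h1 : Nonempty (Σ k, Form (ctx σ k)) := ⟨⟨0, Form.falsum⟩⟩
  obtain ⟨g, hg⟩ := exists_surjective_nat (Σ k, Form (ctx σ k))
  have h2 : ∀ τ, Nonempty (Σ k, Form (τ :: ctx σ k)) := fun τ => ⟨⟨0, Form.falsum⟩⟩
  choose w hw using fun τ => exists_surjective_nat (Σ k, Form (τ :: ctx σ k))
  refine ⟨σ, fun n => liftAny n (g n.unpair.1),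
    fun n => liftAnyUnder n (σ n) (w (σ n) n.unpair.2.unpair.1), ?_, ?_⟩
  · intro k φ
    obtain ⟨i, hi⟩ := hg ⟨k, φ⟩
    have hk : k ≤ Nat.pair i k := Nat.right_le_pair i k
    refine ⟨Nat.pair i k, hk, ?_⟩
    beta_reduce
    rw [Nat.unpair_pair, hi, liftAny, dif_pos hk]
  · intro k τ φ
    obtain ⟨j, hj⟩ := hf τ
    obtain ⟨i, hi⟩ := hw τ ⟨k, φ⟩
    have hk : k ≤ Nat.pair j (Nat.pair i k) :=
      (Nat.right_le_pair i k).trans (Nat.right_le_pair j _)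
    have e : τ = σ (Nat.pair j (Nat.pair i k)) := by simp [σ, hj]
    refine ⟨_, hk, e, ?_⟩
    -- With the target type generalized, the type equation can be eliminated and the transport
    -- disappears.
    have key : ∀ (ρ : Ty) (e : τ = ρ), liftAnyUnder (Nat.pair j (Nat.pair i k)) ρ (w ρ i) =
        (e ▸ φ : Form (ρ :: ctx σ k)).rename (Ren.lift (up hk)) := by
      rintro ρ rfl
      rw [hi, liftAnyUnder, dif_pos hk]
    rw [← key _ e]
    simp only [Nat.unpair_pair]

end Henkin

end HigherOrderRM

namespace HigherOrderRM

/-! ### Complete chains of assumptions with Henkin witnesses. -/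

namespace Henkin

/-- One of `θ` and its negation can be added by classical logic. If the Henkin implication for a
fresh variable were refutable, then `ψ` would be derivable for that variable, hence also its
generalization, and with it the implication itself. -/
theorem exists_extension {T : Set Sentence} {Γ : Ctx} {σ : Ty} {H : List (Form Γ)}
    (hH : ¬ Derives T H Form.falsum) (θ : Form Γ) (ψ : Form (σ :: Γ)) :
    ∃ H' : List (Form (σ :: Γ)), ¬ Derives T H' Form.falsum ∧ H.map Form.wk ⊆ H' ∧
      (θ.wk ∈ H' ∨ θ.neg.wk ∈ H') ∧ (ψ ⟹ (Form.all σ ψ).wk) ∈ H' := by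
  have decide_step : ∃ K : List (Form Γ), ¬ Derives T K Form.falsum ∧ H ⊆ K ∧
      (θ ∈ K ∨ θ.neg ∈ K) := by
    by_cases h : Derives T (θ :: H) Form.falsum
    · refine ⟨θ.neg :: H, fun h' => hH ?_, by simp, by simp⟩
      exact (Derives.impI h).impE (Derives.raa h')
    · exact ⟨θ :: H, h, by simp, by simp⟩
  obtain ⟨K, hK, hHK, hθ⟩ := decide_step
  refine ⟨(ψ ⟹ (Form.all σ ψ).wk) :: K.map Form.wk, fun h => hK ?_, ?_, ?_, by simp⟩
  · have h1 : Derives T (K.map Form.wk) (Form.neg (ψ ⟹ (Form.all σ ψ).wk)) := Derives.impI h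
    have h2 : Derives T (K.map Form.wk) ψ := by
      refine Derives.raa ((h1.mono (List.subset_cons_self _ _)).impE (Derives.impI ?_))
      refine Derives.exfalso (Derives.impE (φ := ψ) (Derives.hyp ?_) (Derives.hyp ?_)) <;>
        simp [Form.neg]
    have h3 : Derives T (K.map (Form.wk (σ := σ))) (Form.all σ ψ).wk := (Derives.allI h2).wk
    have h4 : Derives T (K.map (Form.wk (σ := σ))) Form.falsum :=
      h1.impE (Derives.impI (h3.mono (List.subset_cons_self _ _)))
    -- The contradiction is still derived in the context with the fresh variable. Generalizing and
    -- instantiating by a closed term, available at every type, returns it to `Γ`.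
    exact (Derives.allI h4).allE (oneT σ)
  · exact fun x hx => List.mem_cons_of_mem _ (List.map_subset _ hHK hx)
  · rcases hθ with h | h
    · exact Or.inl (List.mem_cons_of_mem _ (List.mem_map_of_mem h))
    · exact Or.inr (List.mem_cons_of_mem _ (List.mem_map_of_mem h))

/-- A consistent, complete chain of finite sets of formulas with Henkin witnesses. -/
structure Chain (T : Set Sentence) where
  σ : ℕ → Ty
  H : ∀ n, List (Form (ctx σ n))
  con : ∀ n, ¬ Derives T (H n) Form.falsum
  mono : ∀ n, (H n).map Form.wk ⊆ H (n + 1)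
  decided : ∀ k (φ : Form (ctx σ k)), ∃ n, ∃ h : k ≤ n, (lift h φ ∈ H n ∨ lift h φ.neg ∈ H n)
  witness : ∀ k τ (φ : Form (τ :: ctx σ k)), ∃ n, ∃ h : k ≤ n, ∃ e : τ = σ n,
    ((e ▸ φ).rename (Ren.lift (up h)) ⟹ (lift h (Form.all τ φ)).wk) ∈ H (n + 1)

theorem exists_chain {T : Set Sentence} {φ₀ : Sentence} (h₀ : ¬ Proves T φ₀) :
    ∃ C : Chain T, φ₀.neg ∈ C.H 0 := by
  obtain ⟨σ, task, wit, htask, hwit⟩ := exists_schedule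
  choose next hnext using fun (n : ℕ) (H : {H : List (Form (ctx σ n)) //
    ¬ Derives T H Form.falsum}) => exists_extension H.2 (task n) (wit n)
  let seq : ∀ n, {H : List (Form (ctx σ n)) // ¬ Derives T H Form.falsum} := fun n =>
    Nat.rec ⟨[φ₀.neg], fun h => h₀ (Derives.raa h)⟩
      (fun n H => ⟨next n H, (hnext n H).1⟩) n
  refine ⟨⟨σ, fun n => (seq n).1, fun n => (seq n).2, fun n => (hnext n (seq n)).2.1, ?_, ?_⟩, ?_⟩
  · intro k φ
    obtain ⟨n, h, e⟩ := htask k φ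
    refine ⟨n + 1, h.trans n.le_succ, ?_⟩
    rw [lift_succ h, lift_succ h]
    have := (hnext n (seq n)).2.2.1
    rw [e] at this
    exact this
  · intro k τ φ
    obtain ⟨n, h, e, hw⟩ := hwit k τ φ
    refine ⟨n, h, e, ?_⟩
    have := (hnext n (seq n)).2.2.2
    rw [hw] at this
    subst e
    exact this
  · exact List.mem_singleton_self _

namespace Chain

variable {T : Set Sentence} (C : Chain T)

/-- Truth along the chain. -/
def Prov {n : ℕ} (φ : Form (ctx C.σ n)) : Prop :=
  ∃ m, ∃ h : n ≤ m, Derives T (C.H m) (lift h φ)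

theorem derives_lift {n m : ℕ} (h : n ≤ m) {φ : Form (ctx C.σ n)} (hφ : Derives T (C.H n) φ) :
    Derives T (C.H m) (lift h φ) := by
  induction m, h using Nat.le_induction with
  | base => rwa [lift_self]
  | succ m h ih => rw [lift_succ h]; exact (ih.wk).mono (C.mono m)

variable {C}

theorem Prov.of_derives {n : ℕ} {φ : Form (ctx C.σ n)} (h : Derives T (C.H n) φ) : C.Prov φ :=
  ⟨n, le_refl n, by rwa [lift_self]⟩

theorem prov_lift {n m : ℕ} (h : n ≤ m) {φ : Form (ctx C.σ n)} :
    C.Prov (lift h φ) ↔ C.Prov φ := by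
  constructor
  · rintro ⟨k, hk, d⟩
    rw [lift_lift] at d
    exact ⟨k, _, d⟩
  · rintro ⟨k, hk, d⟩
    refine ⟨max m k, le_max_left _ _, ?_⟩
    rw [lift_lift, ← lift_lift hk (le_max_right _ _)]
    exact C.derives_lift _ d

theorem Prov.common {n : ℕ} {φ ψ : Form (ctx C.σ n)} (h : C.Prov φ) (h' : C.Prov ψ) :
    ∃ m, ∃ h : n ≤ m, Derives T (C.H m) (lift h φ) ∧ Derives T (C.H m) (lift h ψ) := by
  obtain ⟨m, hm, d⟩ := h
  obtain ⟨k, hk, d'⟩ := h'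
  refine ⟨max m k, hm.trans (le_max_left _ _), ?_, ?_⟩
  · rw [← lift_lift hm (le_max_left _ _)]; exact C.derives_lift _ d
  · rw [← lift_lift hk (le_max_right _ _)]; exact C.derives_lift _ d'

theorem Prov.mp {n : ℕ} {φ ψ : Form (ctx C.σ n)} (h : C.Prov (φ ⟹ ψ)) (h' : C.Prov φ) :
    C.Prov ψ := by
  obtain ⟨m, hm, d, d'⟩ := h.common h'
  exact ⟨m, hm, Derives.impE d d'⟩

theorem not_prov_falsum {n : ℕ} : ¬ C.Prov (Form.falsum : Form (ctx C.σ n)) :=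
  fun ⟨m, _, d⟩ => C.con m d

theorem prov_neg {n : ℕ} {φ : Form (ctx C.σ n)} : C.Prov φ.neg ↔ ¬ C.Prov φ := by
  constructor
  · exact fun h h' => not_prov_falsum (h.mp h')
  · intro h
    obtain ⟨m, hm, d⟩ := C.decided n φ
    rcases d with d | d
    · exact absurd ⟨m, hm, Derives.hyp d⟩ h
    · exact ⟨m, hm, Derives.hyp d⟩

theorem prov_imp {n : ℕ} {φ ψ : Form (ctx C.σ n)} :
    C.Prov (φ ⟹ ψ) ↔ (C.Prov φ → C.Prov ψ) := by
  refine ⟨Prov.mp, fun h => ?_⟩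
  by_cases hφ : C.Prov φ
  · obtain ⟨m, hm, d⟩ := h hφ
    exact ⟨m, hm, Derives.impI (d.mono (List.subset_cons_self _ _))⟩
  · obtain ⟨m, hm, d⟩ := prov_neg.2 hφ
    refine ⟨m, hm, Derives.impI (Derives.exfalso ?_)⟩
    exact Derives.impE (d.mono (List.subset_cons_self _ _))
      (Derives.hyp (List.mem_cons_self ..))

theorem Prov.inst {n : ℕ} {τ : Ty} {φ : Form (τ :: ctx C.σ n)} (h : C.Prov (Form.all τ φ))
    (t : Term (ctx C.σ n) τ) : C.Prov (φ.inst t) := by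
  obtain ⟨m, hm, d⟩ := h
  refine ⟨m, hm, ?_⟩
  rw [lift, Form.inst_rename]
  exact Derives.allE _ d

/-- The instance that matters is the one at the variable introduced at the witnessing stage: the
stored implication turns it into the universal statement. -/
theorem prov_all {n : ℕ} {τ : Ty} {φ : Form (τ :: ctx C.σ n)}
    (h : ∀ m (h : n ≤ m) (t : Term (ctx C.σ m) τ),
      C.Prov ((φ.rename (Ren.lift (up h))).inst t)) : C.Prov (Form.all τ φ) := by
  obtain ⟨m, hm, rfl, hw⟩ := C.witness n τ φ
  have h1 := h (m + 1) (hm.trans m.le_succ) (Term.var Var.zero)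
  have e : (φ.rename (Ren.lift (up (hm.trans m.le_succ)))).inst (Term.var Var.zero) =
      φ.rename (Ren.lift (up hm)) := by
    rw [Form.inst, Form.subst_rename, Form.rename_eq_subst]
    congr 1; funext ρ v
    cases v with
    | zero => rfl
    | succ v => rw [up_succ hm]; rfl
  rw [e] at h1
  have h2 : C.Prov (n := m + 1) (lift hm (Form.all (C.σ m) φ)).wk :=
    (Prov.of_derives (Derives.hyp hw)).mp h1
  rwa [← lift_succ hm, prov_lift] at h2

theorem Prov.of_axiom {n : ℕ} {φ : Sentence} (h : φ ∈ T) :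
    C.Prov (Form.ofSentence φ : Form (ctx C.σ n)) := Prov.of_derives (Derives.ax h)

theorem prov_refl {n : ℕ} (t : Term (ctx C.σ n) Ty.nat) : C.Prov (t =₀ t) :=
  Prov.of_derives (Derives.eqRefl t)

theorem Prov.eqSubst {n : ℕ} {s t : Term (ctx C.σ n) Ty.nat} (φ : Form (Ty.nat :: ctx C.σ n))
    (h : C.Prov (s =₀ t)) (h' : C.Prov (φ.inst s)) : C.Prov (φ.inst t) := by
  obtain ⟨m, hm, d, d'⟩ := h.common h'
  refine ⟨m, hm, ?_⟩
  rw [lift, Form.inst_rename] at d' ⊢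
  exact Derives.eqSubst _ d d'

theorem wk_inst {Γ : Ctx} {σ τ : Ty} (t : Term Γ τ) (a : Term Γ σ) :
    t.wk.subst (Subst.single a) = t := by
  rw [Term.wk, Term.subst_rename]; exact Term.subst_var t

theorem wk_lift {Γ Δ : Ctx} {σ τ : Ty} (t : Term Γ τ) (s : Subst Γ Δ) :
    (t.wk (σ := σ)).subst (Subst.lift s) = (t.subst s).wk := by
  rw [Term.wk, Term.wk, Term.subst_rename, Term.rename_subst]; rfl

theorem Prov.eq_symm {n : ℕ} {s t : Term (ctx C.σ n) Ty.nat} (h : C.Prov (s =₀ t)) :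
    C.Prov (t =₀ s) := by
  have := h.eqSubst (v0 =₀ s.wk)
  simp only [Form.inst, Form.subst, wk_inst] at this
  exact this (prov_refl s)

theorem Prov.eq_trans {n : ℕ} {s t u : Term (ctx C.σ n) Ty.nat} (h : C.Prov (s =₀ t))
    (h' : C.Prov (t =₀ u)) : C.Prov (s =₀ u) := by
  have := h'.eqSubst (s.wk =₀ v0)
  simp only [Form.inst, Form.subst, wk_inst] at this
  exact this h

theorem Prov.lt_congr {n : ℕ} {s s' t t' : Term (ctx C.σ n) Ty.nat} (h : C.Prov (s =₀ s'))
    (h' : C.Prov (t =₀ t')) (hl : C.Prov (s <₀ t)) : C.Prov (s' <₀ t') := by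
  have h1 := h.eqSubst (v0 <₀ t.wk)
  have h2 := h'.eqSubst (s'.wk <₀ v0)
  simp only [Form.inst, Form.subst, wk_inst] at h1 h2
  exact h2 (h1 hl)

theorem Prov.eqT_app_left {n : ℕ} {σ τ : Ty} {f g : Term (ctx C.σ n) (σ ⇒ τ)}
    (h : C.Prov (eqT (σ ⇒ τ) f g)) (a : Term (ctx C.σ n) σ) : C.Prov (eqT τ (f ⬝ a) (g ⬝ a)) := by
  have := Prov.inst (φ := eqT τ (f.wk ⬝ v0) (g.wk ⬝ v0)) h a
  simp only [Form.inst, eqT_subst, Term.subst, wk_inst] at this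
  exact this

theorem prov_eqT_arr {n : ℕ} {σ τ : Ty} {f g : Term (ctx C.σ n) (σ ⇒ τ)}
    (h : ∀ m (h : n ≤ m) (a : Term (ctx C.σ m) σ),
      C.Prov (eqT τ (liftT h f ⬝ a) (liftT h g ⬝ a))) : C.Prov (eqT (σ ⇒ τ) f g) := by
  refine prov_all fun m hm a => ?_
  have := h m hm a
  simp only [Form.inst, eqT_subst, eqT_rename, Term.rename, Term.subst, Term.wk_rename, wk_inst]
  exact this

theorem prov_eqT_lift {n m : ℕ} (h : n ≤ m) {τ : Ty} {s t : Term (ctx C.σ n) τ} :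
    C.Prov (eqT τ (liftT h s) (liftT h t)) ↔ C.Prov (eqT τ s t) := by
  rw [← prov_lift h, lift, eqT_rename]; rfl

theorem prov_eqT_refl {n : ℕ} (τ : Ty) (t : Term (ctx C.σ n) τ) : C.Prov (eqT τ t t) := by
  induction τ generalizing n with
  | nat => exact prov_refl t
  | arr σ τ _ ih => exact prov_eqT_arr fun m h a => ih _

theorem Prov.eqT_symm {n : ℕ} {τ : Ty} {s t : Term (ctx C.σ n) τ} (h : C.Prov (eqT τ s t)) :
    C.Prov (eqT τ t s) := by
  induction τ generalizing n with
  | nat => exact h.eq_symm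
  | arr σ τ _ ih =>
    exact prov_eqT_arr fun m hm a => ih (((prov_eqT_lift hm).2 h).eqT_app_left a)

theorem Prov.eqT_trans {n : ℕ} {τ : Ty} {s t u : Term (ctx C.σ n) τ} (h : C.Prov (eqT τ s t))
    (h' : C.Prov (eqT τ t u)) : C.Prov (eqT τ s u) := by
  induction τ generalizing n with
  | nat => exact Prov.eq_trans h h'
  | arr σ τ _ ih =>
    exact prov_eqT_arr fun m hm a => ih (((prov_eqT_lift hm).2 h).eqT_app_left a)
      (((prov_eqT_lift hm).2 h').eqT_app_left a)

/-- The extensionality axiom is the only axiom of the base theory on which the construction of the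
term model depends. -/
theorem Prov.eqT_app_right (hT : RCA0omega ⊆ T) {n : ℕ} {σ τ : Ty} {a b : Term (ctx C.σ n) σ}
    (h : C.Prov (eqT σ a b)) (f : Term (ctx C.σ n) (σ ⇒ τ)) :
    C.Prov (eqT τ (f ⬝ a) (f ⬝ b)) := by
  have h1 := Prov.of_axiom (C := C) (n := n) (hT (IsRCAAxiom.ext σ τ))
  have h2 := ((h1.inst a).inst b).inst f
  simp only [Form.rename, eqT_rename, Form.inst, Form.subst, eqT_subst, Term.rename,
    Term.subst] at h2
  refine Prov.mp ?_ h
  convert h2 using 1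
  simp [Ren.lift, Subst.lift, Subst.single, wk_lift, wk_inst, Term.subst]

theorem Prov.eqT_app (hT : RCA0omega ⊆ T) {n : ℕ} {σ τ : Ty} {a b : Term (ctx C.σ n) σ}
    {f g : Term (ctx C.σ n) (σ ⇒ τ)} (hf : C.Prov (eqT (σ ⇒ τ) f g))
    (h : C.Prov (eqT σ a b)) : C.Prov (eqT τ (f ⬝ a) (g ⬝ b)) :=
  (hf.eqT_app_left a).eqT_trans (h.eqT_app_right hT g)

end Chain

end Henkin

end HigherOrderRM

namespace HigherOrderRM

/-! ### The term model and the truth lemma. -/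

namespace Henkin

namespace Chain

variable {T : Set Sentence} (C : Chain T)

/-- Provable equality of two terms, compared at a common level of the chain. -/
def Rel (τ : Ty) (a b : Σ n, Term (ctx C.σ n) τ) : Prop :=
  ∃ k, ∃ (h : a.1 ≤ k) (h' : b.1 ≤ k), C.Prov (eqT τ (liftT h a.2) (liftT h' b.2))

variable {C}

/-- Provability along the chain is invariant under lifting, so the level of comparison does not
matter. -/
theorem rel_iff {τ : Ty} {a b : Σ n, Term (ctx C.σ n) τ} {k : ℕ} (h : a.1 ≤ k) (h' : b.1 ≤ k) :
    C.Rel τ a b ↔ C.Prov (eqT τ (liftT h a.2) (liftT h' b.2)) := by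
  refine ⟨?_, fun p => ⟨k, h, h', p⟩⟩
  rintro ⟨m, hm, hm', p⟩
  rw [← prov_eqT_lift (le_max_left k m), liftT_liftT, liftT_liftT]
  rw [← prov_eqT_lift (le_max_right k m), liftT_liftT, liftT_liftT] at p
  exact p

variable (C)

def setoid (τ : Ty) : Setoid (Σ n, Term (ctx C.σ n) τ) where
  r := C.Rel τ
  iseqv := {
    refl := fun a => ⟨a.1, le_refl _, le_refl _, prov_eqT_refl _ _⟩
    symm := fun ⟨k, h, h', p⟩ => ⟨k, h', h, p.eqT_symm⟩
    trans := by
      intro a b c h h'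
      let k := max a.1 (max b.1 c.1)
      have ha : a.1 ≤ k := le_max_left _ _
      have hb : b.1 ≤ k := (le_max_left _ _).trans (le_max_right _ _)
      have hc : c.1 ≤ k := (le_max_right _ _).trans (le_max_right _ _)
      exact (rel_iff ha hc).2 (((rel_iff ha hb).1 h).eqT_trans ((rel_iff hb hc).1 h')) }

/-- The class of a term. -/
def cls {n : ℕ} {τ : Ty} (t : Term (ctx C.σ n) τ) : Quotient (C.setoid τ) :=
  Quotient.mk (C.setoid τ) ⟨n, t⟩

variable {C}

theorem cls_eq {n : ℕ} {τ : Ty} {s t : Term (ctx C.σ n) τ} :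
    C.cls s = C.cls t ↔ C.Prov (eqT τ s t) := by
  rw [cls, cls, Quotient.eq]
  have := rel_iff (C := C) (a := ⟨n, s⟩) (b := ⟨n, t⟩) (le_refl n) (le_refl n)
  rw [liftT_self, liftT_self] at this
  exact this

theorem cls_lift {n m : ℕ} (h : n ≤ m) {τ : Ty} (t : Term (ctx C.σ n) τ) :
    C.cls (liftT h t) = C.cls t := by
  rw [cls, cls, Quotient.eq]
  refine ⟨m, le_refl m, h, ?_⟩
  rw [liftT_self]
  exact prov_eqT_refl _ _

theorem cls_surj {τ : Ty} (x : Quotient (C.setoid τ)) (n : ℕ) :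
    ∃ m, ∃ _ : n ≤ m, ∃ t : Term (ctx C.σ m) τ, C.cls t = x := by
  obtain ⟨⟨k, t⟩, rfl⟩ := Quotient.exists_rep x
  exact ⟨max n k, le_max_left _ _, liftT (le_max_right _ _) t, cls_lift _ _⟩

theorem liftT_app {n m : ℕ} (h : n ≤ m) {σ τ : Ty} (f : Term (ctx C.σ n) (σ ⇒ τ))
    (a : Term (ctx C.σ n) σ) : liftT h (f ⬝ a) = liftT h f ⬝ liftT h a := rfl

variable (C)

def appClass (hT : RCA0omega ⊆ T) {σ τ : Ty} :
    Quotient (C.setoid (σ ⇒ τ)) → Quotient (C.setoid σ) → Quotient (C.setoid τ) :=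
  Quotient.lift₂
    (fun a b => C.cls (liftT (le_max_left a.1 b.1) a.2 ⬝ liftT (le_max_right a.1 b.1) b.2)) <| by
    intro a b a' b' h h'
    let m := max (max a.1 b.1) (max a'.1 b'.1)
    have hm : max a.1 b.1 ≤ m := le_max_left _ _
    have hm' : max a'.1 b'.1 ≤ m := le_max_right _ _
    rw [← cls_lift hm, ← cls_lift hm', cls_eq, liftT_app, liftT_app]
    simp only [liftT_liftT]
    exact Prov.eqT_app hT ((rel_iff _ _).1 h) ((rel_iff _ _).1 h')

theorem appClass_cls (hT : RCA0omega ⊆ T) {n : ℕ} {σ τ : Ty} (f : Term (ctx C.σ n) (σ ⇒ τ))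
    (a : Term (ctx C.σ n) σ) : C.appClass hT (C.cls f) (C.cls a) = C.cls (f ⬝ a) := by
  change C.cls (liftT (le_max_left n n) f ⬝ liftT (le_max_right n n) a) = _
  rw [← cls_lift (le_max_left n n) (f ⬝ a)]
  rfl

def ltClass : Quotient (C.setoid Ty.nat) → Quotient (C.setoid Ty.nat) → Prop :=
  Quotient.lift₂
    (fun a b => C.Prov (liftT (le_max_left a.1 b.1) a.2 <₀ liftT (le_max_right a.1 b.1) b.2)) <| by
    have key : ∀ a b a' b', C.Rel Ty.nat a a' → C.Rel Ty.nat b b' →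
        C.Prov (liftT (le_max_left a.1 b.1) a.2 <₀ liftT (le_max_right a.1 b.1) b.2) →
        C.Prov (liftT (le_max_left a'.1 b'.1) a'.2 <₀ liftT (le_max_right a'.1 b'.1) b'.2) := by
      intro a b a' b' h h' p
      let m := max (max a.1 b.1) (max a'.1 b'.1)
      have hm : max a.1 b.1 ≤ m := le_max_left _ _
      have hm' : max a'.1 b'.1 ≤ m := le_max_right _ _
      rw [← prov_lift hm] at p
      rw [← prov_lift hm']
      have e1 := (rel_iff ((le_max_left _ _).trans hm) ((le_max_left _ _).trans hm')).1 h
      have e2 := (rel_iff ((le_max_right _ _).trans hm) ((le_max_right _ _).trans hm')).1 h'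
      rw [← liftT_liftT (le_max_left a.1 b.1) hm,
        ← liftT_liftT (le_max_left a'.1 b'.1) hm'] at e1
      rw [← liftT_liftT (le_max_right a.1 b.1) hm,
        ← liftT_liftT (le_max_right a'.1 b'.1) hm'] at e2
      exact Prov.lt_congr e1 e2 p
    intro a b a' b' h h'
    exact propext ⟨key _ _ _ _ h h',
      key _ _ _ _ ((C.setoid _).symm h) ((C.setoid _).symm h')⟩

theorem ltClass_cls {n : ℕ} (s t : Term (ctx C.σ n) Ty.nat) :
    C.ltClass (C.cls s) (C.cls t) ↔ C.Prov (s <₀ t) := by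
  change C.Prov (liftT (le_max_left n n) s <₀ liftT (le_max_right n n) t) ↔ _
  rw [← prov_lift (le_max_left n n) (φ := s <₀ t)]
  rfl

/-- The term model, modulo provable extensional equality. -/
def model (hT : RCA0omega ⊆ T) : Model where
  carrier τ := Quotient (C.setoid τ)
  app := C.appClass hT
  const c := C.cls (n := 0) (Term.const c)
  lt := C.ltClass
  -- Both functions are represented at one level. Agreement on the classes of all later terms then
  -- amounts to provable equality, by the Henkin property of the chain.
  ext := by
    intro σ τ f g h
    obtain ⟨n, -, f, rfl⟩ := cls_surj f 0
    obtain ⟨m, hm, g, rfl⟩ := cls_surj g n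
    rw [← cls_lift hm] at h ⊢
    rw [cls_eq]
    refine prov_eqT_arr fun k hk a => ?_
    have := h (C.cls a)
    rw [← cls_lift hk, ← cls_lift hk g, appClass_cls, appClass_cls, cls_eq] at this
    exact this

variable (hT : RCA0omega ⊆ T)

/-- The assignment given by a substitution. -/
def env {Δ : Ctx} {n : ℕ} (s : Subst Δ (ctx C.σ n)) : (C.model hT).Env Δ :=
  fun τ v => C.cls (s τ v)

variable {C}

theorem eval_env {Δ : Ctx} {n : ℕ} (s : Subst Δ (ctx C.σ n)) {τ : Ty} (t : Term Δ τ) :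
    Model.eval (C.env hT s) t = C.cls (t.subst s) := by
  induction t with
  | var v => rfl
  | const c => exact (cls_lift (Nat.zero_le n) (Term.const c)).symm
  | app f a hf ha =>
    rw [Model.eval_app, hf, ha]
    exact appClass_cls C hT _ _

/-- The truth lemma. Assignments are substitutions of chain terms, so that the induction passes
quantifiers: a value represented at a later level forces only a lift of the substitution. -/
theorem sat_env {Δ : Ctx} (φ : Form Δ) {n : ℕ} (s : Subst Δ (ctx C.σ n)) :
    Model.Sat (C.env hT s) φ ↔ C.Prov (φ.subst s) := by
  induction φ generalizing n with
  | eq a b => rw [Model.sat_eq, eval_env, eval_env]; exact cls_eq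
  | lt a b => rw [Model.sat_lt, eval_env, eval_env]; exact ltClass_cls C _ _
  | falsum => exact ⟨False.elim, not_prov_falsum⟩
  | imp φ ψ hφ hψ => rw [Model.sat_imp, hφ, hψ]; exact prov_imp.symm
  | @all Δ σ φ ih =>
    have env : ∀ m (h : n ≤ m) (t : Term (ctx C.σ m) σ),
        (Model.Env.cons (M := C.model hT) (C.cls t) (C.env hT s)) =
          C.env hT (Subst.cons t (fun τ v => liftT h (s τ v))) := by
      intro m h t
      funext τ v
      cases v with
      | zero => rfl
      | succ v => exact (cls_lift h _).symm
    have inst : ∀ m (h : n ≤ m) (t : Term (ctx C.σ m) σ),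
        ((φ.subst (Subst.lift s)).rename (Ren.lift (up h))).inst t =
          φ.subst (Subst.cons t (fun τ v => liftT h (s τ v))) := by
      intro m h t
      rw [Form.rename_subst, Subst.lift_rename, Form.lift_inst]
      rfl
    constructor
    · intro h
      refine prov_all fun m hm t => ?_
      rw [inst, ← ih, ← env]
      exact h (C.cls t)
    · intro h x
      obtain ⟨m, hm, t, rfl⟩ := cls_surj x n
      rw [env m hm t, ih, ← inst]
      exact Prov.inst ((prov_lift hm).2 h) t

theorem holds_model (φ : Sentence) : (C.model hT).Holds φ ↔ C.Prov (n := 0) φ := by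
  let s : Subst [] (ctx C.σ 0) := fun _ v => nomatch v
  have := sat_env (C := C) hT φ s
  have e : φ.subst s = φ := by
    conv_rhs => rw [← Form.subst_var φ]
    congr 1; funext τ v; cases v
  rw [e] at this
  rw [← this, Model.Holds, Model.Env.eq_nil (C.env hT s)]

end Chain

end Henkin

/-- Completeness for extensional models. -/
theorem Proves.of_models {T : Set Sentence} (hT : RCA0omega ⊆ T) {φ : Sentence}
    (h : ∀ M : Model, (∀ ψ ∈ T, M.Holds ψ) → M.Holds φ) : Proves T φ := by
  by_contra hφ
  obtain ⟨C, hC⟩ := Henkin.exists_chain hφ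
  have h1 : C.Prov (n := 0) φ.neg := Henkin.Chain.Prov.of_derives (Derives.hyp hC)
  -- The negation of the unprovable sentence belongs to the chain from stage `0`, so the sentence
  -- would be both true and false in the term model.
  refine Henkin.Chain.prov_neg.1 h1 ((Henkin.Chain.holds_model hT φ).1 (h _ fun ψ hψ => ?_))
  rw [Henkin.Chain.holds_model hT]
  have := Henkin.Chain.Prov.of_axiom (C := C) (n := 0) hψ
  have e : (Form.ofSentence ψ : Form []) = ψ := by
    conv_rhs => rw [← Form.rename_id ψ]
    rw [Form.ofSentence]
    congr 1; funext τ v; cases v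
  rwa [← e]

end HigherOrderRM

namespace HigherOrderRM

namespace Model

/-! ## Models of `RCA₀^ω`: internal functions -/

/-- The model satisfies `RCA₀^ω`. -/
class IsRCA (M : Model) : Prop where
  holds : ∀ φ ∈ RCA0omega, M.Holds φ

/-- The numbers of the model. -/
abbrev N (M : Model) : Type := M.carrier Ty.nat

variable {M : Model}

instance {σ τ : Ty} : CoeFun (M.carrier (σ ⇒ τ)) (fun _ => M.carrier σ → M.carrier τ) := ⟨M.app⟩

instance {τ : Ty} : Nonempty (M.carrier τ) := ⟨eval Env.nil (oneT τ)⟩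

/-- The functions of the variables in `Γ` that are built from variables and elements of the model
by application. -/
inductive Internal : {Γ : Ctx} → {τ : Ty} → (M.Env Γ → M.carrier τ) → Prop
  | var {Γ : Ctx} {τ : Ty} (v : Var Γ τ) : Internal (fun e => e τ v)
  | const {Γ : Ctx} {τ : Ty} (c : M.carrier τ) : Internal (fun _ : M.Env Γ => c)
  | app {Γ : Ctx} {σ τ : Ty} {F : M.Env Γ → M.carrier (σ ⇒ τ)} {G : M.Env Γ → M.carrier σ} :
      Internal F → Internal G → Internal (fun e => M.app (F e) (G e))

theorem Internal.reindex {Γ Δ : Ctx} {τ : Ty} {F : M.Env Γ → M.carrier τ} (hF : Internal F)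
    {g : M.Env Δ → M.Env Γ} (hg : ∀ τ v, Internal (fun e => g e τ v)) :
    Internal (fun e => F (g e)) := by
  induction hF with
  | var v => exact hg _ v
  | const c => exact .const c
  | app _ _ ih ih' => exact .app ih ih'

open scoped Classical in
/-- The element of the model that represents an internal function. -/
noncomputable def lam {σ τ : Ty} (f : M.carrier σ → M.carrier τ) : M.carrier (σ ⇒ τ) :=
  if h : ∃ g : M.carrier (σ ⇒ τ), ∀ x, g x = f x then h.choose else Classical.arbitrary _

theorem lam_eq {σ τ : Ty} {f : M.carrier σ → M.carrier τ} {g : M.carrier (σ ⇒ τ)}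
    (h : ∀ x, g x = f x) : lam f = g := by
  have h' : ∃ g : M.carrier (σ ⇒ τ), ∀ x, g x = f x := ⟨g, h⟩
  rw [lam, dif_pos h']
  exact M.ext _ _ fun x => (h'.choose_spec x).trans (h x).symm

section IsRCA

variable [hM : M.IsRCA]

theorem eval_combK {Γ : Ctx} (e : M.Env Γ) {σ τ : Ty} (x : M.carrier σ) (y : M.carrier τ) :
    eval e (combK : Term Γ (σ ⇒ τ ⇒ σ)) x y = x := by
  have := hM.holds _ (IsRCAAxiom.combK σ τ) x y
  rw [sat_eqT] at this
  exact this

theorem eval_combS {Γ : Ctx} (e : M.Env Γ) {ρ σ τ : Ty} (x : M.carrier (ρ ⇒ σ ⇒ τ))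
    (y : M.carrier (ρ ⇒ σ)) (z : M.carrier ρ) :
    eval e (combS : Term Γ ((ρ ⇒ σ ⇒ τ) ⇒ (ρ ⇒ σ) ⇒ ρ ⇒ τ)) x y z = x z (y z) := by
  have := hM.holds _ (IsRCAAxiom.combS ρ σ τ) x y z
  rw [sat_eqT] at this
  exact this

theorem eval_lam_app {Γ : Ctx} (e : M.Env Γ) {σ τ : Ty} (t : Term (σ :: Γ) τ) (x : M.carrier σ) :
    eval e (HigherOrderRM.lam t) x = eval (Env.cons x e) t := by
  match t with
  | Term.var Var.zero => simp [HigherOrderRM.lam, eval_combS, eval_combK]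
  | Term.var (Var.succ v) => simp [HigherOrderRM.lam, eval_combK]
  | Term.const c => simp [HigherOrderRM.lam, eval_combK]
  | Term.app s t =>
    simp [HigherOrderRM.lam, eval_combS, eval_lam_app e s x, eval_lam_app e t x]

/-- Combinatory completeness, by bracket abstraction along the construction of `F`: `combS` handles
applications, and `combK` handles constants and the other variables. -/
theorem Internal.curry {Γ : Ctx} {σ τ : Ty} {F : M.Env (σ :: Γ) → M.carrier τ}
    (hF : Internal F) :
    ∃ H : M.Env Γ → M.carrier (σ ⇒ τ), Internal H ∧ ∀ e x, H e x = F (Env.cons x e) := by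
  induction hF with
  | var v =>
    cases v with
    | zero =>
      exact ⟨fun _ => eval Env.nil (HigherOrderRM.lam v0), .const _, fun e x => eval_lam_app _ _ _⟩
    | succ v =>
      exact ⟨fun e => eval Env.nil (combK : Term [] _) (e _ v), .app (.const _) (.var v),
        fun e x => eval_combK _ _ _⟩
  | const c =>
    exact ⟨fun e => eval Env.nil (combK : Term [] _) c, .const _, fun e x => eval_combK _ _ _⟩
  | app _ _ ih ih' =>
    obtain ⟨A, hA, eA⟩ := ih
    obtain ⟨B, hB, eB⟩ := ih'
    refine ⟨fun e => eval Env.nil (combS : Term [] _) (A e) (B e),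
      .app (.app (.const _) hA) hB, fun e x => ?_⟩
    rw [eval_combS, eA, eB]

theorem eval_lam {Γ : Ctx} (e : M.Env Γ) {σ τ : Ty} (t : Term (σ :: Γ) τ) :
    eval e (HigherOrderRM.lam t) = lam (fun x => eval (Env.cons x e) t) :=
  (lam_eq (eval_lam_app e t)).symm

end IsRCA

/-- Types with a distinguished class of parametrizations by the variables of a context. -/
class Obj (M : Model) (α : Type) where
  Plot : {Γ : Ctx} → (M.Env Γ → α) → Prop
  const : ∀ {Γ : Ctx} (a : α), Plot (fun _ : M.Env Γ => a)
  reindex : ∀ {Γ Δ : Ctx} {c : M.Env Γ → α}, Plot c → ∀ {g : M.Env Δ → M.Env Γ},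
    (∀ τ v, Internal (fun e => g e τ v)) → Plot (fun e => c (g e))

instance {τ : Ty} : Obj M (M.carrier τ) where
  Plot := Internal
  const := .const
  reindex := .reindex

instance {α β : Type} [Obj M α] [Obj M β] : Obj M (α × β) where
  Plot c := Obj.Plot (fun e => (c e).1) ∧ Obj.Plot (fun e => (c e).2)
  const a := ⟨Obj.const a.1, Obj.const a.2⟩
  reindex h _ hg := ⟨Obj.reindex h.1 hg, Obj.reindex h.2 hg⟩

/-- A function is internal if it maps plots to plots. -/
@[fun_prop] structure Def (M : Model) {α β : Type} [Obj M α] [Obj M β] (f : α → β) : Prop where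
  plot : ∀ {Γ : Ctx} {c : M.Env Γ → α}, Obj.Plot c → Obj.Plot (fun e => f (c e))

section Def

variable {α β γ : Type} [Obj M α] [Obj M β] [Obj M γ]

@[fun_prop] theorem Def.id : Def M (fun a : α => a) := ⟨fun h => h⟩

@[fun_prop] theorem Def.const (b : β) : Def M (fun _ : α => b) := ⟨fun _ => Obj.const b⟩

@[fun_prop] theorem Def.comp {f : β → γ} {g : α → β} (hf : Def M f) (hg : Def M g) :
    Def M (fun a => f (g a)) := ⟨fun h => hf.plot (hg.plot h)⟩

@[fun_prop] theorem Def.prodMk {f : α → β} {g : α → γ} (hf : Def M f) (hg : Def M g) :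
    Def M (fun a => (f a, g a)) := ⟨fun h => ⟨hf.plot h, hg.plot h⟩⟩

@[fun_prop] theorem Def.fst : Def M (fun p : α × β => p.1) := ⟨fun h => h.1⟩

@[fun_prop] theorem Def.snd : Def M (fun p : α × β => p.2) := ⟨fun h => h.2⟩

@[fun_prop] theorem Def.app {σ τ : Ty} {F : α → M.carrier (σ ⇒ τ)} {G : α → M.carrier σ}
    (hF : Def M F) (hG : Def M G) : Def M (fun a => M.app (F a) (G a)) :=
  ⟨fun h => .app (hF.plot h) (hG.plot h)⟩

@[fun_prop] theorem Def.lam [M.IsRCA] {σ τ : Ty} {F : α → M.carrier σ → M.carrier τ}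
    (hF : Def M (fun p : α × M.carrier σ => F p.1 p.2)) :
    Def M (fun a => Model.lam (fun x => F a x)) := by
  refine ⟨fun {Γ c} hc => ?_⟩
  have hc' : Obj.Plot (fun e : M.Env (σ :: Γ) => (c e.tail, e σ Var.zero)) :=
    ⟨Obj.reindex hc fun τ v => .var v.succ, .var Var.zero⟩
  obtain ⟨H, hH, e⟩ := Internal.curry (hF.plot hc')
  have : (fun e => Model.lam (fun x => F (c e) x)) = H := by
    funext a; exact lam_eq (e a)
  show Internal (fun e => Model.lam (fun x => F (c e) x))
  rw [this]; exact hH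

/-- The beta rule needs internality, since `Model.lam` is an arbitrary element when no element of
the model represents the function. -/
theorem lam_app [M.IsRCA] {σ τ : Ty} {F : M.carrier σ → M.carrier τ} (hF : Def M F)
    (x : M.carrier σ) : Model.lam F x = F x := by
  obtain ⟨H, -, e⟩ := Internal.curry (hF.plot (Internal.var (Γ := [σ]) Var.zero))
  have h : ∀ y, H Env.nil y = F y := e Env.nil
  rw [lam_eq h, h]

end Def

end Model

end HigherOrderRM

namespace HigherOrderRM

namespace Model

/-! ## The ordered semiring of numbers -/

variable {M : Model}

instance : Zero M.N := ⟨M.const Const.zero⟩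
instance : One M.N := ⟨M.const Const.one⟩
instance : Add M.N := ⟨fun a b => M.const Const.add a b⟩
instance : Mul M.N := ⟨fun a b => M.const Const.mul a b⟩

section eval

variable {Γ : Ctx} (e : M.Env Γ) (s t : Term Γ Ty.nat)

@[simp] theorem eval_zero : eval e zero = 0 := rfl
@[simp] theorem eval_one : eval e one = 1 := rfl
@[simp] theorem eval_add : eval e (add s t) = eval e s + eval e t := rfl
@[simp] theorem eval_mul : eval e (mul s t) = eval e s * eval e t := rfl
@[simp] theorem eval_succ : eval e (succ t) = eval e t + 1 := rfl
@[simp] theorem eval_two : eval e two = 1 + 1 := rfl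

end eval

variable {α : Type} [Obj M α]

@[fun_prop] theorem Def.add {F G : α → M.N} (hF : Def M F) (hG : Def M G) :
    Def M (fun a => F a + G a) := by
  change Def M (fun a => M.app (M.app (M.const Const.add) (F a)) (G a))
  fun_prop

@[fun_prop] theorem Def.mul {F G : α → M.N} (hF : Def M F) (hG : Def M G) :
    Def M (fun a => F a * G a) := by
  change Def M (fun a => M.app (M.app (M.const Const.mul) (F a)) (G a))
  fun_prop

variable [hM : M.IsRCA]

theorem holds_arithmetic {φ : Sentence} (h : IsArithmeticAxiom φ) : M.Holds φ :=
  hM.holds _ (IsRCAAxiom.arithmetic h)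

theorem N_add_comm (a b : M.N) : a + b = b + a := holds_arithmetic IsArithmeticAxiom.add_comm a b

theorem N_mul_comm (a b : M.N) : a * b = b * a := holds_arithmetic IsArithmeticAxiom.mul_comm a b

theorem N_add_zero (a : M.N) : a + 0 = a := holds_arithmetic IsArithmeticAxiom.add_zero a

theorem N_mul_one (a : M.N) : a * 1 = a := holds_arithmetic IsArithmeticAxiom.mul_one a

theorem N_mul_zero (a : M.N) : a * 0 = 0 := holds_arithmetic IsArithmeticAxiom.mul_zero a

theorem N_mul_add (a b c : M.N) : a * (b + c) = a * b + a * c :=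
  holds_arithmetic IsArithmeticAxiom.mul_add a b c

instance : CommSemiring M.N where
  add_assoc a b c := holds_arithmetic IsArithmeticAxiom.add_assoc a b c
  zero_add a := (N_add_comm 0 a).trans (N_add_zero a)
  add_zero := N_add_zero
  add_comm := N_add_comm
  nsmul := nsmulRec
  mul_assoc a b c := holds_arithmetic IsArithmeticAxiom.mul_assoc a b c
  one_mul a := (N_mul_comm 1 a).trans (N_mul_one a)
  mul_one := N_mul_one
  mul_comm := N_mul_comm
  zero_mul a := (N_mul_comm 0 a).trans (N_mul_zero a)
  mul_zero := N_mul_zero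
  left_distrib := N_mul_add
  right_distrib a b c := by rw [N_mul_comm, N_mul_add, N_mul_comm c a, N_mul_comm c b]

theorem N_lt_irrefl (a : M.N) : ¬ M.lt a a := holds_arithmetic IsArithmeticAxiom.lt_irrefl a

theorem N_lt_trans {a b c : M.N} : M.lt a b → M.lt b c → M.lt a c :=
  holds_arithmetic IsArithmeticAxiom.lt_trans a b c

theorem N_lt_total (a b : M.N) : M.lt a b ∨ a = b ∨ M.lt b a := by
  have := holds_arithmetic (M := M) IsArithmeticAxiom.lt_total a b
  simpa using this

open scoped Classical in
noncomputable instance : LinearOrder M.N where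
  le a b := M.lt a b ∨ a = b
  lt := M.lt
  le_refl a := Or.inr rfl
  le_trans a b c := by
    rintro (h | rfl) (h' | rfl)
    · exact Or.inl (N_lt_trans h h')
    · exact Or.inl h
    · exact Or.inl h'
    · exact Or.inr rfl
  le_antisymm a b := by
    rintro (h | rfl) (h' | h')
    · exact absurd (N_lt_trans h h') (N_lt_irrefl _)
    · exact h'.symm
    · rfl
    · rfl
  lt_iff_le_not_ge a b := by
    constructor
    · refine fun h => ⟨Or.inl h, ?_⟩
      rintro (h' | rfl)
      · exact N_lt_irrefl _ (N_lt_trans h h')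
      · exact N_lt_irrefl _ h
    · rintro ⟨h | rfl, h'⟩
      · exact h
      · exact absurd (Or.inr rfl) h'
  le_total a b := by
    rcases N_lt_total a b with h | h | h
    · exact Or.inl (Or.inl h)
    · exact Or.inl (Or.inr h)
    · exact Or.inr (Or.inl h)
  toDecidableLE := Classical.decRel _

@[simp] theorem lt_eq (a b : M.N) : M.lt a b ↔ a < b := Iff.rfl

@[simp] theorem sat_le {Γ : Ctx} (e : M.Env Γ) (s t : Term Γ Ty.nat) :
    Sat e (HigherOrderRM.le s t) ↔ eval e s ≤ eval e t := by
  rw [le_iff_lt_or_eq]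
  simp [HigherOrderRM.le]

theorem N_add_lt_add {a b : M.N} (c : M.N) (h : a < b) : a + c < b + c :=
  holds_arithmetic IsArithmeticAxiom.add_lt_add a b c h

theorem N_mul_lt_mul {a b c : M.N} (h : a < b) (hc : 0 < c) : a * c < b * c :=
  holds_arithmetic IsArithmeticAxiom.mul_lt_mul a b c h hc

theorem N_zero_lt_one : (0 : M.N) < 1 := holds_arithmetic IsArithmeticAxiom.zero_lt_one

theorem N_zero_le (a : M.N) : 0 ≤ a := by
  have := holds_arithmetic (M := M) IsArithmeticAxiom.zero_le a
  simpa using this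

theorem N_one_le {a : M.N} (h : 0 < a) : 1 ≤ a := by
  have := holds_arithmetic (M := M) IsArithmeticAxiom.discrete a
  simp at this
  exact this h

theorem N_add_le_add {a b : M.N} (h : a ≤ b) (c : M.N) : a + c ≤ b + c := by
  rcases h.lt_or_eq with h | rfl
  · exact (N_add_lt_add c h).le
  · exact le_rfl

instance : IsStrictOrderedRing M.N where
  add_le_add_left a b h c := N_add_le_add h c
  le_of_add_le_add_left a b c h := by
    by_contra h'
    rw [not_le] at h'
    have := N_add_lt_add a h'
    rw [N_add_comm c, N_add_comm b] at this
    exact absurd h (not_le.2 this)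
  zero_le_one := N_zero_lt_one.le
  exists_pair_ne := ⟨0, 1, N_zero_lt_one.ne⟩
  mul_lt_mul_of_pos_left a ha b c h := by
    have := N_mul_lt_mul h ha
    rw [N_mul_comm b, N_mul_comm c] at this
    exact this
  mul_lt_mul_of_pos_right a ha b c h := N_mul_lt_mul h ha

/-- A family of propositions is internal when it has an internal characteristic function, with `0`
for truth. A single proposition always has one, by cases on its truth. -/
instance : Obj M Prop where
  Plot P := ∃ F, Internal F ∧ ∀ e, P e ↔ F e = (0 : M.N)
  const P := by
    by_cases h : P
    · exact ⟨fun _ => 0, .const _, fun _ => by simp [h]⟩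
    · exact ⟨fun _ => 1, .const _, fun _ => by simp [h]⟩
  reindex := by
    rintro Γ Δ c ⟨F, hF, e⟩ g hg
    exact ⟨_, hF.reindex hg, fun _ => e _⟩

/-! ## Induction, recursion and choice -/

/-- The characteristic function of `P` is passed as a parameter of type `1`, so a single instance of
the induction axiom covers every internal predicate. `choice` is obtained in the same manner. -/
theorem induction {P : M.N → Prop} (hP : Def M P) (h0 : P 0) (hs : ∀ n, P n → P (n + 1)) (n : M.N) :
    P n := by
  obtain ⟨F, hF, e⟩ := hP.plot (Internal.var (Γ := [Ty.nat]) Var.zero)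
  obtain ⟨H, -, eH⟩ := hF.curry
  have key : ∀ n, P n ↔ H Env.nil n = 0 := fun n => by rw [eH, ← e]; rfl
  have := (holds_close _).1 (hM.holds _ (IsRCAAxiom.induction [Ty.one] (v1 ⬝ v0 =₀ zero)
    ⟨⟩)) (Env.cons (H Env.nil) Env.nil)
  simp at this
  exact (key n).2 (this ((key 0).1 h0) (fun n hn => (key _).1 (hs n ((key n).2 hn))) n)

theorem choice {P : M.carrier Ty.one → M.N → Prop}
    (hP : Def M (fun p : M.carrier Ty.one × M.N => P p.1 p.2)) (h : ∀ x, ∃ y, P x y) :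
    ∃ Y : M.carrier Ty.two, ∀ x, P x (Y x) := by
  obtain ⟨F, hF, e⟩ := hP.plot (Γ := [Ty.nat, Ty.one])
    (c := fun e => (e Ty.one Var.zero.succ, e Ty.nat Var.zero)) ⟨.var _, .var _⟩
  obtain ⟨H, hH, eH⟩ := hF.curry
  obtain ⟨K, -, eK⟩ := hH.curry
  have key : ∀ x y, P x y ↔ K Env.nil x y = 0 := fun x y => by rw [eK, eH, ← e]; rfl
  have := (holds_close _).1 (hM.holds _ (IsRCAAxiom.choice [Ty.one ⇒ Ty.nat ⇒ Ty.nat]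
    (v2 ⬝ v1 ⬝ v0 =₀ zero) ⟨⟩)) (Env.cons (K Env.nil) Env.nil)
  simp [sat_rename] at this
  obtain ⟨Y, hY⟩ := this fun x => (h x).imp fun y hy => (key x y).1 hy
  exact ⟨Y, fun x => (key _ _).2 (hY x)⟩

/-- The function given by `g 0 = m`, `g (k + 1) = F k (g k)`, for an internal `F`. -/
noncomputable def recF (F : M.N → M.N → M.N) (m n : M.N) : M.N :=
  M.const (Const.recursor Ty.nat) (Model.lam fun k => Model.lam fun v => F k v) m n

@[fun_prop] theorem Def.recF {F : α → M.N → M.N → M.N} {m n : α → M.N}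
    (hF : Def M (fun p : α × M.N × M.N => F p.1 p.2.1 p.2.2)) (hm : Def M m) (hn : Def M n) :
    Def M (fun a => Model.recF (fun k v => F a k v) (m a) (n a)) := by
  have : Def M (fun p : (α × M.N) × M.N => F p.1.1 p.1.2 p.2) :=
    hF.comp (g := fun p : (α × M.N) × M.N => (p.1.1, p.1.2, p.2)) (by fun_prop)
  unfold Model.recF
  fun_prop

theorem lam_lam_app {F : M.N → M.N → M.N} (hF : Def M (fun p : M.N × M.N => F p.1 p.2)) (k v : M.N) :
    Model.lam (fun k => Model.lam fun v => F k v) k v = F k v := by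
  have hk : Def M (fun v => F k v) := hF.comp (g := fun v => (k, v)) (by fun_prop)
  rw [lam_app (by fun_prop), lam_app hk]

theorem recF_zero (F : M.N → M.N → M.N) (m : M.N) : recF F m 0 = m :=
  hM.holds _ IsRCAAxiom.rec_zero _ m

theorem recF_succ {F : M.N → M.N → M.N} (hF : Def M (fun p : M.N × M.N => F p.1 p.2)) (m n : M.N) :
    recF F m (n + 1) = F n (recF F m n) := by
  have := hM.holds _ IsRCAAxiom.rec_succ (Model.lam fun k => Model.lam fun v => F k v) m n
  refine Eq.trans this ?_
  exact lam_lam_app hF _ _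

@[simp] theorem eval_recNat {Γ : Ctx} (e : M.Env Γ) (m n : Term Γ Ty.nat)
    (f : Term (Ty.nat :: Ty.nat :: Γ) Ty.nat) : eval e (recNat m f n) =
      recF (fun k v => eval (Env.cons v (Env.cons k e)) f) (eval e m) (eval e n) := by
  simp [recNat, recF, eval_lam]

end Model

end HigherOrderRM

namespace HigherOrderRM

namespace Model

variable {M : Model} [hM : M.IsRCA] {α : Type} [Obj M α]

/-! ## Truncated subtraction and decidable predicates -/

noncomputable def predM (n : M.N) : M.N := recF (fun k _ => k) 0 n

noncomputable def monusM (a b : M.N) : M.N := recF (fun _ v => predM v) a b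

@[fun_prop] theorem Def.predM {F : α → M.N} (hF : Def M F) : Def M (fun a => Model.predM (F a)) := by
  unfold Model.predM; fun_prop

@[fun_prop] theorem Def.monusM {F G : α → M.N} (hF : Def M F) (hG : Def M G) :
    Def M (fun a => Model.monusM (F a) (G a)) := by
  unfold Model.monusM; fun_prop

section eval

variable {Γ : Ctx} (e : M.Env Γ) (s t : Term Γ Ty.nat)

@[simp] theorem eval_pred : eval e (pred t) = predM (eval e t) := by simp [pred, predM]

@[simp] theorem eval_monus : eval e (monus s t) = monusM (eval e s) (eval e t) := by
  simp [monus, monusM]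

end eval

@[simp] theorem predM_zero : predM (0 : M.N) = 0 := recF_zero _ _

@[simp] theorem predM_succ (n : M.N) : predM (n + 1) = n := recF_succ (by fun_prop) _ _

@[simp] theorem monusM_zero (a : M.N) : monusM a 0 = a := recF_zero _ _

@[simp] theorem monusM_succ (a b : M.N) : monusM a (b + 1) = predM (monusM a b) :=
  recF_succ (by fun_prop) _ _

/-- Here, and in `add_monusM_or`, the induction axiom is applied to an explicit quantifier-free
formula: closure of `Def` under connectives is itself proved from the laws of truncated subtraction.
-/
theorem eq_zero_or_succ (n : M.N) : n = 0 ∨ predM n + 1 = n := by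
  have := (holds_close _).1 (hM.holds _ (IsRCAAxiom.induction []
    ((v0 =₀ zero) ⩒ (succ (pred v0) =₀ v0))
    (by simp [Form.QuantifierFree, Form.disj, Form.neg]))) Env.nil
  simp at this
  exact this n

theorem exists_succ {n : M.N} (h : n ≠ 0) : ∃ m, n = m + 1 :=
  ⟨_, ((eq_zero_or_succ n).resolve_left h).symm⟩

theorem add_monusM_or (a b : M.N) : b + monusM a b = a ∨ (monusM a b = 0 ∧ a < b) := by
  have := (holds_close _).1 (hM.holds _ (IsRCAAxiom.induction [Ty.nat]
    ((add v0 (monus v1 v0) =₀ v1) ⩒ ((monus v1 v0 =₀ zero) ⩑ (v1 <₀ v0)))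
    (by simp [Form.QuantifierFree, Form.disj, Form.conj, Form.neg]))) (Env.cons a Env.nil)
  simp at this
  refine this (fun b hb => ?_) b
  rcases hb with h | ⟨h, h'⟩
  · rcases eq_zero_or_succ (monusM a b) with h0 | h0
    · rw [h0, add_zero] at h
      right; rw [h0, ← h]; exact ⟨predM_zero, lt_add_one b⟩
    · left; rw [← h0] at h; rw [add_assoc, add_comm 1]; exact h
  · right; simp [h, h'.trans (lt_add_one b)]

theorem add_monusM {a b : M.N} (h : b ≤ a) : b + monusM a b = a :=
  (add_monusM_or a b).resolve_right fun h' => h.not_gt h'.2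

theorem monusM_add {a b : M.N} (h : b ≤ a) : monusM a b + b = a := by
  rw [add_comm, add_monusM h]

theorem monusM_eq_zero {a b : M.N} : monusM a b = 0 ↔ a ≤ b := by
  rcases add_monusM_or a b with h | h
  · constructor
    · intro h0; rw [h0, add_zero] at h; exact h.ge
    · intro hab
      rw [← h] at hab
      exact le_antisymm (by simpa using hab) (N_zero_le _)
  · simp [h.1, h.2.le]

@[simp] theorem monusM_add_right (a b : M.N) : monusM (a + b) b = a := by
  have := monusM_add (M := M) (a := a + b) (b := b) (by simpa using N_zero_le a)
  exact add_right_cancel this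

theorem succ_le_iff {a b : M.N} : a + 1 ≤ b ↔ a < b := by
  refine ⟨(lt_add_one a).trans_le, fun h => ?_⟩
  have h1 := add_monusM h.le
  have h2 : 0 < monusM b a := by
    rw [← h1] at h; simpa using h
  rw [← h1]
  simpa using N_one_le h2

theorem lt_succ_iff {a b : M.N} : a < b + 1 ↔ a ≤ b := by
  rw [← not_le, succ_le_iff, not_lt]

theorem N_pos_iff {a : M.N} : 0 < a ↔ a ≠ 0 := (N_zero_le a).lt_iff_ne'

theorem N_lt_one {a : M.N} : a < 1 ↔ a = 0 := by
  rw [← zero_add (1 : M.N), lt_succ_iff]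
  exact ⟨fun h => le_antisymm h (N_zero_le a), fun h => h.le⟩

section Predicates

variable {P Q : α → Prop} {F G : α → M.N}

-- Truncated subtraction supplies characteristic functions: the difference for `≤`, and `1` minus
-- the given one for negation. Conjunction is a sum, and the other connectives are Boolean
-- combinations.
@[fun_prop] theorem Def.le (hF : Def M F) (hG : Def M G) : Def M (fun a => F a ≤ G a) :=
  ⟨fun h => ⟨_, (Def.monusM hF hG).plot h, fun _ => monusM_eq_zero.symm⟩⟩

@[fun_prop] theorem Def.and (hP : Def M P) (hQ : Def M Q) : Def M (fun a => P a ∧ Q a) := by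
  refine ⟨fun {Γ c} h => ?_⟩
  obtain ⟨A, hA, eA⟩ := hP.plot h
  obtain ⟨B, hB, eB⟩ := hQ.plot h
  have key : Def M (fun p : M.N × M.N => p.1 + p.2) := by fun_prop
  refine ⟨fun e => A e + B e, key.plot (c := fun e => (A e, B e)) ⟨hA, hB⟩, fun e => ?_⟩
  beta_reduce at eA eB ⊢
  rw [eA, eB, add_eq_zero_iff_of_nonneg (N_zero_le _) (N_zero_le _)]

@[fun_prop] theorem Def.not (hP : Def M P) : Def M (fun a => ¬ P a) := by
  refine ⟨fun {Γ c} h => ?_⟩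
  obtain ⟨A, hA, eA⟩ := hP.plot h
  have key : Def M (fun p : M.N => Model.monusM 1 p) := by fun_prop
  refine ⟨fun e => Model.monusM 1 (A e), key.plot hA, fun e => ?_⟩
  beta_reduce at eA ⊢
  rw [eA, monusM_eq_zero, ← not_lt, N_lt_one]

theorem Def.congr {P Q : α → Prop} (hP : Def M P) (h : ∀ a, Q a ↔ P a) : Def M Q := by
  have : Q = P := funext fun a => propext (h a)
  rwa [this]

@[fun_prop] theorem Def.or (hP : Def M P) (hQ : Def M Q) : Def M (fun a => P a ∨ Q a) :=
  Def.congr (P := fun a => ¬ (¬ P a ∧ ¬ Q a)) (by fun_prop) fun a => by tauto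

theorem Def.imp (hP : Def M P) (hQ : Def M Q) : Def M (fun a => P a → Q a) :=
  Def.congr (P := fun a => ¬ (P a ∧ ¬ Q a)) (by fun_prop) fun a => by tauto

@[fun_prop] theorem Def.lt (hF : Def M F) (hG : Def M G) : Def M (fun a => F a < G a) :=
  Def.congr (P := fun a => ¬ G a ≤ F a) (by fun_prop) fun a => by simp

@[fun_prop] theorem Def.eq (hF : Def M F) (hG : Def M G) : Def M (fun a => F a = G a) :=
  Def.congr (P := fun a => F a ≤ G a ∧ G a ≤ F a) (by fun_prop) fun a => le_antisymm_iff

@[fun_prop] theorem Def.ite {inst : ∀ a, Decidable (P a)} (hP : Def M P) (hF : Def M F)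
    (hG : Def M G) : Def M (fun a => if P a then F a else G a) := by
  refine ⟨fun {Γ c} h => ?_⟩
  obtain ⟨A, hA, eA⟩ := hP.plot h
  have key : Def M (fun p : M.N × M.N × M.N =>
      Model.monusM 1 p.1 * p.2.1 + Model.monusM 1 (Model.monusM 1 p.1) * p.2.2) := by fun_prop
  have := key.plot (c := fun e => (A e, F (c e), G (c e))) ⟨hA, hF.plot h, hG.plot h⟩
  convert this using 1
  funext e
  by_cases hp : P (c e)
  · have : A e = 0 := (eA e).1 hp
    have h1 : Model.monusM (1 : M.N) 1 = 0 := monusM_eq_zero.2 le_rfl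
    simp [hp, this, h1]
  · have h0 : A e ≠ 0 := fun h => hp ((eA e).2 h)
    have : Model.monusM 1 (A e) = 0 := monusM_eq_zero.2 (N_one_le (N_pos_iff.2 h0))
    simp [hp, this]

end Predicates

/-! ## Bounded quantification and least numbers -/

/-- The number of `k < n` such that `P k`. -/
noncomputable def countM (P : M.N → Prop) (n : M.N) : M.N :=
  open scoped Classical in recF (fun k v => v + if P k then 1 else 0) 0 n

theorem countM_zero (P : M.N → Prop) : countM P 0 = 0 := recF_zero _ _

open scoped Classical in
theorem countM_succ {P : M.N → Prop} (hP : Def M P) (n : M.N) :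
    countM P (n + 1) = countM P n + if P n then 1 else 0 := recF_succ (by fun_prop) _ _

/-- Counting by the recursor turns a bounded quantifier into an equation between numbers, which
makes bounded quantification internal. -/
theorem countM_eq_zero {P : M.N → Prop} (hP : Def M P) (n : M.N) :
    countM P n = 0 ↔ ∀ k < n, ¬ P k := by
  have hc : Def M (countM P) := by unfold countM; fun_prop
  constructor
  · intro h k hk hPk
    have key : ∀ j, ¬ (k < j ∧ countM P j = 0) := by
      refine induction (by fun_prop) (fun h => (N_zero_le k).not_gt h.1) fun j ih => ?_
      rw [lt_succ_iff, countM_succ hP]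
      rintro ⟨h1, h2⟩
      rw [add_eq_zero_iff_of_nonneg (N_zero_le _) (N_zero_le _)] at h2
      rcases h1.lt_or_eq with h1 | rfl
      · exact ih ⟨h1, h2.1⟩
      · simp [hPk] at h2
    exact key n ⟨hk, h⟩
  · intro h
    have key : ∀ j, ¬ (j ≤ n ∧ ¬ countM P j = 0) := by
      refine induction (by fun_prop) (by simp [countM_zero]) fun j ih => ?_
      rw [succ_le_iff, countM_succ hP]
      rintro ⟨h1, h2⟩
      rw [if_neg (h j h1), add_zero] at h2
      exact ih ⟨h1.le, h2⟩
    by_contra h0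
    exact key n ⟨le_rfl, h0⟩

theorem Def.allLt {P : α → M.N → Prop} {n : α → M.N}
    (hP : Def M (fun p : α × M.N => P p.1 p.2)) (hn : Def M n) :
    Def M (fun a => ∀ k < n a, P a k) := by
  have hP' : ∀ a, Def M (fun k => ¬ P a k) := fun a => by
    have : Def M (fun k => P a k) := hP.comp (g := fun k => (a, k)) (by fun_prop)
    fun_prop
  refine Def.congr (P := fun a => countM (fun k => ¬ P a k) (n a) = 0) ?_ fun a => ?_
  · have : Def M (fun p : α × M.N × M.N => P p.1 p.2.1) :=
      hP.comp (g := fun p : α × M.N × M.N => (p.1, p.2.1)) (by fun_prop)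
    unfold countM
    fun_prop
  · rw [countM_eq_zero (hP' a)]; simp

theorem exists_least {P : M.N → Prop} (hP : Def M P) {n : M.N} (hn : P n) :
    ∃ m, P m ∧ ∀ k < m, ¬ P k := by
  by_contra! h
  have key : ∀ m, ∀ k < m, ¬ P k := by
    refine induction (Def.allLt (by fun_prop) Def.id)
      (fun k hk => absurd hk (N_zero_le k).not_gt) fun m ih k hk => ?_
    rcases (lt_succ_iff.1 hk).lt_or_eq with hk | rfl
    · exact ih k hk
    · intro hk
      obtain ⟨j, hj, hPj⟩ := h k hk
      exact ih j hj hPj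
  exact key (n + 1) n (lt_add_one n) hn

theorem exists_switch {P : M.N → Prop} (hP : Def M P) (h0 : P 0) {n : M.N} (hn : ¬ P n) :
    ∃ m, P m ∧ ¬ P (m + 1) := by
  by_contra! h
  exact hn (induction hP h0 h n)

/-! ## Halving, powers of two, and pairing -/

noncomputable def halfM (n : M.N) : M.N := recF (fun k v => monusM k v) 0 n
noncomputable def parityM (n : M.N) : M.N := monusM n ((1 + 1) * halfM n)
noncomputable def twoPowM (n : M.N) : M.N := recF (fun _ v => v + v) 1 n
noncomputable def triangleM (w : M.N) : M.N := halfM (w * (w + 1))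
noncomputable def leIndM (a b : M.N) : M.N := monusM 1 (monusM a b)
noncomputable def triangleRootM (z : M.N) : M.N :=
  recF (fun k v => v + leIndM (triangleM (v + 1)) (k + 1)) 0 z
noncomputable def pairM (a b : M.N) : M.N := triangleM (a + b) + a
noncomputable def fstM (z : M.N) : M.N := monusM z (triangleM (triangleRootM z))
noncomputable def sndM (z : M.N) : M.N := monusM (triangleRootM z) (fstM z)

section Def

variable {F G : α → M.N}

@[fun_prop] theorem Def.halfM (hF : Def M F) : Def M (fun a => Model.halfM (F a)) := by
  unfold Model.halfM; fun_prop
@[fun_prop] theorem Def.parityM (hF : Def M F) : Def M (fun a => Model.parityM (F a)) := by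
  unfold Model.parityM; fun_prop
@[fun_prop] theorem Def.twoPowM (hF : Def M F) : Def M (fun a => Model.twoPowM (F a)) := by
  unfold Model.twoPowM; fun_prop
@[fun_prop] theorem Def.triangleM (hF : Def M F) : Def M (fun a => Model.triangleM (F a)) := by
  unfold Model.triangleM; fun_prop
@[fun_prop] theorem Def.leIndM (hF : Def M F) (hG : Def M G) :
    Def M (fun a => Model.leIndM (F a) (G a)) := by
  unfold Model.leIndM; fun_prop
@[fun_prop] theorem Def.triangleRootM (hF : Def M F) :
    Def M (fun a => Model.triangleRootM (F a)) := by
  unfold Model.triangleRootM; fun_prop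
@[fun_prop] theorem Def.pairM (hF : Def M F) (hG : Def M G) :
    Def M (fun a => Model.pairM (F a) (G a)) := by
  unfold Model.pairM; fun_prop
@[fun_prop] theorem Def.fstM (hF : Def M F) : Def M (fun a => Model.fstM (F a)) := by
  unfold Model.fstM; fun_prop
@[fun_prop] theorem Def.sndM (hF : Def M F) : Def M (fun a => Model.sndM (F a)) := by
  unfold Model.sndM; fun_prop

end Def

section eval

variable {Γ : Ctx} (e : M.Env Γ) (s t : Term Γ Ty.nat)

@[simp] theorem eval_half : eval e (half t) = halfM (eval e t) := by simp [half, halfM]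
@[simp] theorem eval_parity : eval e (parity t) = parityM (eval e t) := by
  simp [parity, parityM]
@[simp] theorem eval_twoPow : eval e (twoPow t) = twoPowM (eval e t) := by
  simp [twoPow, twoPowM]
@[simp] theorem eval_triangle : eval e (triangle t) = triangleM (eval e t) := by
  simp [triangle, triangleM]
@[simp] theorem eval_leInd : eval e (leInd s t) = leIndM (eval e s) (eval e t) := by
  simp [leInd, leIndM]
@[simp] theorem eval_triangleRoot : eval e (triangleRoot t) = triangleRootM (eval e t) := by
  simp [triangleRoot, triangleRootM]
@[simp] theorem eval_pair : eval e (pair s t) = pairM (eval e s) (eval e t) := by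
  simp [pair, pairM]
@[simp] theorem eval_fst : eval e (fst t) = fstM (eval e t) := by simp [fst, fstM]
@[simp] theorem eval_snd : eval e (snd t) = sndM (eval e t) := by simp [snd, sndM]

end eval

theorem halfM_zero : halfM (0 : M.N) = 0 := recF_zero _ _

theorem halfM_succ (n : M.N) : halfM (n + 1) = monusM n (halfM n) := recF_succ (by fun_prop) _ _

theorem monusM_eq {a b c : M.N} (h : a = c + b) : monusM a b = c := by rw [h, monusM_add_right]

theorem halfM_double (k : M.N) : halfM (k + k) = k := by
  refine induction (P := fun k => halfM (k + k) = k) (by fun_prop) (by simp [halfM_zero])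
    (fun k ih => ?_) k
  have h1 : halfM (k + k + 1) = k := by rw [halfM_succ, ih]; exact monusM_eq rfl
  have e : k + 1 + (k + 1) = k + k + 1 + 1 := by ring
  rw [e, halfM_succ, h1]
  exact monusM_eq (by ring)

theorem halfM_double_succ (k : M.N) : halfM (k + k + 1) = k := by
  rw [halfM_succ, halfM_double]; exact monusM_eq rfl

theorem exists_half (n : M.N) : ∃ k, n = k + k ∨ n = k + k + 1 := by
  refine ⟨halfM n, induction (P := fun n => n = halfM n + halfM n ∨ n = halfM n + halfM n + 1)
    (by fun_prop) (by simp [halfM_zero]) (fun n ih => ?_) n⟩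
  generalize halfM n = k at ih
  rcases ih with rfl | rfl
  · rw [halfM_double_succ]; exact Or.inr rfl
  · have e : k + k + 1 + 1 = (k + 1) + (k + 1) := by ring
    rw [e, halfM_double]; exact Or.inl rfl

theorem parityM_double (k : M.N) : parityM (k + k) = 0 := by
  rw [parityM, halfM_double]; exact monusM_eq (by ring)

theorem parityM_double_succ (k : M.N) : parityM (k + k + 1) = 1 := by
  rw [parityM, halfM_double_succ]; exact monusM_eq (by ring)

theorem twoPowM_zero : twoPowM (0 : M.N) = 1 := recF_zero _ _

theorem twoPowM_succ (n : M.N) : twoPowM (n + 1) = twoPowM n + twoPowM n :=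
  recF_succ (by fun_prop) _ _

theorem twoPowM_add (m n : M.N) : twoPowM (m + n) = twoPowM m * twoPowM n := by
  refine induction (P := fun n => twoPowM (m + n) = twoPowM m * twoPowM n) (by fun_prop)
    (by simp [twoPowM_zero]) (fun n ih => ?_) n
  rw [← add_assoc, twoPowM_succ, twoPowM_succ, ih]; ring

theorem lt_twoPowM (n : M.N) : n < twoPowM n := by
  refine induction (P := fun n => n < twoPowM n) (by fun_prop) (by simp [twoPowM_zero])
    (fun n ih => ?_) n
  have := N_zero_le n
  rw [twoPowM_succ, ← succ_le_iff] at *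
  grind

theorem twoPowM_pos (n : M.N) : 0 < twoPowM n := (N_zero_le n).trans_lt (lt_twoPowM n)

theorem triangleM_double (w : M.N) : triangleM w + triangleM w = w * (w + 1) := by
  refine induction (P := fun w => triangleM w + triangleM w = w * (w + 1)) (by fun_prop)
    (by simp [triangleM, halfM_zero]) (fun w ih => ?_) w
  have e : (w + 1) * (w + 1 + 1) = (triangleM w + (w + 1)) + (triangleM w + (w + 1)) := by
    have : (triangleM w + (w + 1)) + (triangleM w + (w + 1)) =
      (triangleM w + triangleM w) + (w + 1) + (w + 1) := by ring
    rw [this, ih]; ring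
  conv_lhs => rw [triangleM, e, halfM_double]
  rw [e]

theorem triangleM_succ (w : M.N) : triangleM (w + 1) = triangleM w + (w + 1) := by
  have e : (w + 1) * (w + 1 + 1) = (triangleM w + (w + 1)) + (triangleM w + (w + 1)) := by
    have : (triangleM w + (w + 1)) + (triangleM w + (w + 1)) =
      (triangleM w + triangleM w) + (w + 1) + (w + 1) := by ring
    rw [this, triangleM_double]; ring
  rw [triangleM, e, halfM_double]

theorem triangleM_mono {a b : M.N} (h : a ≤ b) : triangleM a ≤ triangleM b := by
  have h1 := triangleM_double a
  have h2 := triangleM_double b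
  have h3 : a * (a + 1) ≤ b * (b + 1) :=
    mul_le_mul h (by grind) (N_zero_le _) (N_zero_le b)
  grind

theorem leIndM_of_le {a b : M.N} (h : a ≤ b) : leIndM a b = 1 := by
  rw [leIndM, monusM_eq_zero.2 h, monusM_zero]

theorem leIndM_of_lt {a b : M.N} (h : b < a) : leIndM a b = 0 := by
  rw [leIndM, monusM_eq_zero]
  refine N_one_le (N_pos_iff.2 fun h' => h.not_ge (monusM_eq_zero.1 h'))

theorem triangleRootM_succ (z : M.N) : triangleRootM (z + 1) = triangleRootM z +
    leIndM (triangleM (triangleRootM z + 1)) (z + 1) := recF_succ (by fun_prop) _ _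

theorem triangleRootM_spec (z : M.N) :
    triangleM (triangleRootM z) ≤ z ∧ z < triangleM (triangleRootM z + 1) := by
  refine induction (P := fun z => triangleM (triangleRootM z) ≤ z ∧
    z < triangleM (triangleRootM z + 1)) (by fun_prop) ?_ (fun z ih => ?_) z
  · have h0 : triangleRootM (0 : M.N) = 0 := recF_zero _ _
    have h1 : triangleM (0 : M.N) = 0 := by simp [triangleM, halfM_zero]
    rw [h0, triangleM_succ, h1]
    simp
  · rw [triangleRootM_succ]
    rcases le_or_gt (triangleM (triangleRootM z + 1)) (z + 1) with h | h
    · rw [leIndM_of_le h]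
      refine ⟨h, ?_⟩
      rw [triangleM_succ (triangleRootM z + 1)]
      have := N_zero_le (triangleRootM z)
      grind
    · rw [leIndM_of_lt h, add_zero]
      exact ⟨ih.1.trans (le_of_lt (lt_add_one z)), h⟩

theorem triangleRootM_eq {r z : M.N} (h : triangleM r ≤ z) (h' : z < triangleM (r + 1)) :
    triangleRootM z = r := by
  obtain ⟨h1, h2⟩ := triangleRootM_spec z
  rcases lt_trichotomy (triangleRootM z) r with h3 | h3 | h3
  · exact absurd (h2.trans_le (triangleM_mono (succ_le_iff.2 h3))) h.not_gt
  · exact h3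
  · exact absurd (h'.trans_le (triangleM_mono (succ_le_iff.2 h3))) h1.not_gt

theorem triangleRootM_pairM (a b : M.N) : triangleRootM (pairM a b) = a + b := by
  have ha := N_zero_le a
  have hb := N_zero_le b
  refine triangleRootM_eq ?_ ?_
  · rw [pairM]; grind
  · rw [pairM, triangleM_succ]
    exact add_lt_add_of_le_of_lt le_rfl (lt_succ_iff.2 (by grind))

@[simp] theorem fstM_pairM (a b : M.N) : fstM (pairM a b) = a := by
  rw [fstM, triangleRootM_pairM, pairM]
  exact monusM_eq (by ring)

@[simp] theorem sndM_pairM (a b : M.N) : sndM (pairM a b) = b := by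
  rw [sndM, triangleRootM_pairM, fstM_pairM]
  exact monusM_eq (by ring)

end Model

end HigherOrderRM

namespace HigherOrderRM

/-! ## The ring of differences and the field of fractions of an ordered semiring -/

section Differences

variable (R : Type) [CommSemiring R] [LinearOrder R] [IsStrictOrderedRing R]

/-- `(a, b)` stands for `a - b`. -/
def diffSetoid : Setoid (R × R) where
  r x y := x.1 + y.2 = y.1 + x.2
  iseqv := {
    refl := fun _ => rfl
    symm := fun h => h.symm
    trans := by
      rintro ⟨a, b⟩ ⟨c, d⟩ ⟨e, f⟩ h h'
      dsimp only at *
      grind }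

def Diff : Type := Quotient (diffSetoid R)

namespace Diff

variable {R}

def mk (a b : R) : Diff R := Quotient.mk (diffSetoid R) (a, b)

theorem mk_eq {a b c d : R} : mk a b = mk c d ↔ a + d = c + b := by
  exact Quotient.eq (r := diffSetoid R)

theorem ind {P : Diff R → Prop} (h : ∀ a b, P (mk a b)) (x : Diff R) : P x :=
  Quotient.ind (fun p => h p.1 p.2) x

instance : Add (Diff R) := ⟨Quotient.map₂ (fun x y => (x.1 + y.1, x.2 + y.2)) (by
  rintro ⟨a, b⟩ ⟨c, d⟩ (h : a + d = c + b) ⟨a', b'⟩ ⟨c', d'⟩ (h' : a' + d' = c' + b')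
  change a + a' + (d + d') = c + c' + (b + b')
  grind)⟩

instance : Mul (Diff R) := ⟨Quotient.map₂ (fun x y => (x.1 * y.1 + x.2 * y.2, x.1 * y.2 + x.2 * y.1))
  (by
  rintro ⟨a, b⟩ ⟨c, d⟩ (h : a + d = c + b) ⟨a', b'⟩ ⟨c', d'⟩ (h' : a' + d' = c' + b')
  show a * a' + b * b' + (c * d' + d * c') = c * c' + d * d' + (a * b' + b * a')
  have h1 : (a + d) * a' + (c + b) * b' = (c + b) * a' + (a + d) * b' := by rw [h]
  have h2 : c * (a' + d') + d * (c' + b') = c * (c' + b') + d * (a' + d') := by rw [h']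
  refine add_right_cancel (b := c * a' + d * a' + c * b' + d * b') ?_
  calc _ = ((a + d) * a' + (c + b) * b') + (c * (a' + d') + d * (c' + b')) := by ring
    _ = _ := by rw [h1, h2]; ring)⟩

instance : Neg (Diff R) := ⟨Quotient.map (fun x => (x.2, x.1)) (by
  rintro ⟨a, b⟩ ⟨c, d⟩ (h : a + d = c + b)
  change b + c = d + a
  grind)⟩

instance : Zero (Diff R) := ⟨mk 0 0⟩
instance : One (Diff R) := ⟨mk 1 0⟩

theorem mk_add (a b c d : R) : mk a b + mk c d = mk (a + c) (b + d) := rfl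
theorem mk_mul (a b c d : R) : mk a b * mk c d = mk (a * c + b * d) (a * d + b * c) := rfl
theorem neg_mk (a b : R) : -mk a b = mk b a := rfl
theorem zero_def : (0 : Diff R) = mk 0 0 := rfl
theorem one_def : (1 : Diff R) = mk 1 0 := rfl

instance : CommRing (Diff R) where
  add_assoc x y z := by
    induction x using ind; induction y using ind; induction z using ind
    simp only [mk_add, add_assoc]
  zero_add x := by induction x using ind; simp [zero_def, mk_add]
  add_zero x := by induction x using ind; simp [zero_def, mk_add]
  add_comm x y := by
    induction x using ind; induction y using ind
    simp only [mk_add, mk_eq]; ring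
  nsmul := nsmulRec
  zsmul := zsmulRec
  neg_add_cancel x := by
    induction x using ind
    simp only [neg_mk, mk_add, zero_def, mk_eq]; ring
  mul_assoc x y z := by
    induction x using ind; induction y using ind; induction z using ind
    simp only [mk_mul, mk_eq]; ring
  one_mul x := by induction x using ind; simp [one_def, mk_mul]
  mul_one x := by induction x using ind; simp [one_def, mk_mul]
  zero_mul x := by induction x using ind; simp [zero_def, mk_mul]
  mul_zero x := by induction x using ind; simp [zero_def, mk_mul]
  mul_comm x y := by
    induction x using ind; induction y using ind
    simp only [mk_mul, mk_eq]; ring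
  left_distrib x y z := by
    induction x using ind; induction y using ind; induction z using ind
    simp only [mk_mul, mk_add, mk_eq]; ring
  right_distrib x y z := by
    induction x using ind; induction y using ind; induction z using ind
    simp only [mk_mul, mk_add, mk_eq]; ring

variable (R) in
def of : R →+* Diff R where
  toFun a := mk a 0
  map_one' := rfl
  map_zero' := rfl
  map_mul' a b := by simp [mk_mul]
  map_add' a b := by simp [mk_add]

theorem of_injective : Function.Injective (of R) := fun a b h => by
  have : mk a 0 = mk b 0 := h
  simpa [mk_eq] using this

theorem mk_eq_sub (a b : R) : mk a b = of R a - of R b := by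
  rw [sub_eq_add_neg]
  change _ = mk a 0 + -mk b 0
  simp [neg_mk, mk_add]

variable [ExistsAddOfLE R]

theorem cases (x : Diff R) : ∃ a, x = of R a ∨ x = -of R a := by
  induction x using ind with
  | h a b =>
    rcases le_total b a with h | h
    · obtain ⟨c, rfl⟩ := exists_add_of_le h
      exact ⟨c, Or.inl (by rw [mk_eq_sub, map_add]; ring)⟩
    · obtain ⟨c, rfl⟩ := exists_add_of_le h
      exact ⟨c, Or.inr (by rw [mk_eq_sub, map_add]; ring)⟩

instance : IsDomain (Diff R) := by
  have : Nontrivial (Diff R) := ⟨0, 1, fun h => zero_ne_one (α := R) (of_injective (by rw [map_zero, map_one]; exact h))⟩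
  have : NoZeroDivisors (Diff R) := ⟨fun {x y} h => by
    obtain ⟨a, ha⟩ := cases x
    obtain ⟨b, hb⟩ := cases y
    have : of R (a * b) = of R 0 := by
      rw [map_mul, map_zero]
      rcases ha with rfl | rfl <;> rcases hb with rfl | rfl <;> simpa using h
    rcases mul_eq_zero.1 (of_injective this) with rfl | rfl
    · left; rcases ha with rfl | rfl <;> simp
    · right; rcases hb with rfl | rfl <;> simp⟩
  exact NoZeroDivisors.to_isDomain _

end Diff

/-- The field of fractions of the ring of differences. -/
abbrev FracField : Type := FractionRing (Diff R)

namespace FracField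

variable {R}

variable (R) in
def of : R →+* FracField R := (algebraMap (Diff R) (FracField R)).comp (Diff.of R)

theorem of_injective : Function.Injective (of R) :=
  (IsFractionRing.injective (Diff R) (FracField R)).comp Diff.of_injective

theorem of_ne_zero {a : R} (h : a ≠ 0) : of R a ≠ 0 := fun h' => h (of_injective (by simpa using h'))

variable [ExistsAddOfLE R]

theorem cases (x : FracField R) : ∃ a b, b ≠ 0 ∧ (x = of R a / of R b ∨ x = -(of R a / of R b)) := by
  obtain ⟨p, q, hq, rfl⟩ := IsFractionRing.div_surjective (A := Diff R) x
  obtain ⟨a, ha⟩ := Diff.cases p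
  obtain ⟨b, hb⟩ := Diff.cases q
  have hb0 : b ≠ 0 := by
    rintro rfl
    have := nonZeroDivisors.ne_zero hq
    rcases hb with rfl | rfl <;> simp at this
  refine ⟨a, b, hb0, ?_⟩
  rcases ha with rfl | rfl <;> rcases hb with rfl | rfl <;> simp [of, neg_div, div_neg]

/-- The nonnegative elements. -/
def cone : RingCone (FracField R) where
  carrier := {x | ∃ a b, 0 ≤ a ∧ 0 < b ∧ x = of R a / of R b}
  mul_mem' := by
    rintro _ _ ⟨a, b, ha, hb, rfl⟩ ⟨c, d, hc, hd, rfl⟩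
    exact ⟨a * c, b * d, mul_nonneg ha hc, mul_pos hb hd, by simp [div_mul_div_comm]⟩
  one_mem' := ⟨1, 1, zero_le_one, zero_lt_one, by simp⟩
  add_mem' := by
    rintro _ _ ⟨a, b, ha, hb, rfl⟩ ⟨c, d, hc, hd, rfl⟩
    refine ⟨a * d + b * c, b * d, by positivity, mul_pos hb hd, ?_⟩
    rw [div_add_div _ _ (of_ne_zero hb.ne') (of_ne_zero hd.ne')]
    simp
  zero_mem' := ⟨0, 1, le_rfl, zero_lt_one, by simp⟩
  eq_zero_of_mem_of_neg_mem' := by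
    rintro _ ⟨a, b, ha, hb, rfl⟩ ⟨c, d, hc, hd, h⟩
    have hb' := of_ne_zero hb.ne'
    have hd' := of_ne_zero hd.ne'
    rw [neg_eq_iff_add_eq_zero, div_add_div _ _ hb' hd', div_eq_zero_iff,
      or_iff_left (mul_ne_zero hb' hd')] at h
    have h1 : a * d + b * c = 0 := of_injective (by simpa using h)
    have h2 : a * d = 0 := by
      have := mul_nonneg ha hd.le
      have := mul_nonneg hb.le hc
      exact ((add_eq_zero_iff_of_nonneg ‹0 ≤ a * d› ‹0 ≤ b * c›).1 h1).1
    rcases mul_eq_zero.1 h2 with rfl | rfl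
    · simp
    · exact absurd hd (lt_irrefl _)

end FracField

/-- Subtraction-closed ordered semirings in which all elements are nonnegative. -/
class NonnegSemiring : Prop where
  nonneg : ∀ a : R, 0 ≤ a

variable [ExistsAddOfLE R] [NonnegSemiring R]

namespace FracField

variable {R}

open scoped Classical in
noncomputable instance : LinearOrder (FracField R) :=
  letI : PartialOrder (FracField R) := .mkOfAddGroupCone (cone (R := R))
  { (inferInstance : PartialOrder (FracField R)) with
    le_total := by
      intro x y
      obtain ⟨a, b, hb, h⟩ := cases (y - x)
      have hb' : 0 < b := (NonnegSemiring.nonneg b).lt_of_ne' hb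
      rcases h with h | h
      · left; exact ⟨a, b, NonnegSemiring.nonneg a, hb', h⟩
      · right
        exact ⟨a, b, NonnegSemiring.nonneg a, hb', by rw [← neg_sub, h, neg_neg]⟩
    toDecidableLE := Classical.decRel _ }

theorem le_iff {x y : FracField R} : x ≤ y ↔ y - x ∈ cone (R := R) := Iff.rfl

instance : IsStrictOrderedRing (FracField R) := by
  have : IsOrderedRing (FracField R) := IsOrderedRing.mkOfCone (cone (R := R))
  exact IsOrderedRing.toIsStrictOrderedRing _

theorem of_nonneg (a : R) : 0 ≤ of R a := by
  rw [le_iff]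
  exact ⟨a, 1, NonnegSemiring.nonneg a, zero_lt_one, by simp⟩

theorem of_strictMono : StrictMono (of R) := by
  intro a b h
  obtain ⟨c, rfl⟩ := exists_add_of_le h.le
  refine lt_of_le_of_ne ?_ fun h' => h.ne (of_injective h')
  rw [map_add]
  have := of_nonneg c
  linarith

end FracField

end Differences

end HigherOrderRM

namespace HigherOrderRM

namespace Model

/-! ## Rational numbers of the model -/

variable {M : Model} [hM : M.IsRCA] {α : Type} [Obj M α]

instance : ExistsAddOfLE M.N := ⟨fun {a b} h => ⟨monusM b a, (add_monusM h).symm⟩⟩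

instance : NonnegSemiring M.N := ⟨N_zero_le⟩

variable (M) in
/-- The field of rational numbers of the model. -/
def K : Type := FracField M.N

noncomputable instance : Field M.K := inferInstanceAs (Field (FracField M.N))
noncomputable instance : LinearOrder M.K := inferInstanceAs (LinearOrder (FracField M.N))
instance : IsStrictOrderedRing M.K := inferInstanceAs (IsStrictOrderedRing (FracField M.N))

/-- The inclusion of the numbers into the rational numbers. -/
noncomputable def toK : M.N →+* M.K := FracField.of M.N

theorem toK_strictMono : StrictMono (toK (M := M)) := FracField.of_strictMono

@[simp] theorem toK_lt {a b : M.N} : toK a < toK b ↔ a < b := toK_strictMono.lt_iff_lt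
@[simp] theorem toK_le {a b : M.N} : toK a ≤ toK b ↔ a ≤ b := toK_strictMono.le_iff_le

theorem toK_nonneg (a : M.N) : 0 ≤ toK a := FracField.of_nonneg a

theorem toK_pos {a : M.N} (h : 0 < a) : 0 < toK a := by
  rw [← map_zero toK]; exact toK_lt.2 h

theorem toK_monusM {a b : M.N} (h : b ≤ a) : toK (monusM a b) = toK a - toK b := by
  rw [eq_sub_iff_add_eq, ← map_add, monusM_add h]

noncomputable def ratDenM (q : M.N) : M.N := sndM q + 1
noncomputable def ratPosM (q : M.N) : M.N := monusM 1 (parityM (fstM q)) * halfM (fstM q)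
noncomputable def ratNegM (q : M.N) : M.N := parityM (fstM q) * (halfM (fstM q) + 1)
noncomputable def ratMkM (p m d : M.N) : M.N :=
  pairM ((1 + 1) * monusM p m + predM ((1 + 1) * monusM m p)) (predM d)

section Def

variable {F G H : α → M.N}

@[fun_prop] theorem Def.ratDenM (hF : Def M F) : Def M (fun a => Model.ratDenM (F a)) := by
  unfold Model.ratDenM; fun_prop
@[fun_prop] theorem Def.ratPosM (hF : Def M F) : Def M (fun a => Model.ratPosM (F a)) := by
  unfold Model.ratPosM; fun_prop
@[fun_prop] theorem Def.ratNegM (hF : Def M F) : Def M (fun a => Model.ratNegM (F a)) := by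
  unfold Model.ratNegM; fun_prop
@[fun_prop] theorem Def.ratMkM (hF : Def M F) (hG : Def M G) (hH : Def M H) :
    Def M (fun a => Model.ratMkM (F a) (G a) (H a)) := by
  unfold Model.ratMkM; fun_prop

end Def

/-- The rational number with a given code. -/
noncomputable def val (q : M.N) : M.K := (toK (ratPosM q) - toK (ratNegM q)) / toK (ratDenM q)

theorem ratDenM_pos (q : M.N) : 0 < toK (ratDenM q) :=
  toK_pos (lt_succ_iff.2 (N_zero_le _))

theorem val_pairM_double (k d : M.N) : val (pairM (k + k) d) = toK k / toK (d + 1) := by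
  simp [val, ratPosM, ratNegM, ratDenM, parityM_double, halfM_double]

theorem val_pairM_double_succ (k d : M.N) :
    val (pairM (k + k + 1) d) = -toK (k + 1) / toK (d + 1) := by
  have : monusM (1 : M.N) 1 = 0 := monusM_eq_zero.2 le_rfl
  simp [val, ratPosM, ratNegM, ratDenM, parityM_double_succ, halfM_double_succ, this]

theorem predM_add_one {d : M.N} (hd : d ≠ 0) : predM d + 1 = d :=
  (eq_zero_or_succ d).resolve_left hd

theorem val_ratMkM (p m : M.N) {d : M.N} (hd : d ≠ 0) :
    val (ratMkM p m d) = (toK p - toK m) / toK d := by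
  rw [ratMkM]
  rcases le_or_gt m p with h | h
  · have h0 : monusM m p = 0 := monusM_eq_zero.2 h
    rw [h0, mul_zero, predM_zero, add_zero, one_add_one_eq_two, two_mul, val_pairM_double,
      predM_add_one hd, toK_monusM h]
  · have h0 : monusM p m = 0 := monusM_eq_zero.2 h.le
    obtain ⟨k, hk⟩ := exists_succ (n := monusM m p) fun h' => h.not_ge (monusM_eq_zero.1 h')
    have h1 : (1 + 1) * (k + 1) = k + k + 1 + 1 := by ring
    rw [h0, mul_zero, zero_add, hk, h1, predM_succ, val_pairM_double_succ, ← hk,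
      predM_add_one hd, toK_monusM h.le, neg_sub]

theorem exists_val (x : M.K) : ∃ q, val q = x := by
  obtain ⟨a, b, hb, h⟩ := FracField.cases x
  rcases h with h | h
  · exact ⟨ratMkM a 0 b, by rw [val_ratMkM _ _ hb, h, map_zero, sub_zero]; rfl⟩
  · exact ⟨ratMkM 0 a b, by rw [val_ratMkM _ _ hb, h, map_zero, zero_sub, neg_div]; rfl⟩

section eval

variable {Γ : Ctx} (e : M.Env Γ) (q r : Term Γ Ty.nat)

@[simp] theorem eval_ratDen : eval e (ratDen q) = ratDenM (eval e q) := by simp [ratDen, ratDenM]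
@[simp] theorem eval_ratPos : eval e (ratPos q) = ratPosM (eval e q) := by simp [ratPos, ratPosM]
@[simp] theorem eval_ratNeg : eval e (ratNeg q) = ratNegM (eval e q) := by simp [ratNeg, ratNegM]
@[simp] theorem eval_ratMk (p m d : Term Γ Ty.nat) :
    eval e (ratMk p m d) = ratMkM (eval e p) (eval e m) (eval e d) := by simp [ratMk, ratMkM]

theorem ratDenM_ne (q : M.N) : ratDenM q ≠ 0 := (lt_succ_iff.2 (N_zero_le (sndM q))).ne'

theorem toK_ratDenM_ne (q : M.N) : toK (ratDenM q) ≠ 0 := (ratDenM_pos q).ne'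

@[simp] theorem val_ratAdd : val (eval e (ratAdd q r)) = val (eval e q) + val (eval e r) := by
  have h1 := toK_ratDenM_ne (eval e q)
  have h2 := toK_ratDenM_ne (eval e r)
  simp only [ratAdd, eval_ratMk, eval_mul, eval_ratDen]
  rw [val_ratMkM _ _ (mul_ne_zero (ratDenM_ne _) (ratDenM_ne _)), val, val]
  simp only [eval_add, eval_mul, eval_ratPos, eval_ratNeg, eval_ratDen, map_add, map_mul]
  field_simp
  ring

@[simp] theorem val_ratSub : val (eval e (ratSub q r)) = val (eval e q) - val (eval e r) := by
  have h1 := toK_ratDenM_ne (eval e q)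
  have h2 := toK_ratDenM_ne (eval e r)
  simp only [ratSub, eval_ratMk, eval_mul, eval_ratDen]
  rw [val_ratMkM _ _ (mul_ne_zero (ratDenM_ne _) (ratDenM_ne _)), val, val]
  simp only [eval_add, eval_mul, eval_ratPos, eval_ratNeg, eval_ratDen, map_add, map_mul]
  field_simp
  ring

theorem ratPosM_or (q : M.N) : ratPosM q = 0 ∨ ratNegM q = 0 := by
  obtain ⟨k, h | h⟩ := exists_half (fstM q)
  · right; rw [ratNegM, h, parityM_double, zero_mul]
  · left; rw [ratPosM, h, parityM_double_succ, monusM_eq_zero.2 le_rfl, zero_mul]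

@[simp] theorem val_ratAbs : val (eval e (ratAbs q)) = |val (eval e q)| := by
  simp only [ratAbs, eval_ratMk, eval_ratDen, eval_add, eval_ratPos, eval_ratNeg, eval_zero]
  rw [val_ratMkM _ _ (ratDenM_ne _), val, abs_div, abs_of_pos (ratDenM_pos _)]
  congr 1
  rcases ratPosM_or (eval e q) with h | h <;> simp [h, abs_of_nonneg, toK_nonneg]

@[simp] theorem sat_ratLt : Sat e (ratLt q r) ↔ val (eval e q) < val (eval e r) := by
  simp only [ratLt, sat_lt, eval_add, eval_mul, eval_ratPos, eval_ratNeg, eval_ratDen, lt_eq]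
  rw [val, val, div_lt_div_iff₀ (ratDenM_pos _) (ratDenM_pos _), ← toK_lt]
  simp only [map_add, map_mul]
  constructor <;> intro h <;> linarith

@[simp] theorem sat_ratLe : Sat e (ratLe q r) ↔ val (eval e q) ≤ val (eval e r) := by
  simp [ratLe]

end eval

/-- `2 ^ (-n)`. -/
noncomputable def eps (n : M.N) : M.K := 1 / toK (twoPowM n)

theorem twoPowM_ne (n : M.N) : twoPowM n ≠ 0 := (twoPowM_pos n).ne'

theorem eps_pos (n : M.N) : 0 < eps n := div_pos one_pos (toK_pos (twoPowM_pos n))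

@[simp] theorem eps_zero : eps (0 : M.N) = 1 := by simp [eps, twoPowM_zero]

theorem eps_succ (n : M.N) : eps (n + 1) = eps n / 2 := by
  rw [eps, eps, twoPowM_succ, ← two_mul, map_mul, map_ofNat]
  field_simp

theorem eps_add (m n : M.N) : eps (m + n) = eps m * eps n := by
  rw [eps, eps, eps, twoPowM_add, map_mul]; field_simp

theorem eps_mono {m n : M.N} (h : m ≤ n) : eps n ≤ eps m := by
  obtain ⟨k, rfl⟩ := exists_add_of_le h
  have h1 : eps k ≤ 1 := by
    rw [eps, div_le_one (toK_pos (twoPowM_pos k)), ← map_one toK, toK_le]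
    exact N_one_le (twoPowM_pos k)
  rw [eps_add]
  exact mul_le_of_le_one_right (eps_pos m).le h1

/-- A positive rational is `a / b` with `1 ≤ a`, and `b < 2 ^ b`. So `K` is Archimedean relative to
the numbers of the model, standard or not. -/
theorem exists_eps_lt {x : M.K} (hx : 0 < x) : ∃ n, eps n < x := by
  obtain ⟨a, b, hb, h⟩ := FracField.cases x
  have hb' : 0 < toK b := toK_pos (N_pos_iff.2 hb)
  have h1 : x = toK a / toK b := by
    rcases h with h | h
    · exact h
    · have : 0 ≤ toK a / toK b := div_nonneg (toK_nonneg a) hb'.le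
      exact absurd hx (not_lt.2 (by rw [h]; exact neg_nonpos.2 this))
  refine ⟨b, ?_⟩
  have ha : 0 < toK a := by
    rw [h1] at hx
    exact (div_pos_iff_of_pos_right hb').1 hx
  have ha' : 1 ≤ toK a := by
    rw [← map_one toK, toK_le]
    rw [← map_zero toK, toK_lt] at ha
    exact N_one_le ha
  rw [h1]
  calc eps b < 1 / toK b := one_div_lt_one_div_of_lt hb' (toK_lt.2 (lt_twoPowM b))
    _ ≤ _ := by gcongr

@[simp] theorem val_ratMkM_one (n : M.N) : val (ratMkM 1 0 (twoPowM n)) = eps n := by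
  simp [eps, val_ratMkM _ _ (twoPowM_ne _)]

@[simp] theorem val_ratMkM_two (n : M.N) : val (ratMkM (1 + 1) 0 (twoPowM n)) = 2 * eps n := by
  rw [val_ratMkM _ _ (twoPowM_ne _), eps, map_add, map_one, map_zero]
  ring

/-! ## Internal functions with rational values -/

/-- A family of rationals is internal if some internal family of codes represents it; codes are not
unique, and none is preferred. -/
instance : Obj M M.K where
  Plot c := ∃ F, Internal F ∧ ∀ e, val (F e) = c e
  const x := by
    obtain ⟨q, rfl⟩ := exists_val x
    exact ⟨fun _ => q, .const q, fun _ => rfl⟩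
  reindex := by
    rintro Γ Δ c ⟨F, hF, e⟩ g hg
    exact ⟨_, hF.reindex hg, fun _ => e _⟩

@[fun_prop] theorem Def.val {F : α → M.N} (hF : Def M F) : Def M (fun a => Model.val (F a)) :=
  ⟨fun h => ⟨_, hF.plot h, fun _ => rfl⟩⟩

/-- A function on pairs of rational numbers is internal if it is so on codes. -/
theorem Def.of_codes {β : Type} [Obj M β] {f : M.K → M.K → β}
    (h : Def M (fun p : M.N × M.N => f (Model.val p.1) (Model.val p.2))) :
    Def M (fun p : M.K × M.K => f p.1 p.2) := by
  refine ⟨fun {Γ c} hc => ?_⟩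
  obtain ⟨⟨F, hF, eF⟩, G, hG, eG⟩ := hc
  have := h.plot (c := fun e => (F e, G e)) ⟨hF, hG⟩
  convert this using 1
  funext e
  simp only [eF, eG]

theorem Def.of_eq_val {f : α → M.K} {F : α → M.N} (hF : Def M F) (h : ∀ a, f a = Model.val (F a)) :
    Def M f := by
  have : f = fun a => Model.val (F a) := funext h
  rw [this]; fun_prop

@[fun_prop] theorem Def.toK {F : α → M.N} (hF : Def M F) : Def M (fun a => Model.toK (F a)) :=
  Def.of_eq_val (F := fun a => Model.ratMkM (F a) 0 1) (by fun_prop) fun a => by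
    simp [val_ratMkM]

@[fun_prop] theorem Def.eps {F : α → M.N} (hF : Def M F) : Def M (fun a => Model.eps (F a)) :=
  Def.of_eq_val (F := fun a => Model.ratMkM 1 0 (Model.twoPowM (F a))) (by fun_prop) fun a => by
    simp [val_ratMkM _ _ (twoPowM_ne _), Model.eps]

section Field

variable {F G : α → M.K}

@[fun_prop] theorem Def.add_K (hF : Def M F) (hG : Def M G) : Def M (fun a => F a + G a) := by
  have h : Def M (fun p : M.K × M.K => p.1 + p.2) := Def.of_codes <|
    Def.of_eq_val (F := fun p : M.N × M.N => Model.ratMkM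
      (Model.ratPosM p.1 * Model.ratDenM p.2 + Model.ratPosM p.2 * Model.ratDenM p.1)
      (Model.ratNegM p.1 * Model.ratDenM p.2 + Model.ratNegM p.2 * Model.ratDenM p.1)
      (Model.ratDenM p.1 * Model.ratDenM p.2)) (by fun_prop) fun p => by
        have h1 := toK_ratDenM_ne p.1
        have h2 := toK_ratDenM_ne p.2
        rw [val_ratMkM _ _ (mul_ne_zero (ratDenM_ne _) (ratDenM_ne _)), Model.val, Model.val]
        simp only [map_add, map_mul]
        field_simp
        ring
  fun_prop

@[fun_prop] theorem Def.mul_K (hF : Def M F) (hG : Def M G) : Def M (fun a => F a * G a) := by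
  have h : Def M (fun p : M.K × M.K => p.1 * p.2) := Def.of_codes <|
    Def.of_eq_val (F := fun p : M.N × M.N => Model.ratMkM
      (Model.ratPosM p.1 * Model.ratPosM p.2 + Model.ratNegM p.1 * Model.ratNegM p.2)
      (Model.ratPosM p.1 * Model.ratNegM p.2 + Model.ratNegM p.1 * Model.ratPosM p.2)
      (Model.ratDenM p.1 * Model.ratDenM p.2)) (by fun_prop) fun p => by
        have h1 := toK_ratDenM_ne p.1
        have h2 := toK_ratDenM_ne p.2
        rw [val_ratMkM _ _ (mul_ne_zero (ratDenM_ne _) (ratDenM_ne _)), Model.val, Model.val]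
        simp only [map_add, map_mul]
        field_simp
        ring
  fun_prop

@[fun_prop] theorem Def.neg_K (hF : Def M F) : Def M (fun a => -F a) := by
  have : (fun a => -F a) = fun a => (-1) * F a := by funext a; ring
  rw [this]; fun_prop

@[fun_prop] theorem Def.sub_K (hF : Def M F) (hG : Def M G) : Def M (fun a => F a - G a) := by
  simp only [sub_eq_add_neg]; fun_prop

@[fun_prop] theorem Def.lt_K (hF : Def M F) (hG : Def M G) : Def M (fun a => F a < G a) := by
  have h : Def M (fun p : M.K × M.K => p.1 < p.2) := Def.of_codes <|
    Def.congr (P := fun p : M.N × M.N =>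
      Model.ratPosM p.1 * Model.ratDenM p.2 + Model.ratNegM p.2 * Model.ratDenM p.1 <
        Model.ratPosM p.2 * Model.ratDenM p.1 + Model.ratNegM p.1 * Model.ratDenM p.2)
      (by fun_prop) fun p => by
        rw [Model.val, Model.val, div_lt_div_iff₀ (ratDenM_pos _) (ratDenM_pos _), ← toK_lt]
        simp only [map_add, map_mul]
        constructor <;> intro h <;> linarith
  fun_prop

@[fun_prop] theorem Def.le_K (hF : Def M F) (hG : Def M G) : Def M (fun a => F a ≤ G a) :=
  Def.congr (P := fun a => ¬ G a < F a) (by fun_prop) fun a => by simp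

@[fun_prop] theorem Def.max_K (hF : Def M F) (hG : Def M G) : Def M (fun a => max (F a) (G a)) := by
  have h : Def M (fun p : M.K × M.K => max p.1 p.2) := Def.of_codes <| by
    classical
    refine Def.of_eq_val (F := fun p : M.N × M.N => if Model.val p.1 ≤ Model.val p.2 then p.2
      else p.1) (by fun_prop) fun p => ?_
    rw [max_def]; split_ifs <;> rfl
  fun_prop

@[fun_prop] theorem Def.min_K (hF : Def M F) (hG : Def M G) : Def M (fun a => min (F a) (G a)) := by
  have : (fun a => min (F a) (G a)) = fun a => -max (-F a) (-G a) := by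
    funext a; rw [max_neg_neg, neg_neg]
  rw [this]; fun_prop

end Field

/-- An internal family of sequences of rational numbers is given by an internal functional. -/
theorem exists_codes {σ : Ty} {c : M.carrier σ → M.N → M.K}
    (hc : Def M (fun p : M.carrier σ × M.N => c p.1 p.2)) :
    ∃ X : M.carrier (σ ⇒ Ty.one), ∀ x n, val (X x n) = c x n := by
  obtain ⟨F, hF, e⟩ := hc.plot (Γ := [Ty.nat, σ])
    (c := fun e => (e σ Var.zero.succ, e Ty.nat Var.zero)) ⟨.var _, .var _⟩
  obtain ⟨H, hH, eH⟩ := hF.curry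
  obtain ⟨X, -, eX⟩ := hH.curry
  exact ⟨X Env.nil, fun x n => by rw [eX, eH, e]; rfl⟩

theorem exists_code {c : M.N → M.K} (hc : Def M c) : ∃ x : M.carrier Ty.one, ∀ n, val (x n) = c n := by
  obtain ⟨X, hX⟩ := exists_codes (σ := Ty.nat) (c := fun _ n => c n) (by fun_prop)
  exact ⟨X 0, hX 0⟩

end Model

end HigherOrderRM

namespace HigherOrderRM

namespace Model

open Filter

/-! ## Real numbers of the model -/

variable {M : Model} [hM : M.IsRCA]

variable (M) in
-- It refines `atTop`, so bounds that hold from some index on pass to germs; being an ultrafilter,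
-- it makes the germs a linearly ordered field.
noncomputable def limitFilter : Ultrafilter M.N := Ultrafilter.of atTop

variable (M) in
/-- An ordered field in which every real number of the model has a value, up to infinitesimals. -/
def L : Type := Germ (limitFilter M : Filter M.N) M.K

noncomputable instance : Field M.L := inferInstanceAs (Field (Germ (limitFilter M : Filter M.N) M.K))
noncomputable instance : LinearOrder M.L :=
  inferInstanceAs (LinearOrder (Germ (limitFilter M : Filter M.N) M.K))
instance : IsStrictOrderedRing M.L :=
  inferInstanceAs (IsStrictOrderedRing (Germ (limitFilter M : Filter M.N) M.K))

/-- The inclusion of the rational numbers. -/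
noncomputable def toL : M.K →+* M.L :=
  (Germ.coeRingHom (limitFilter M : Filter M.N)).comp (Pi.constRingHom M.N M.K)

/-- The value of a sequence of codes. -/
noncomputable def st (x : M.carrier Ty.one) : M.L :=
  (((fun n => val (x n)) : M.N → M.K) : Germ (limitFilter M : Filter M.N) M.K)

theorem toL_le {a b : M.K} : toL a ≤ toL b ↔ a ≤ b :=
  Germ.const_le_iff (l := (limitFilter M : Filter M.N))

theorem toL_lt {a b : M.K} : toL a < toL b ↔ a < b := by
  rw [← not_le, toL_le, not_le]

theorem toL_abs (a : M.K) : toL |a| = |toL a| := by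
  rcases le_total 0 a with h | h
  · rw [abs_of_nonneg h, abs_of_nonneg (by rw [← map_zero toL]; exact toL_le.2 h)]
  · rw [abs_of_nonpos h, abs_of_nonpos (by rw [← map_zero toL]; exact toL_le.2 h), map_neg]

theorem st_le {x : M.carrier Ty.one} {a : M.K} (m : M.N) (h : ∀ n, m ≤ n → val (x n) ≤ a) :
    st x ≤ toL a := by
  refine (Germ.coe_le (l := (limitFilter M : Filter M.N))).2 ?_
  exact (Ultrafilter.of_le _) (mem_of_superset (mem_atTop m) h)

theorem le_st {x : M.carrier Ty.one} {a : M.K} (m : M.N) (h : ∀ n, m ≤ n → a ≤ val (x n)) :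
    toL a ≤ st x := by
  refine (Germ.coe_le (l := (limitFilter M : Filter M.N))).2 ?_
  exact (Ultrafilter.of_le _) (mem_of_superset (mem_atTop m) h)

noncomputable def epsL (n : M.N) : M.L := toL (eps n)

theorem epsL_pos (n : M.N) : 0 < epsL n := by
  rw [← map_zero toL]; exact toL_lt.2 (eps_pos n)

theorem epsL_succ (n : M.N) : epsL (n + 1) = epsL n / 2 := by
  rw [epsL, eps_succ, map_div₀, map_ofNat]; rfl

theorem epsL_mono {m n : M.N} (h : m ≤ n) : epsL n ≤ epsL m := toL_le.2 (eps_mono h)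

theorem exists_epsL_lt {x : M.K} (h : 0 < x) : ∃ n, epsL n < toL x :=
  (exists_eps_lt h).imp fun _ h => toL_lt.2 h

def IsReal (x : M.carrier Ty.one) : Prop := ∀ n i, |val (x n) - val (x (n + i))| < eps n

def RLt (x y : M.carrier Ty.one) : Prop := ∃ n, 2 * eps n < val (y n) - val (x n)

def REq (x y : M.carrier Ty.one) : Prop := ∀ n, |val (x n) - val (y n)| ≤ 2 * eps n

section eval

variable {Γ : Ctx} (e : M.Env Γ) (x y : Term Γ Ty.one)

@[simp] theorem sat_isReal : Sat e (isReal x) ↔ IsReal (eval e x) := by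
  simp [isReal, IsReal]

@[simp] theorem sat_realLt : Sat e (realLt x y) ↔ RLt (eval e x) (eval e y) := by
  simp [realLt, RLt]

@[simp] theorem sat_realLe : Sat e (realLe x y) ↔ ¬ RLt (eval e y) (eval e x) := by
  simp [realLe]

@[simp] theorem sat_realEq : Sat e (realEq x y) ↔ REq (eval e x) (eval e y) := by
  simp [realEq, REq]

theorem val_realAdd (n : M.N) : val (eval e (realAdd x y) n) =
    val (eval e x (n + 1)) + val (eval e y (n + 1)) := by
  rw [realAdd, eval_lam_app]; simp

theorem val_realSub (n : M.N) : val (eval e (realSub x y) n) =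
    val (eval e x (n + 1)) - val (eval e y (n + 1)) := by
  rw [realSub, eval_lam_app]; simp

theorem val_realZero (n : M.N) : val (eval e realZero n) = 0 := by
  rw [realZero, eval_lam_app]; simp [val_ratMkM]

theorem val_realOne (n : M.N) : val (eval e realOne n) = 1 := by
  rw [realOne, eval_lam_app]; simp [val_ratMkM]

end eval

/-- From index `n` on, all entries lie within `eps n` of the `n`-th, and the germ inherits both
bounds. This links entries with values in all later estimates. -/
theorem IsReal.near {x : M.carrier Ty.one} (hx : IsReal x) (n : M.N) :
    |toL (val (x n)) - st x| ≤ epsL n := by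
  have h : ∀ k, n ≤ k → |val (x n) - val (x k)| < eps n := fun k hk => by
    obtain ⟨i, rfl⟩ := exists_add_of_le hk
    exact hx n i
  have h1 := st_le (x := x) (a := val (x n) + eps n) n fun k hk => by
    have := abs_lt.1 (h k hk); linarith
  have h2 := le_st (x := x) (a := val (x n) - eps n) n fun k hk => by
    have := abs_lt.1 (h k hk); linarith
  rw [map_add] at h1
  rw [map_sub] at h2
  rw [abs_le, epsL]
  constructor <;> linarith

/-- Strict inequality of reals is inequality of germs by a margin that is not infinitesimal. The
excess in the definition is a positive rational, hence above some `eps`. -/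
theorem rlt_iff {x y : M.carrier Ty.one} (hx : IsReal x) (hy : IsReal y) :
    RLt x y ↔ ∃ n, st x + epsL n < st y := by
  constructor
  · rintro ⟨n, h⟩
    obtain ⟨m, hm⟩ := exists_epsL_lt (sub_pos.2 h)
    have h1 := abs_le.1 (hx.near n)
    have h2 := abs_le.1 (hy.near n)
    rw [map_sub, map_sub, map_mul, map_ofNat] at hm
    change _ < _ - 2 * epsL n at hm
    exact ⟨m, by linarith⟩
  · rintro ⟨n, h⟩
    -- Two entries at index `n + 2` cost at most half of `epsL n` together, and the other half is
    -- exactly the required `2 * epsL (n + 2)`.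
    refine ⟨n + 1 + 1, toL_lt.1 ?_⟩
    have h1 := abs_le.1 (hx.near (n + 1 + 1))
    have h2 := abs_le.1 (hy.near (n + 1 + 1))
    rw [map_sub, map_mul, map_ofNat]
    change 2 * epsL _ < _
    rw [epsL_succ, epsL_succ] at *
    linarith

theorem not_rlt_iff {x y : M.carrier Ty.one} (hx : IsReal x) (hy : IsReal y) :
    ¬ RLt x y ↔ ∀ n, st y ≤ st x + epsL n := by
  rw [rlt_iff hx hy]; push Not; rfl

/-- Distinct rationals of the model never differ by an infinitesimal. -/
theorem le_of_forall_epsL {a b : M.K} (h : ∀ n, toL a ≤ toL b + epsL n) : a ≤ b := by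
  by_contra! h'
  obtain ⟨n, hn⟩ := exists_epsL_lt (sub_pos.2 h')
  rw [map_sub] at hn
  have := h n
  linarith

theorem req_iff {x y : M.carrier Ty.one} (hx : IsReal x) (hy : IsReal y) :
    REq x y ↔ ∀ n, |st x - st y| ≤ epsL n := by
  constructor
  · intro h n
    have h1 := abs_le.1 (hx.near (n + 1 + 1))
    have h2 := abs_le.1 (hy.near (n + 1 + 1))
    have h3 := toL_le.2 (h (n + 1 + 1))
    rw [map_mul, map_ofNat, toL_abs, map_sub] at h3
    change _ ≤ 2 * epsL _ at h3
    have h3 := abs_le.1 h3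
    rw [epsL_succ, epsL_succ] at *
    rw [abs_le]
    constructor <;> linarith
  · intro h n
    refine le_of_forall_epsL fun m => ?_
    have h1 := abs_le.1 (hx.near n)
    have h2 := abs_le.1 (hy.near n)
    have h3 := abs_le.1 (h m)
    rw [map_mul, map_ofNat, toL_abs, map_sub]
    change _ ≤ 2 * epsL _ + _
    rw [abs_le]
    constructor <;> linarith

theorem isReal_const {x : M.carrier Ty.one} {a : M.K} (h : ∀ n, val (x n) = a) : IsReal x := by
  intro n i; simp [h, eps_pos]

theorem st_const {x : M.carrier Ty.one} {a : M.K} (h : ∀ n, val (x n) = a) : st x = toL a :=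
  le_antisymm (st_le 0 fun n _ => (h n).le) (le_st 0 fun n _ => (h n).ge)

/-- The constant real number with a given rational value. -/
noncomputable def ofK (a : M.K) : M.carrier Ty.one :=
  (exists_code (Def.const (α := M.N) a)).choose

theorem val_ofK (a : M.K) (n : M.N) : val (ofK a n) = a :=
  (exists_code (Def.const (α := M.N) a)).choose_spec n

theorem isReal_ofK (a : M.K) : IsReal (ofK a) := isReal_const (val_ofK a)

theorem st_ofK (a : M.K) : st (ofK a) = toL a := st_const (val_ofK a)

section eval

variable {Γ : Ctx} (e : M.Env Γ) {x y : Term Γ Ty.one}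

theorem isReal_realAdd (hx : IsReal (eval e x)) (hy : IsReal (eval e y)) :
    IsReal (eval e (realAdd x y)) := by
  intro n i
  have h1 := hx (n + 1) i
  have h2 := hy (n + 1) i
  have e1 : n + i + 1 = n + 1 + i := by ring
  rw [val_realAdd, val_realAdd, e1]
  rw [eps_succ, abs_lt] at h1 h2
  rw [abs_lt]
  constructor <;> linarith

theorem isReal_realSub (hx : IsReal (eval e x)) (hy : IsReal (eval e y)) :
    IsReal (eval e (realSub x y)) := by
  intro n i
  have h1 := hx (n + 1) i
  have h2 := hy (n + 1) i
  have e1 : n + i + 1 = n + 1 + i := by ring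
  rw [val_realSub, val_realSub, e1]
  rw [eps_succ, abs_lt] at h1 h2
  rw [abs_lt]
  constructor <;> linarith

theorem st_realAdd (hx : IsReal (eval e x)) (hy : IsReal (eval e y)) (n : M.N) :
    |st (eval e (realAdd x y)) - (st (eval e x) + st (eval e y))| ≤ epsL n := by
  have h1 := abs_le.1 ((isReal_realAdd e hx hy).near (n + 1))
  have h2 := abs_le.1 (hx.near (n + 1 + 1))
  have h3 := abs_le.1 (hy.near (n + 1 + 1))
  rw [val_realAdd, map_add] at h1
  rw [epsL_succ (n + 1)] at h2 h3
  rw [epsL_succ] at *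
  rw [abs_le]
  constructor <;> linarith

theorem st_realSub (hx : IsReal (eval e x)) (hy : IsReal (eval e y)) (n : M.N) :
    |st (eval e (realSub x y)) - (st (eval e x) - st (eval e y))| ≤ epsL n := by
  have h1 := abs_le.1 ((isReal_realSub e hx hy).near (n + 1))
  have h2 := abs_le.1 (hx.near (n + 1 + 1))
  have h3 := abs_le.1 (hy.near (n + 1 + 1))
  rw [val_realSub, map_sub] at h1
  rw [epsL_succ (n + 1)] at h2 h3
  rw [epsL_succ] at *
  rw [abs_le]
  constructor <;> linarith

/-- `x` belongs to the unit interval. -/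
def InUnit (x : M.carrier Ty.one) : Prop := IsReal x ∧ ∀ n, 0 ≤ st x + epsL n ∧ st x ≤ 1 + epsL n

theorem sat_inUnitInterval : Sat e (inUnitInterval x) ↔ InUnit (eval e x) := by
  simp only [inUnitInterval, sat_conj, sat_isReal, sat_realLe, InUnit]
  refine and_congr_right fun hx => ?_
  rw [not_rlt_iff hx (isReal_const (val_realZero e)), st_const (val_realZero e),
    not_rlt_iff (isReal_const (val_realOne e)) hx, st_const (val_realOne e), map_zero, map_one,
    forall_and]

/-- `|x - y| < Ψ y`, up to infinitesimals. -/
def Near (Ψ : M.carrier (Ty.one ⇒ Ty.one)) (x y : M.carrier Ty.one) : Prop :=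
  ∃ n, |st x - st y| + epsL n < st (Ψ y)

theorem sat_inInterval {Ψ : Term Γ (Ty.one ⇒ Ty.one)} (hx : IsReal (eval e x))
    (hy : IsReal (eval e y)) (hΨ : IsReal (eval e (Ψ ⬝ y))) :
    Sat e (inInterval Ψ x y) ↔ Near (eval e Ψ) (eval e x) (eval e y) := by
  have hs := isReal_realSub e hy hΨ
  have ha := isReal_realAdd e hy hΨ
  simp only [inInterval, sat_conj, sat_realLt, rlt_iff hs hx, rlt_iff hx ha, Near]
  have h1 := st_realSub e hy hΨ
  have h2 := st_realAdd e hy hΨ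
  rw [eval_app] at h1 h2
  constructor
  · rintro ⟨⟨n, hn⟩, ⟨m, hm⟩⟩
    refine ⟨max n m + 1, ?_⟩
    have h3 := abs_le.1 (h1 (max n m + 1))
    have h4 := abs_le.1 (h2 (max n m + 1))
    have h5 := epsL_mono (le_max_left n m)
    have h6 := epsL_mono (le_max_right n m)
    rw [epsL_succ] at *
    rw [← lt_sub_iff_add_lt, abs_lt]
    constructor <;> linarith
  · rintro ⟨n, hn⟩
    have h3 := abs_le.1 (h1 (n + 1))
    have h4 := abs_le.1 (h2 (n + 1))
    rw [← lt_sub_iff_add_lt, abs_lt] at hn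
    rw [epsL_succ] at *
    refine ⟨⟨n + 1, ?_⟩, ⟨n + 1, ?_⟩⟩ <;> rw [epsL_succ] <;> linarith

end eval

end Model

end HigherOrderRM

namespace HigherOrderRM

namespace Model

/-! ## `(∃³)` implies `LUB` -/

variable {M : Model} {α : Type} [Obj M α]

instance {Γ : Ctx} : Obj M (M.Env Γ) where
  Plot c := ∀ τ v, Internal (fun e => c e τ v)
  const _ _ _ := .const _
  reindex h _ hg τ v := (h τ v).reindex hg

variable (M) in
/-- The model satisfies `(∃³)`. -/
def HasE3 : Prop := ∃ E : M.carrier Ty.three, ∀ Y : M.carrier Ty.two, (∃ f, Y f = (0 : M.N)) ↔ E Y = (0 : M.N)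

theorem hasE3_of_holds (h : M.Holds exists3) : M.HasE3 := by
  simp [Holds, exists3] at h
  obtain ⟨E, -, hE⟩ := h
  exact ⟨E, hE⟩

theorem Def.eval {Γ : Ctx} {τ : Ty} (t : Term Γ τ) : Def M (fun e : M.Env Γ => Model.eval e t) := by
  induction t with
  | var v => exact ⟨fun hc => hc _ v⟩
  | const c => exact Def.const _
  | app s t hs ht => exact Def.app hs ht

theorem Def.envCons {Γ : Ctx} {σ : Ty} {e : α → M.Env Γ} {x : α → M.carrier σ} (he : Def M e)
    (hx : Def M x) : Def M (fun a => Env.cons (x a) (e a)) := by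
  refine ⟨fun {Δ c} hc τ v => ?_⟩
  cases v with
  | zero => exact hx.plot hc
  | succ v => exact he.plot hc _ v

variable [hM : M.IsRCA]

section E3

variable (hE : M.HasE3)

include hE

/-- `E`, applied to the curried characteristic function of `P`, is a characteristic function of the
quantified predicate. -/
theorem Def.exists_one {P : α → M.carrier Ty.one → Prop}
    (hP : Def M (fun p : α × M.carrier Ty.one => P p.1 p.2)) : Def M (fun a => ∃ f, P a f) := by
  refine ⟨fun {Γ c} hc => ?_⟩
  obtain ⟨E, hE⟩ := hE
  have hc' : Obj.Plot (fun e : M.Env (Ty.one :: Γ) => (c e.tail, e Ty.one Var.zero)) :=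
    ⟨Obj.reindex hc fun τ v => .var v.succ, .var Var.zero⟩
  obtain ⟨F, hF, eF⟩ := hP.plot hc'
  obtain ⟨H, hH, eH⟩ := hF.curry
  refine ⟨fun e => E (H e), .app (.const E) hH, fun e => ?_⟩
  rw [← hE]
  refine exists_congr fun f => ?_
  rw [eH, ← eF]
  rfl

/-- A number is quantified as the value at `0` of a function. -/
theorem Def.exists_nat {P : α → M.N → Prop}
    (hP : Def M (fun p : α × M.N => P p.1 p.2)) : Def M (fun a => ∃ n, P a n) := by
  have h : Def M (fun p : α × M.carrier Ty.one => P p.1 (p.2 (0 : M.N))) :=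
    hP.comp (g := fun p : α × M.carrier Ty.one => (p.1, p.2 (0 : M.N))) (by fun_prop)
  refine Def.congr (Def.exists_one hE (P := fun a f => P a (f (0 : M.N))) h) fun a => ⟨?_, fun ⟨f, hf⟩ => ⟨_, hf⟩⟩
  rintro ⟨n, hn⟩
  refine ⟨Model.lam fun _ => n, ?_⟩
  rwa [lam_app (by fun_prop)]

theorem Def.forall_one {P : α → M.carrier Ty.one → Prop}
    (hP : Def M (fun p : α × M.carrier Ty.one => P p.1 p.2)) : Def M (fun a => ∀ f, P a f) :=
  Def.congr (Def.exists_one hE (P := fun a f => ¬ P a f) (by fun_prop)).not fun a => by simp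

theorem Def.forall_nat {P : α → M.N → Prop}
    (hP : Def M (fun p : α × M.N => P p.1 p.2)) : Def M (fun a => ∀ n, P a n) :=
  Def.congr (Def.exists_nat hE (P := fun a f => ¬ P a f) (by fun_prop)).not fun a => by simp

/-- Since `E` decides quantifiers over types `0` and `1`, second-order formulas become admissible in
induction and choice. -/
theorem Def.sat {Γ : Ctx} {φ : Form Γ} (hφ : φ.SecondOrder) : Def M (fun e : M.Env Γ => Sat e φ) := by
  induction φ with
  | eq s t => exact Def.eq (Def.eval s) (Def.eval t)
  | lt s t => exact Def.lt (Def.eval s) (Def.eval t)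
  | falsum => exact Def.const _
  | imp φ ψ h h' => exact Def.imp (h hφ.1) (h' hφ.2)
  | @all Γ σ φ h =>
    have := (h hφ.2).comp (g := fun p : M.Env Γ × M.carrier σ => Env.cons p.2 p.1)
      (Def.envCons Def.fst Def.snd)
    rcases hφ.1 with rfl | rfl
    · exact Def.forall_nat hE this
    · exact Def.forall_one hE this

end E3

/-- Choice over numbers follows from choice over functions: a number is read off as `x 0`, and
supplied as a constant function. -/
theorem choice_nat {P : M.N → M.N → Prop} (hP : Def M (fun p : M.N × M.N => P p.1 p.2))
    (h : ∀ x, ∃ y, P x y) : ∃ f : M.carrier Ty.one, ∀ n, P n (f n) := by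
  obtain ⟨Y, hY⟩ := choice (P := fun x y => P (x (0 : M.N)) y)
    (hP.comp (g := fun p : M.carrier Ty.one × M.N => (p.1 (0 : M.N), p.2)) (by fun_prop))
    fun x => h _
  refine ⟨Model.lam fun n => Y (Model.lam fun _ => n), fun n => ?_⟩
  rw [lam_app (by fun_prop)]
  have := hY (Model.lam fun _ => n)
  rwa [lam_app (by fun_prop)] at this

theorem IsReal.le_iff {x : M.carrier Ty.one} (hx : IsReal x) (a : M.K) :
    (∀ m, a ≤ val (x m) + eps m) ↔ ∀ m, toL a ≤ st x + epsL m := by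
  constructor
  · intro h m
    have h1 := toL_le.2 (h (m + 1))
    have h2 := abs_le.1 (hx.near (m + 1))
    rw [map_add] at h1
    change _ ≤ _ + epsL _ at h1
    rw [epsL_succ] at *
    linarith
  · intro h m
    refine le_of_forall_epsL fun n => ?_
    have h1 := h n
    have h2 := abs_le.1 (hx.near m)
    rw [map_add]
    change _ ≤ _ + epsL _ + _
    linarith

theorem IsReal.ge_iff {x : M.carrier Ty.one} (hx : IsReal x) (a : M.K) :
    (∀ m, val (x m) ≤ a + eps m) ↔ ∀ m, st x ≤ toL a + epsL m := by
  constructor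
  · intro h m
    have h1 := toL_le.2 (h (m + 1))
    have h2 := abs_le.1 (hx.near (m + 1))
    rw [map_add] at h1
    change _ ≤ _ + epsL _ at h1
    rw [epsL_succ] at *
    linarith
  · intro h m
    refine le_of_forall_epsL fun n => ?_
    have h1 := h n
    have h2 := abs_le.1 (hx.near m)
    rw [map_add]
    change _ ≤ _ + epsL _ + _
    linarith

theorem inUnit_iff {x : M.carrier Ty.one} :
    InUnit x ↔ IsReal x ∧ (∀ m, 0 ≤ val (x m) + eps m) ∧ ∀ m, val (x m) ≤ 1 + eps m := by
  rw [InUnit]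
  refine and_congr_right fun hx => ?_
  rw [hx.le_iff, hx.ge_iff, forall_and, map_zero, map_one]

theorem Def.inUnit (hE : M.HasE3) : Def M (fun x : M.carrier Ty.one => InUnit x) := by
  refine Def.congr ?_ fun x => inUnit_iff
  refine Def.and ?_ (Def.and ?_ ?_)
  · refine Def.forall_nat hE (P := fun (x : M.carrier Ty.one) n =>
      ∀ i, |Model.val (x n) - Model.val (x (n + i))| < Model.eps n) ?_
    refine Def.forall_nat hE (P := fun (p : M.carrier Ty.one × M.N) i =>
      |Model.val (p.1 p.2) - Model.val (p.1 (p.2 + i))| < Model.eps p.2) ?_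
    simp only [abs_lt]
    fun_prop
  · exact Def.forall_nat hE (by fun_prop)
  · exact Def.forall_nat hE (by fun_prop)

/-- At precision `n`, let `a n` be a number such that some element of the set in the unit interval
is at least `a n * eps n`, but none is at least `(a n + 1) * eps n`. The supremum is the real with
entries `a n * eps n`. -/
theorem exists_lub (hE : M.HasE3) {φ : M.carrier Ty.one → Prop} (hφ : Def M φ)
    {o : M.carrier Ty.one} (ho : ∀ n, val (o n) = 0) (h0 : φ o) :
    ∃ y, InUnit y ∧ (∀ z, IsReal z → RLt y z → (∀ m, st z ≤ 1 + epsL m) → ¬ φ z) ∧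
      ∀ z, InUnit z → (∀ w, IsReal w → RLt z w → (∀ m, st w ≤ 1 + epsL m) → ¬ φ w) →
        ¬ RLt z y := by
  let P : M.N → M.N → Prop := fun n k =>
    ∃ x, (InUnit x ∧ φ x) ∧ ∀ m, toK k * eps n ≤ val (x m) + eps m
  have hP : Def M (fun p : M.N × M.N => P p.1 p.2) := by
    refine Def.exists_one hE (Def.and ?_ ?_)
    · have := Def.inUnit hE
      fun_prop
    · exact Def.forall_nat hE (by fun_prop)
  have hPk : ∀ n, Def M (P n) := fun n => hP.comp (g := fun k => (n, k)) (by fun_prop)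
  have hP0 : ∀ n, P n 0 := fun n => by
    have h1 : IsReal o := isReal_const ho
    refine ⟨o, ⟨⟨h1, fun m => ?_⟩, h0⟩, fun m => ?_⟩
    · have := epsL_pos m
      rw [st_const ho, map_zero]
      constructor <;> linarith
    · have := eps_pos m
      rw [ho, map_zero]; linarith
  have bound : ∀ {n k}, P n k → toK k * eps n ≤ 1 := by
    rintro n k ⟨x, ⟨hx, -⟩, h⟩
    rw [hx.1.le_iff] at h
    refine le_of_forall_epsL fun m => ?_
    have h1 := h (m + 1)
    have h2 := (hx.2 (m + 1)).2
    rw [epsL_succ] at h1 h2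
    rw [map_one]
    linarith
  -- The search is bounded: `P n k` forces `k * eps n ≤ 1`, which fails at `k = 2 ^ n + 1`.
  obtain ⟨a, ha⟩ := choice_nat (P := fun n k => P n k ∧ ¬ P n (k + 1)) (by
      have : Def M (fun p : M.N × M.N => P p.1 (p.2 + 1)) :=
        hP.comp (g := fun p : M.N × M.N => (p.1, p.2 + 1)) (by fun_prop)
      fun_prop) fun n => by
    refine exists_switch (hPk n) (hP0 n) (n := twoPowM n + 1) fun h => ?_
    have h1 := bound h
    have h2 : toK (twoPowM n) * eps n = 1 := by
      rw [eps, mul_one_div_cancel (toK_pos (twoPowM_pos n)).ne']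
    rw [map_add, map_one, add_mul, h2, one_mul] at h1
    have := eps_pos n
    linarith
  let s : M.N → M.K := fun n => toK (a n) * eps n
  obtain ⟨y, hy⟩ := exists_code (c := s) (by fun_prop)
  -- Otherwise the element that witnesses `a m` would also witness `a n + 1` at precision `n`. Used
  -- in both directions, this gives the Cauchy rate required of a real.
  have hs : ∀ n m, s m < s n + eps n := by
    intro n m
    by_contra! h
    refine (ha n).2 ?_
    obtain ⟨x, hx, hx'⟩ := (ha m).1
    refine ⟨x, hx, fun k => le_trans ?_ (hx' k)⟩
    refine le_trans (le_of_eq ?_) h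
    rw [map_add, map_one, add_mul, one_mul]
  have hyr : IsReal y := by
    intro n i
    have h1 := hs n (n + i)
    have h2 := hs (n + i) n
    have h3 := eps_mono (show n ≤ n + i from le_add_of_nonneg_right (N_zero_le i))
    rw [hy, hy, abs_lt]
    constructor <;> linarith
  have hyu : InUnit y := by
    rw [inUnit_iff]
    refine ⟨hyr, fun m => ?_, fun m => ?_⟩
    · have h1 := eps_pos m
      have h2 : 0 ≤ s m := mul_nonneg (toK_nonneg _) h1.le
      rw [hy]; linarith
    · have h1 := eps_pos m
      have h2 : s m ≤ 1 := bound (ha m).1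
      rw [hy]; linarith
  have near : ∀ m, |toL (s m) - st y| ≤ epsL m := fun m => by
    have := hyr.near m
    rwa [hy] at this
  refine ⟨y, hyu, fun z hz hyz hz1 hφz => ?_, fun z hz hnone hzy => ?_⟩
  · rw [rlt_iff hyr hz] at hyz
    obtain ⟨n, hn⟩ := hyz
    -- The grid point above `s (n + 1)` is at most `y + 2 * epsL (n + 1) = y + epsL n`, hence below
    -- `z`; so `z` would witness `a (n + 1) + 1`.
    have h1 := abs_le.1 (near (n + 1))
    refine (ha (n + 1)).2 ⟨z, ⟨⟨hz, fun m => ⟨?_, hz1 m⟩⟩, hφz⟩, ?_⟩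
    · have h2 := (hyu.2 (m + 1)).1
      have h3 := epsL_pos n
      have h4 := epsL_pos m
      rw [epsL_succ] at h2
      linarith
    · rw [hz.le_iff]
      intro m
      have h2 := epsL_pos m
      rw [map_add, map_one, add_mul, one_mul, map_add]
      change toL (s (n + 1)) + epsL (n + 1) ≤ _
      rw [epsL_succ] at *
      linarith
  · rw [rlt_iff hz.1 hyr] at hzy
    obtain ⟨n, hn⟩ := hzy
    -- This element is at least `y - epsL (n + 1)` up to infinitesimals, so it exceeds `z` and
    -- contradicts `hnone`.
    obtain ⟨x, ⟨hx, hφx⟩, h⟩ := (ha (n + 1)).1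
    refine hnone x hx.1 ?_ (fun m => (hx.2 m).2) hφx
    rw [rlt_iff hz.1 hx.1]
    rw [hx.1.le_iff] at h
    refine ⟨n + 1 + 1, ?_⟩
    have h1 := abs_le.1 (near (n + 1))
    have h2 := h (n + 1 + 1)
    change toL (s (n + 1)) ≤ _ at h2
    rw [epsL_succ (n + 1)] at *
    rw [epsL_succ] at *
    linarith

theorem holds_LUB (hE : M.HasE3) {ψ : Sentence} (hψ : ψ ∈ LUB) : M.Holds ψ := by
  obtain ⟨Γ, φ, hφ, rfl⟩ := hψ
  rw [holds_close]
  intro e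
  rw [lubFormula, sat_imp]
  intro h
  rw [sat_conj, sat_conj, sat_inst] at h
  have hDef : Def M (fun x : M.carrier Ty.one => Sat (Env.cons x e) φ) :=
    (Def.sat hE hφ).comp (Def.envCons (Def.const e) Def.id)
  have h1 : ∀ {Δ : Ctx} (e' : M.Env Δ) (z : M.carrier Ty.one), IsReal z →
      (¬ RLt (eval e' realOne) z ↔ ∀ m, st z ≤ 1 + epsL m) := fun e' z hz => by
    rw [not_rlt_iff (isReal_const (val_realOne e')) hz, st_const (val_realOne e'), map_one]
  obtain ⟨y, hy, hy1, hy2⟩ := exists_lub hE hDef (val_realZero e) h.2.1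
  rw [sat_ex]
  refine ⟨y, ?_⟩
  rw [sat_conj, sat_conj, sat_inUnitInterval, noneAbove]
  refine ⟨hy, ?_, ?_⟩
  · rw [sat_all]
    intro z hz hφz
    simp at hz hφz
    exact hy1 z hz.1 hz.2.1 ((h1 _ z hz.1).1 hz.2.2) hφz
  · rw [sat_all]
    intro z
    rw [sat_imp, sat_conj, sat_inUnitInterval, noneAbove, sat_realLe]
    rintro ⟨hz, hnone⟩
    refine hy2 z hz fun w hw hzw hw1 hφw => ?_
    rw [sat_all] at hnone
    have := hnone w
    simp at this
    exact this hw hzw ((h1 _ w hw).2 hw1) hφw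

end Model

end HigherOrderRM

namespace HigherOrderRM

/-! ## `LUB` implies `HBU` -/

section Formula

variable {Γ : Ctx}

/-- The `i`-th member of the sequence of functions coded by `v`. -/
def slice (v : Term Γ Ty.one) (i : Term Γ Ty.nat) : Term Γ Ty.one :=
  lam (v.wk ⬝ pair i.wk v0)

/-- There is a finite sequence in the unit interval such that the associated intervals cover
`[0, x]`. Here `v0` is `x` and `v1` is `Ψ`. -/
def coveredTo : Form (Ty.one :: (Ty.one ⇒ Ty.one) :: Γ) :=
  Form.ex Ty.nat (Form.ex Ty.one (
    allLt v1 (inUnitInterval (slice v1 v0)) ⩑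
    Form.all Ty.one (inUnitInterval v0 ⟹ realLe v0 (Term.var Var.zero.succ.succ.succ) ⟹
      exLt v2 (inInterval (Term.var Var.zero.succ.succ.succ.succ.succ) v1 (slice v2 v0)))))

theorem secondOrder_coveredTo : (coveredTo (Γ := Γ)).SecondOrder := by
  simp [coveredTo, Form.SecondOrder, Form.ex, Form.neg, Form.conj, allLt, exLt, inUnitInterval,
    inInterval, realLe, realLt, ratLt, isReal]

end Formula

namespace Model

variable {M : Model} [hM : M.IsRCA]

noncomputable def sliceM (v : M.carrier Ty.one) (i : M.N) : M.carrier Ty.one :=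
  Model.lam fun n => v (pairM i n)

theorem sliceM_app (v : M.carrier Ty.one) (i n : M.N) : sliceM v i n = v (pairM i n) :=
  lam_app (by fun_prop) n

@[simp] theorem eval_slice {Γ : Ctx} (e : M.Env Γ) (v : Term Γ Ty.one) (i : Term Γ Ty.nat) :
    eval e (slice v i) = sliceM (eval e v) (eval e i) := by
  simp [slice, eval_lam, sliceM]

theorem sat_allLt {Γ : Ctx} (e : M.Env Γ) (n : Term Γ Ty.nat) (φ : Form (Ty.nat :: Γ)) :
    Sat e (allLt n φ) ↔ ∀ i < eval e n, Sat (Env.cons i e) φ := by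
  simp [allLt]

theorem sat_exLt {Γ : Ctx} (e : M.Env Γ) (n : Term Γ Ty.nat) (φ : Form (Ty.nat :: Γ)) :
    Sat e (exLt n φ) ↔ ∃ i < eval e n, Sat (Env.cons i e) φ := by
  simp [exLt]

/-- `Ψ` maps reals to positive reals. -/
def IsPositive (Ψ : M.carrier (Ty.one ⇒ Ty.one)) : Prop :=
  ∀ x, IsReal x → IsReal (Ψ x) ∧ ∃ n, epsL n < st (Ψ x)

/-- The centres are slices of a single function, which keeps all quantifiers at types `0` and `1`;
`coveredTo` is the formula that expresses this. -/
def Covered (Ψ : M.carrier (Ty.one ⇒ Ty.one)) (x : M.carrier Ty.one) : Prop :=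
  ∃ (k : M.N) (v : M.carrier Ty.one), (∀ i < k, InUnit (sliceM v i)) ∧
    ∀ z, InUnit z → (∀ m, st z ≤ st x + epsL m) → ∃ i < k, Near Ψ z (sliceM v i)

theorem sat_coveredTo {Γ : Ctx} (e : M.Env Γ) {Ψ : M.carrier (Ty.one ⇒ Ty.one)}
    (hΨ : IsPositive Ψ) {x : M.carrier Ty.one} (hx : IsReal x) :
    Sat (Env.cons x (Env.cons Ψ e)) coveredTo ↔ Covered Ψ x := by
  rw [coveredTo, sat_ex]
  simp only [sat_ex, sat_conj, sat_allLt, sat_inUnitInterval, sat_all, sat_imp, sat_realLe,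
    sat_exLt, Covered, eval_slice, eval_var, Env.cons_zero, Env.cons_succ]
  refine exists_congr fun k => exists_congr fun v => and_congr_right fun hv => ?_
  refine forall_congr' fun z => forall_congr' fun hz => ?_
  rw [not_rlt_iff hx hz.1]
  refine forall_congr' fun _ => exists_congr fun i => and_congr_right fun hi => ?_
  rw [sat_inInterval]
  · simp
  · exact hz.1
  · simpa using (hv i hi).1
  · simpa using (hΨ _ (hv i hi).1).1

theorem Covered.mono {Ψ : M.carrier (Ty.one ⇒ Ty.one)} {x u : M.carrier Ty.one}
    (h : Covered Ψ u) (hxu : ∀ m, st x ≤ st u + epsL m) : Covered Ψ x := by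
  obtain ⟨k, v, hv, hc⟩ := h
  refine ⟨k, v, hv, fun z hz hzx => hc z hz fun m => ?_⟩
  have h1 := hzx (m + 1)
  have h2 := hxu (m + 1)
  rw [epsL_succ] at *
  linarith

theorem inUnit_ofK {q : M.K} (h0 : 0 ≤ q) (h1 : q ≤ 1) : InUnit (ofK q) := by
  rw [inUnit_iff]
  refine ⟨isReal_ofK q, fun m => ?_, fun m => ?_⟩ <;>
  · have := eps_pos m
    rw [val_ofK]; linarith

/-- One interval around `0` suffices; all slices of a constant code of `0` represent the real `0`.
-/
theorem covered_of_le_zero {Ψ : M.carrier (Ty.one ⇒ Ty.one)} (hΨ : IsPositive Ψ)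
    {x : M.carrier Ty.one} (hx : ∀ m, st x ≤ epsL m) : Covered Ψ x := by
  have hs : ∀ n, val (sliceM (ofK (0 : M.K)) 0 n) = 0 := fun n => by rw [sliceM_app, val_ofK]
  refine ⟨1, ofK 0, fun i hi => ?_, fun z hz hzx => ?_⟩
  · rw [N_lt_one.1 hi, inUnit_iff]
    refine ⟨isReal_const hs, fun m => ?_, fun m => ?_⟩ <;>
    · have := eps_pos m
      rw [hs]; linarith
  · refine ⟨0, zero_lt_one, ?_⟩
    obtain ⟨n, hn⟩ := (hΨ _ (isReal_const hs)).2
    refine ⟨n + 1, ?_⟩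
    rw [st_const hs, map_zero, sub_zero, ← lt_sub_iff_add_lt, abs_lt]
    have h1 := hzx (n + 1 + 1)
    have h2 := hx (n + 1 + 1)
    have h3 := (hz.2 (n + 1 + 1)).1
    have h4 := epsL_pos n
    rw [epsL_succ (n + 1)] at *
    rw [epsL_succ] at *
    constructor <;> linarith

/-- The centre `y` is appended at index `k` of the coded sequence, and only points beyond `x` need
its interval. -/
theorem Covered.extend {Ψ : M.carrier (Ty.one ⇒ Ty.one)} {x u y : M.carrier Ty.one}
    (h : Covered Ψ x) (hx : IsReal x) (hy : InUnit y)
    (hu : ∀ z, InUnit z → RLt x z → (∀ m, st z ≤ st u + epsL m) → Near Ψ z y) : Covered Ψ u := by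
  classical
  obtain ⟨k, v, hv, hc⟩ := h
  let v' : M.carrier Ty.one := Model.lam fun p => if fstM p < k then v p else y (sndM p)
  have hv' : ∀ p, v' p = if fstM p < k then v p else y (sndM p) := lam_app (by fun_prop)
  have h1 : ∀ i < k, sliceM v' i = sliceM v i := fun i hi => M.ext _ _ fun n => by
    rw [sliceM_app, sliceM_app, hv', fstM_pairM, if_pos hi]
  have h2 : sliceM v' k = y := M.ext _ _ fun n => by
    rw [sliceM_app, hv', fstM_pairM, if_neg (lt_irrefl _), sndM_pairM]
  refine ⟨k + 1, v', fun i hi => ?_, fun z hz hzu => ?_⟩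
  · rcases (lt_succ_iff.1 hi).lt_or_eq with hi | rfl
    · rw [h1 i hi]; exact hv i hi
    · rw [h2]; exact hy
  · by_cases hxz : RLt x z
    · exact ⟨k, lt_add_one k, by rw [h2]; exact hu z hz hxz hzu⟩
    · obtain ⟨i, hi, hn⟩ := hc z hz ((not_rlt_iff hx hz.1).1 hxz)
      exact ⟨i, hi.trans (lt_add_one k), by rw [h1 i hi]; exact hn⟩

/-- Some covered `x` lies only slightly below `y`. Adding the interval around `y` covers everything
up to a point `r` above `y`, or up to `1`; the first alternative contradicts that nothing above `y`
is covered. -/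
theorem covered_of_isLub {Ψ : M.carrier (Ty.one ⇒ Ty.one)} (hΨ : IsPositive Ψ)
    {y : M.carrier Ty.one} (hy : InUnit y)
    (h1 : ∀ z, IsReal z → RLt y z → (∀ m, st z ≤ 1 + epsL m) → ¬ Covered Ψ z)
    (h2 : ∀ z, InUnit z → (∀ w, IsReal w → RLt z w → (∀ m, st w ≤ 1 + epsL m) → ¬ Covered Ψ w) →
      ¬ RLt z y) : Covered Ψ (ofK 1) := by
  obtain ⟨n, hn⟩ := (hΨ y hy.1).2
  -- Four units `epsL m` fit into `Ψ y`: three for the distance from `y`, and two halves for the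
  -- slack in `z ≤ r` and for the margin in `Near`.
  let m := n + 1 + 1
  have hm : epsL n = 4 * epsL m := by rw [epsL_succ, epsL_succ]; ring
  have hm0 := epsL_pos m
  have near := abs_le.1 (hy.1.near m)
  have two_eps : toL (2 * eps m) = 2 * epsL m := by rw [map_mul, map_ofNat]; rfl
  obtain ⟨x, hx, hcx, hxy⟩ : ∃ x, IsReal x ∧ Covered Ψ x ∧ st y - 3 * epsL m ≤ st x := by
    -- A rational between `y - 3 * epsL m` and `y - epsL m`. It lies below `y`, so by leastness some
    -- covered point exceeds it; if it is negative, `0` serves instead.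
    let q := val (y m) - 2 * eps m
    have hq : toL q = toL (val (y m)) - 2 * epsL m := by rw [map_sub, two_eps]
    rcases lt_or_ge q 0 with hq0 | hq0
    · refine ⟨ofK 0, isReal_ofK 0, covered_of_le_zero hΨ fun k => ?_, ?_⟩
      · rw [st_ofK, map_zero]; exact (epsL_pos k).le
      · have := toL_lt.2 hq0
        rw [st_ofK, map_zero] at *
        linarith
    · have hq1 : q ≤ 1 := le_of_forall_epsL fun k => by
        have := (hy.2 k).2
        rw [map_one]; linarith
      by_contra! hcon
      refine h2 (ofK q) (inUnit_ofK hq0 hq1) (fun w hw hqw _ hcw => ?_) ?_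
      · rw [rlt_iff (isReal_ofK q) hw, st_ofK] at hqw
        obtain ⟨k, hk⟩ := hqw
        have := hcon w hw hcw
        have := epsL_pos k
        linarith
      · rw [rlt_iff (isReal_ofK q) hy.1, st_ofK]
        refine ⟨m + 1, ?_⟩
        rw [epsL_succ m]
        linarith
  -- Apart from the cut-off at `1`, this lies between `y + epsL m` and `y + 3 * epsL m`.
  let r := min 1 (val (y m) + 2 * eps m)
  have hr : toL r ≤ toL (val (y m)) + 2 * epsL m := by
    rw [← two_eps, ← map_add]; exact toL_le.2 (min_le_right _ _)
  have hcr : Covered Ψ (ofK r) := by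
    refine hcx.extend hx hy fun z hz hxz hzr => ⟨m + 1, ?_⟩
    rw [rlt_iff hx hz.1] at hxz
    obtain ⟨j, hj⟩ := hxz
    have := epsL_pos j
    have h3 := hzr (m + 1)
    rw [st_ofK] at h3
    rw [← lt_sub_iff_add_lt, abs_lt]
    rw [epsL_succ m] at *
    constructor <;> linarith
  rcases le_or_gt 1 (val (y m) + 2 * eps m) with h | h
  · have : r = 1 := min_eq_left h
    rwa [this] at hcr
  · exfalso
    have hr' : r = val (y m) + 2 * eps m := min_eq_right h.le
    refine h1 (ofK r) (isReal_ofK r) ?_ (fun k => ?_) hcr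
    · rw [rlt_iff hy.1 (isReal_ofK r), st_ofK, hr', map_add, two_eps]
      refine ⟨m + 1, ?_⟩
      rw [epsL_succ m]
      linarith
    · have h3 := toL_le.2 (min_le_left 1 (val (y m) + 2 * eps m))
      have h4 := epsL_pos k
      rw [st_ofK]
      rw [map_one] at h3
      linarith

theorem holds_HBU (hL : ∀ ψ ∈ LUB, M.Holds ψ) : M.Holds HBU := by
  rw [Holds, HBU, sat_all]
  intro Ψ
  rw [sat_imp]
  intro hpos
  have hΨ : IsPositive Ψ := by
    rw [isPositiveRealFunction, sat_conj, sat_all] at hpos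
    intro x hx
    have := hpos.1 x
    simp at this
    obtain ⟨h1, h2⟩ := this hx
    refine ⟨h1, ?_⟩
    rw [rlt_iff (isReal_const (val_realZero _)) h1, st_const (val_realZero _), map_zero] at h2
    simpa using h2
  have hlub := (holds_close _).1 (hL _ ⟨[Ty.one ⇒ Ty.one], coveredTo, secondOrder_coveredTo, rfl⟩)
    (Env.cons Ψ Env.nil)
  have hone : Covered Ψ (ofK 1) := by
    by_contra hcon
    have hz := isReal_const (val_realZero (M := M) (Env.cons Ψ Env.nil))
    have ho := isReal_const (val_realOne (M := M) (Env.cons Ψ Env.nil))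
    have hle : ∀ {Δ : Ctx} (e' : M.Env Δ) (z : M.carrier Ty.one), IsReal z →
        (¬ RLt (eval e' realOne) z ↔ ∀ m, st z ≤ 1 + epsL m) := fun e' z hz => by
      rw [not_rlt_iff (isReal_const (val_realOne e')) hz, st_const (val_realOne e'), map_one]
    rw [lubFormula, sat_imp, sat_conj, sat_conj, sat_ex] at hlub
    obtain ⟨y, hy⟩ := hlub ⟨by
      rw [isExtensional, sat_all]
      intro a b
      simp only [sat_imp, sat_isReal, sat_realEq, sat_iff, sat_wk, sat_wkUnder, eval_var,
        Env.cons_zero, Env.cons_succ, Env.tail_cons]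
      intro ha hb hab
      rw [sat_coveredTo _ hΨ ha, sat_coveredTo _ hΨ hb]
      rw [req_iff ha hb] at hab
      constructor <;> intro h <;> refine h.mono fun m => ?_ <;>
      · have := abs_le.1 (hab m); linarith, by
      rw [sat_inst, sat_coveredTo _ hΨ hz]
      refine covered_of_le_zero hΨ fun m => ?_
      rw [st_const (val_realZero _), map_zero]; exact (epsL_pos m).le, by
      rw [sat_neg, sat_inst, sat_coveredTo _ hΨ ho]
      refine fun h => hcon (h.mono fun m => ?_)
      rw [st_const (val_realOne _), st_ofK]
      have := epsL_pos m
      linarith⟩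
    rw [sat_conj, sat_conj, sat_inUnitInterval, noneAbove, sat_all, sat_all] at hy
    obtain ⟨hy, hy1, hy2⟩ := hy
    refine hcon (covered_of_isLub hΨ hy (fun z hz hyz hz1 hc => ?_) fun z hz hnone => ?_)
    · have := hy1 z
      rw [sat_imp, sat_neg, sat_wkUnder, Env.tail_cons, sat_coveredTo _ hΨ hz] at this
      refine this ?_ hc
      simp only [sat_conj, sat_isReal, sat_realLt, sat_realLe]
      exact ⟨hz, hyz, (hle _ z hz).2 hz1⟩
    · have := hy2 z
      rw [sat_imp, sat_conj, sat_inUnitInterval, noneAbove, sat_all, sat_realLe] at this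
      refine this ⟨hz, fun w => ?_⟩
      rw [sat_imp, sat_neg, sat_wkUnder, sat_wkUnder]
      simp only [sat_conj, sat_isReal, sat_realLt, sat_realLe]
      rintro ⟨hw, hzw, hw1⟩
      have hw : IsReal w := hw
      change ¬ Sat (Env.cons w (Env.cons Ψ Env.nil)) _
      rw [sat_coveredTo _ hΨ hw]
      exact hnone w hw hzw ((hle _ w hw).1 hw1)
  obtain ⟨k, v, hv, hc⟩ := hone
  rw [sat_ex]
  refine ⟨k, ?_⟩
  rw [sat_ex]
  let w : M.carrier (Ty.nat ⇒ Ty.one) := Model.lam fun i => sliceM v i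
  have hw : ∀ i, w i = sliceM v i := lam_app (by unfold sliceM; fun_prop)
  refine ⟨w, ?_⟩
  simp only [sat_conj, sat_allLt, sat_exLt, sat_inUnitInterval, sat_all, sat_imp, eval_app, eval_var,
    Env.cons_zero, Env.cons_succ]
  refine ⟨fun i hi => by rw [hw]; exact hv i hi, fun z hz => ?_⟩
  obtain ⟨i, hi, hn⟩ := hc z hz fun m => by
    rw [st_ofK, map_one]; exact (hz.2 m).2
  refine ⟨i, hi, ?_⟩
  have hr := (hv i hi).1
  rw [← hw] at hr hn
  rw [sat_inInterval]
  · exact hn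
  · exact hz.1
  · exact hr
  · exact (hΨ _ hr).1

end Model

end HigherOrderRM

namespace HigherOrderRM

/-! ## `HBU` implies `HBU_c` -/

namespace Model

variable {M : Model} [hM : M.IsRCA]

/-- `f ∈ C`. -/
def InCantor (f : M.carrier Ty.one) : Prop := ∀ n, f n ≤ 1

theorem InCantor.eq {f : M.carrier Ty.one} (hf : InCantor f) (n : M.N) : f n = 0 ∨ f n = 1 := by
  rcases eq_or_ne (f n) 0 with h | h
  · exact .inl h
  · exact .inr (le_antisymm (hf n) (N_one_le (N_pos_iff.2 h)))

theorem InCantor.eq_one {f : M.carrier Ty.one} (hf : InCantor f) {n : M.N} (h : f n ≠ 0) : f n = 1 :=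
  (hf.eq n).resolve_left h

/-- `4 ^ (-n)`. -/
noncomputable def quart (n : M.N) : M.K := eps (n + n)

theorem quart_pos (n : M.N) : 0 < quart n := eps_pos _

theorem quart_zero : quart (0 : M.N) = 1 := by rw [quart, add_zero, eps_zero]

theorem quart_succ (n : M.N) : quart (n + 1) = quart n / 4 := by
  have : n + 1 + (n + 1) = n + n + 1 + 1 := by ring
  rw [quart, this, eps_succ, eps_succ, quart]; ring

theorem quart_mono {m n : M.N} (h : m ≤ n) : quart n ≤ quart m := eps_mono (add_le_add h h)

theorem quart_le_eps (n : M.N) : quart n ≤ eps n := eps_mono (le_add_of_nonneg_right (N_zero_le n))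

@[fun_prop] theorem Def.quart {α : Type} [Obj M α] {F : α → M.N} (hF : Def M F) :
    Def M (fun a => Model.quart (F a)) := by
  unfold Model.quart; fun_prop

/-- The integer `∑ 3 f(i) 4 ^ (n - 1 - i)`, over all `i < n`. -/
noncomputable def num (f : M.carrier Ty.one) (n : M.N) : M.N := recF (fun i c => 4 * c + 3 * f i) 0 n

/-- The rational number `∑ 3 f(i) 4 ^ (-i - 1)`, over all `i < n`. -/
noncomputable def left (f : M.carrier Ty.one) (n : M.N) : M.K := toK (num f n) * quart n

theorem num_zero (f : M.carrier Ty.one) : num f 0 = 0 := recF_zero _ _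

theorem num_succ (f : M.carrier Ty.one) (n : M.N) : num f (n + 1) = 4 * num f n + 3 * f n :=
  recF_succ (by fun_prop) _ _

@[fun_prop] theorem Def.num {α : Type} [Obj M α] {F : α → M.carrier Ty.one} {n : α → M.N}
    (hF : Def M F) (hn : Def M n) : Def M (fun a => Model.num (F a) (n a)) := by
  unfold Model.num; fun_prop

@[fun_prop] theorem Def.left {α : Type} [Obj M α] {F : α → M.carrier Ty.one} {n : α → M.N}
    (hF : Def M F) (hn : Def M n) : Def M (fun a => Model.left (F a) (n a)) := by
  unfold Model.left; fun_prop

theorem left_zero (f : M.carrier Ty.one) : left f 0 = 0 := by rw [left, num_zero, map_zero, zero_mul]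

theorem left_succ (f : M.carrier Ty.one) (n : M.N) :
    left f (n + 1) = left f n + 3 / 4 * toK (f n) * quart n := by
  rw [left, num_succ, map_add, map_mul, map_mul, map_ofNat, map_ofNat, quart_succ, left]; ring

theorem left_succ_of_eq_zero {f : M.carrier Ty.one} {n : M.N} (h : f n = 0) :
    left f (n + 1) = left f n := by
  rw [left_succ, h, map_zero]; ring

theorem left_succ_of_eq_one {f : M.carrier Ty.one} {n : M.N} (h : f n = 1) :
    left f (n + 1) = left f n + 3 / 4 * quart n := by
  rw [left_succ, h, map_one]; ring

theorem num_congr {f g : M.carrier Ty.one} {n : M.N} (h : ∀ i < n, f i = g i) : num f n = num g n := by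
  have key : ∀ m, ¬ m ≤ n ∨ num f m = num g m := by
    refine induction (by fun_prop) (.inr (by rw [num_zero, num_zero])) fun m ih => ?_
    rcases ih with ih | ih
    · exact .inl fun hm => ih ((lt_add_one m).le.trans hm)
    · refine or_iff_not_imp_left.2 fun hm => ?_
      rw [num_succ, num_succ, ih, h m (succ_le_iff.1 (not_not.1 hm))]
  exact (key n).resolve_left (not_not.2 le_rfl)

theorem left_congr {f g : M.carrier Ty.one} {n : M.N} (h : ∀ i < n, f i = g i) : left f n = left g n := by
  rw [left, num_congr h, left]

/-- The intervals from `left f n` to `left f n + quart n` are nested: digit `0` keeps the first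
quarter, digit `1` the last. -/
theorem InCantor.left_le {f : M.carrier Ty.one} (hf : InCantor f) (n i : M.N) :
    left f n ≤ left f (n + i) ∧ left f (n + i) + quart (n + i) ≤ left f n + quart n := by
  induction i using induction
  · fun_prop
  · simp
  · rename_i i ih
    have h1 := quart_pos (n + i)
    rw [← add_assoc, quart_succ]
    rcases hf.eq (n + i) with h | h
    · rw [left_succ_of_eq_zero h]; constructor <;> linarith
    · rw [left_succ_of_eq_one h]; constructor <;> linarith

/-- The real number `∑ 3 f(i) 4 ^ (-i - 1)`. -/
noncomputable def point (f : M.carrier Ty.one) : M.carrier Ty.one :=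
  (exists_code (M := M) (c := fun n => left f n) (by fun_prop)).choose

theorem val_point (f : M.carrier Ty.one) (n : M.N) : val (point f n) = left f n :=
  (exists_code (M := M) (c := fun n => left f n) (by fun_prop)).choose_spec n

theorem InCantor.inUnit_point {f : M.carrier Ty.one} (hf : InCantor f) : InUnit (point f) := by
  rw [inUnit_iff]
  have h0 : ∀ n, 0 ≤ left f n ∧ left f n ≤ 1 := fun n => by
    have h := hf.left_le 0 n
    have := quart_pos n
    rw [zero_add, left_zero, quart_zero] at h
    constructor <;> linarith
  refine ⟨fun n i => ?_, fun m => ?_, fun m => ?_⟩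
  · have h := hf.left_le n i
    have h1 := quart_pos (n + i)
    have h2 := quart_le_eps n
    rw [val_point, val_point, abs_lt]
    constructor <;> linarith
  all_goals
    rw [val_point]
    have := h0 m
    have := eps_pos m
    linarith

theorem InCantor.st_point {f : M.carrier Ty.one} (hf : InCantor f) (n : M.N) :
    toL (left f n) ≤ st (point f) ∧ st (point f) ≤ toL (left f n + quart n) := by
  constructor
  · refine le_st n fun k hk => ?_
    obtain ⟨i, rfl⟩ := exists_add_of_le hk
    rw [val_point]; exact (hf.left_le n i).1
  · refine st_le n fun k hk => ?_
    obtain ⟨i, rfl⟩ := exists_add_of_le hk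
    have := (hf.left_le n i).2
    have := quart_pos (n + i)
    rw [val_point]; linarith

/-! ### Points of Cantor space near a real number -/

open Classical in
/-- The element of Cantor space that follows `x`, with digit `1` at `n` if the approximation of `x`
exceeds the left end point of the current interval by more than `t` times its length. -/
noncomputable def path (t : M.K) (x : M.carrier Ty.one) : M.carrier Ty.one := Model.lam fun n =>
  -- The inner recursion rebuilds the numerator of the prefix already produced. Entry `2 n + 6` of a
  -- real has error at most `quart n / 64`.
  if (toK (recF (fun i c => if (toK c + t) * quart i < val (x (i + i + 6)) then 4 * c + 3
    else 4 * c) 0 n) + t) * quart n < val (x (n + n + 6)) then 1 else 0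

-- The auxiliary recursion computes `num` of the path itself, so the definition can be traded for
-- this self-referential equation.
open Classical in
theorem path_app (t : M.K) (x : M.carrier Ty.one) (n : M.N) :
    path t x n = if left (path t x) n + t * quart n < val (x (n + n + 6)) then 1 else 0 := by
  set F : M.N → M.N → M.N := fun i c => if (toK c + t) * quart i < val (x (i + i + 6)) then 4 * c + 3
    else 4 * c with hF
  have h : ∀ n, path t x n = if (toK (recF F 0 n) + t) * quart n < val (x (n + n + 6)) then 1 else 0 :=
    lam_app (by fun_prop)
  have key : ∀ n, num (path t x) n = recF F 0 n := by
    refine induction (by fun_prop) (by rw [num_zero, recF_zero]) fun n ih => ?_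
    rw [num_succ, recF_succ (by fun_prop), ih, h]
    simp only [hF]
    split_ifs <;> simp
  rw [h, ← key, left, add_mul]

theorem inCantor_path (t : M.K) (x : M.carrier Ty.one) : InCantor (path t x) := fun n => by
  classical
  rw [path_app]; split_ifs
  · exact le_rfl
  · exact N_zero_le 1

@[fun_prop] theorem Def.path {α : Type} [Obj M α] (t : M.K) {F : α → M.carrier Ty.one}
    (hF : Def M F) : Def M (fun a => Model.path t (F a)) := by
  unfold Model.path; fun_prop

theorem IsReal.near_quart {x : M.carrier Ty.one} (hx : IsReal x) (n : M.N) :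
    |toL (val (x (n + n + 6))) - st x| ≤ toL (quart n) / 64 := by
  have h := hx.near (n + n + 6)
  have e : n + n + 6 = n + n + 1 + 1 + 1 + 1 + 1 + 1 := by ring
  rw [e] at h ⊢
  have : epsL (n + n + 1 + 1 + 1 + 1 + 1 + 1) = toL (quart n) / 64 := by
    rw [epsL_succ, epsL_succ, epsL_succ, epsL_succ, epsL_succ, epsL_succ, quart, epsL]; ring
  rwa [this] at h

theorem path_eq_zero {t : M.K} {x : M.carrier Ty.one} (hx : IsReal x) {n : M.N} (h : path t x n = 0) :
    st x ≤ toL (left (path t x) n + (t + 1 / 64) * quart n) := by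
  classical
  have h1 := abs_le.1 (hx.near_quart n)
  rw [path_app] at h
  have h2 : ¬ left (path t x) n + t * quart n < val (x (n + n + 6)) := fun h3 => by
    rw [if_pos h3] at h; exact one_ne_zero h
  have h3 := toL_le.2 (not_lt.1 h2)
  simp only [map_add, map_mul, map_div₀, map_one, map_ofNat] at h3 ⊢
  linarith

theorem path_ne_zero {t : M.K} {x : M.carrier Ty.one} (hx : IsReal x) {n : M.N} (h : path t x n ≠ 0) :
    toL (left (path t x) n + (t - 1 / 64) * quart n) ≤ st x := by
  classical
  have h1 := abs_le.1 (hx.near_quart n)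
  rw [path_app] at h
  have h2 : left (path t x) n + t * quart n < val (x (n + n + 6)) := by
    by_contra h3
    rw [if_neg h3] at h; exact h rfl
  have h3 := toL_le.2 h2.le
  simp only [map_add, map_sub, map_mul, map_div₀, map_one, map_ofNat] at h3 ⊢
  linarith

/-- If `f` leaves `path t y` at `p`, then its point is not close to `y`. -/
theorem InCantor.far {f y : M.carrier Ty.one} (hf : InCantor f) (hy : IsReal y) {t : M.K}
    (ht : 3 / 8 ≤ t) (ht' : t ≤ 5 / 8) {p : M.N} (h : ∀ i < p, f i = path t y i) (hp : f p ≠ path t y p) :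
    toL (7 / 64 * quart p) ≤ |st (point f) - st y| := by
  have hq := quart_pos p
  rw [le_abs]
  rcases (inCantor_path t y).eq p with h0 | h1
  · left
    rw [h0] at hp
    have h2 := (hf.st_point (p + 1)).1
    rw [left_succ_of_eq_one (hf.eq_one hp), left_congr h] at h2
    have h3 := path_eq_zero hy h0
    -- In units of `quart p` from the common left end, the point of `f` is at least `48/64`, while
    -- `y` is at most `5/8 + 1/64 = 41/64`.
    have h4 : left (path t y) p + (t + 1 / 64) * quart p + 7 / 64 * quart p ≤
        left (path t y) p + 3 / 4 * quart p := by nlinarith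
    have h5 := toL_le.2 h4
    rw [map_add] at h5
    linarith
  · right
    have h0 : f p = 0 := (hf.eq p).resolve_right fun h => hp (h.trans h1.symm)
    have h2 := (hf.st_point (p + 1)).2
    rw [left_succ_of_eq_zero h0, left_congr h, quart_succ] at h2
    have h3 := path_ne_zero hy (h1.trans_ne one_ne_zero)
    -- Here the point of `f` is at most `16/64`, while `y` is at least `3/8 - 1/64 = 23/64`.
    have h4 : left (path t y) p + quart p / 4 + 7 / 64 * quart p ≤
        left (path t y) p + (t - 1 / 64) * quart p := by nlinarith
    have h5 := toL_le.2 h4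
    rw [map_add] at h5
    linarith

/-- The digits of `f` are compatible with the location of `X`. -/
structure Follows (X : M.L) (f : M.carrier Ty.one) : Prop where
  inCantor : InCantor f
  le_of_eq {n : M.N} : f n = 0 → X ≤ toL (left f n + 21 / 32 * quart n)
  le_of_ne {n : M.N} : f n ≠ 0 → toL (left f n + 11 / 32 * quart n) ≤ X

/-- The bounds in `Follows` are the extreme thresholds widened by two errors of `1/64`, one for
reading `x` and one for replacing `x` by `X`: `5/8 + 2/64 = 21/32` and `3/8 - 2/64 = 11/32`. -/
theorem follows_path {t : M.K} (ht : 3 / 8 ≤ t) (ht' : t ≤ 5 / 8) {x : M.carrier Ty.one} (hx : IsReal x)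
    {X : M.L} (hX : ∀ n, |st x - X| ≤ epsL n) : Follows X (path t x) := by
  have h1 : ∀ n, |st x - X| ≤ toL (1 / 64 * quart n) := fun n => by
    have h := hX (n + n + 1 + 1 + 1 + 1 + 1 + 1)
    have : epsL (n + n + 1 + 1 + 1 + 1 + 1 + 1) = toL (1 / 64 * quart n) := by
      rw [epsL, eps_succ, eps_succ, eps_succ, eps_succ, eps_succ, eps_succ, quart]; congr 1; ring
    rwa [this] at h
  refine ⟨inCantor_path t x, fun {n} h => ?_, fun {n} h => ?_⟩
  · have h2 := path_eq_zero hx h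
    have h3 := abs_le.1 (h1 n)
    have h4 : left (path t x) n + (t + 1 / 64) * quart n + 1 / 64 * quart n ≤
        left (path t x) n + 21 / 32 * quart n := by nlinarith [quart_pos n]
    have h5 := toL_le.2 h4
    rw [map_add] at h5
    linarith
  · have h2 := path_ne_zero hx h
    have h3 := abs_le.1 (h1 n)
    have h4 : left (path t x) n + 11 / 32 * quart n + 1 / 64 * quart n ≤
        left (path t x) n + (t - 1 / 64) * quart n := by nlinarith [quart_pos n]
    have h5 := toL_le.2 h4
    rw [map_add] at h5
    linarith

/-- After digit `0`, the intervals of `f` stay in the first quarter. Since `X` lies to the right of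
it, no later digit can be `0`. `Follows.eq_zero` is the mirror image, with the last quarter. -/
theorem Follows.eq_one {X : M.L} {f : M.carrier Ty.one} (hf : Follows X f) {n i : M.N} (h0 : f n = 0)
    (hX : toL (left f n + 11 / 32 * quart n) ≤ X) : f (n + 1 + i) = 1 := by
  refine hf.inCantor.eq_one fun h => ?_
  have h1 := hf.le_of_eq h
  have h2 := (hf.inCantor.left_le (n + 1) i).2
  have h3 := quart_pos (n + 1 + i)
  have h4 := quart_pos n
  rw [left_succ_of_eq_zero h0, quart_succ n] at h2
  have := toL_le.1 (hX.trans h1)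
  linarith

theorem Follows.eq_zero {X : M.L} {f : M.carrier Ty.one} (hf : Follows X f) {n i : M.N} (h0 : f n ≠ 0)
    (hX : X ≤ toL (left f n + 21 / 32 * quart n)) : f (n + 1 + i) = 0 := by
  by_contra h
  have h1 := hf.le_of_ne h
  have h2 := (hf.inCantor.left_le (n + 1) i).1
  have h3 := quart_pos (n + 1 + i)
  have h4 := quart_pos n
  rw [left_succ_of_eq_one (hf.inCantor.eq_one h0)] at h2
  have := toL_le.1 (h1.trans hX)
  linarith

/-- In the middle zone the digit at `n` forces all later ones, so beyond a common prefix `X` has at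
most two followers. The whole construction of the radius rests on this. -/
theorem Follows.eq {X : M.L} {f g : M.carrier Ty.one} (hf : Follows X f) (hg : Follows X g) {n : M.N}
    (h : ∀ i < n, f i = g i) (hn : f n = g n) (hX : toL (left f n + 11 / 32 * quart n) ≤ X)
    (hX' : X ≤ toL (left f n + 21 / 32 * quart n)) : f = g := by
  refine M.ext _ _ fun m => ?_
  rcases lt_trichotomy m n with hm | rfl | hm
  · exact h m hm
  · exact hn
  · obtain ⟨i, rfl⟩ := exists_add_of_le (succ_le_iff.2 hm)
    have e := left_congr h
    by_cases h0 : f n = 0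
    · rw [hf.eq_one h0 hX, hg.eq_one (hn ▸ h0) (e ▸ hX)]
    · rw [hf.eq_zero h0 hX', hg.eq_zero (hn ▸ h0) (e ▸ hX')]

end Model

end HigherOrderRM

namespace HigherOrderRM

namespace Model

/-! ### Interpolated radii that respect equality of reals. -/

section Weight

variable {R : Type} [Field R] [LinearOrder R]

/-- The piecewise linear function of `y` that is `0` up to `l + 7 / (16 s)` and `1` from
`l + 9 / (16 s)` on. -/
def weight (l s y : R) : R := max 0 (min 1 (8 * (y - l) * s - 7 / 2))

theorem weight_nonneg (l s y : R) : 0 ≤ weight l s y := le_max_left _ _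

variable [IsStrictOrderedRing R]

theorem weight_le_one (l s y : R) : weight l s y ≤ 1 := max_le zero_le_one (min_le_left _ _)

theorem weight_eq_zero {l s q y : R} (hs : 0 < s) (hsq : s * q = 1) (h : y ≤ l + 7 / 16 * q) :
    weight l s y = 0 := by
  refine max_eq_left ((min_le_right _ _).trans ?_)
  nlinarith [mul_le_mul_of_nonneg_left h hs.le]

theorem weight_eq_one {l s q y : R} (hs : 0 < s) (hsq : s * q = 1) (h : l + 9 / 16 * q ≤ y) :
    weight l s y = 1 := by
  have : 1 ≤ 8 * (y - l) * s - 7 / 2 := by nlinarith [mul_le_mul_of_nonneg_left h hs.le]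
  rw [weight, min_eq_left this, max_eq_right zero_le_one]

theorem abs_weight_sub_le {l s : R} (hs : 0 ≤ s) (y z : R) :
    |weight l s y - weight l s z| ≤ 8 * s * |y - z| := by
  have h1 := abs_max_sub_max_le_abs (min 1 (8 * (y - l) * s - 7 / 2))
    (min 1 (8 * (z - l) * s - 7 / 2)) 0
  have h2 := abs_min_sub_min_le_max 1 (8 * (y - l) * s - 7 / 2) 1 (8 * (z - l) * s - 7 / 2)
  have h3 : |8 * (y - l) * s - 7 / 2 - (8 * (z - l) * s - 7 / 2)| = 8 * s * |y - z| := by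
    rw [show 8 * (y - l) * s - 7 / 2 - (8 * (z - l) * s - 7 / 2) = 8 * s * (y - z) by ring, abs_mul,
      abs_of_nonneg (by positivity)]
  rw [sub_self, abs_zero, h3, max_eq_right (by positivity)] at h2
  rw [weight, weight, max_comm 0, max_comm 0]
  exact h1.trans h2

theorem add_weight_mem {l s y a b : R} :
    min a b ≤ a + weight l s y * (b - a) ∧ a + weight l s y * (b - a) ≤ max a b := by
  have h0 := weight_nonneg l s y
  have h1 := weight_le_one l s y
  rcases le_total a b with h | h
  · rw [min_eq_left h, max_eq_right h]; constructor <;> nlinarith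
  · rw [min_eq_right h, max_eq_left h]; constructor <;> nlinarith

end Weight

variable {M : Model} [hM : M.IsRCA]

/-- `4 ^ n`. -/
noncomputable def scale (n : M.N) : M.K := toK (twoPowM (n + n))

theorem scale_pos (n : M.N) : 0 < scale n := toK_pos (twoPowM_pos _)

theorem scale_mul_quart (n : M.N) : scale n * quart n = 1 := by
  have := (scale_pos n).ne'
  rw [quart, eps]
  change scale n * (1 / scale n) = 1
  field_simp

theorem toL_max (a b : M.K) : toL (max a b) = max (toL a) (toL b) :=
  Monotone.map_max (f := (toL : M.K → M.L)) fun _ _ h => toL_le.2 h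

theorem toL_min (a b : M.K) : toL (min a b) = min (toL a) (toL b) :=
  Monotone.map_min (f := (toL : M.K → M.L)) fun _ _ h => toL_le.2 h

theorem toL_weight (l s y : M.K) : toL (weight l s y) = weight (toL l) (toL s) (toL y) := by
  simp only [weight, toL_max, toL_min, map_zero, map_one, map_sub, map_mul, map_div₀, map_ofNat]

theorem toL_scale_pos (n : M.N) : 0 < toL (scale n) := by
  rw [← map_zero toL]; exact toL_lt.2 (scale_pos n)

theorem toL_scale_mul (n : M.N) : toL (scale n) * toL (quart n) = 1 := by
  rw [← map_mul, scale_mul_quart, map_one]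

/-- The weight at level `n` has Lipschitz constant `8 * scale n`; reading `x` at `2 n + 3` further
places compensates for it. -/
theorem scale_mul_eps (n k : M.N) : 8 * scale n * eps (k + (n + n + 1 + 1 + 1)) = eps k := by
  rw [eps_add, eps_succ, eps_succ, eps_succ]
  change 8 * scale n * (eps k * (quart n / 2 / 2 / 2)) = eps k
  linear_combination eps k * scale_mul_quart n

/-- `z` interpolates between `a` and `b` by the weight of `x`. -/
def Interpolates (z x : M.carrier Ty.one) (n : M.N) (l a b : M.K) : Prop :=
  ∀ k, val (z k) = a + weight l (scale n) (val (x (k + (n + n + 1 + 1 + 1)))) * (b - a)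

section Interpolates

variable {z x : M.carrier Ty.one} {n : M.N} {l a b : M.K}

theorem Interpolates.isReal (h : Interpolates z x n l a b) (hx : IsReal x) (hab : |b - a| ≤ 1) :
    IsReal z := by
  intro k i
  have h1 := abs_weight_sub_le (l := l) (scale_pos n).le (val (x (k + (n + n + 1 + 1 + 1))))
    (val (x (k + i + (n + n + 1 + 1 + 1))))
  have h2 := hx (k + (n + n + 1 + 1 + 1)) i
  have e : k + (n + n + 1 + 1 + 1) + i = k + i + (n + n + 1 + 1 + 1) := by ring
  rw [e] at h2
  have h3 := mul_lt_mul_of_pos_left h2 (mul_pos (by norm_num : (0 : M.K) < 8) (scale_pos n))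
  rw [scale_mul_eps] at h3
  rw [h, h, add_sub_add_left_eq_sub, ← sub_mul, abs_mul]
  refine lt_of_le_of_lt ?_ (h1.trans_lt h3)
  exact mul_le_of_le_one_right (abs_nonneg _) hab

/-- The value is expressed through any `X` that agrees with `x` up to all `epsL k`, so that
different representations of one real can be compared at the same `X`. -/
theorem Interpolates.st_near (h : Interpolates z x n l a b) (hx : IsReal x) (hab : |b - a| ≤ 1)
    {X : M.L} (hX : ∀ k, |st x - X| ≤ epsL k) (k : M.N) :
    |st z - (toL a + weight (toL l) (toL (scale n)) X * (toL b - toL a))| ≤ epsL k := by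
  let j := k + 1 + 1 + (n + n + 1 + 1 + 1)
  have h1 := (h.isReal hx hab).near (k + 1 + 1)
  have h2 := hx.near j
  have h3 := hX j
  have h4 := abs_weight_sub_le (l := toL l) (toL_scale_pos n).le (toL (val (x j))) X
  have h5 : |toL (val (x j)) - X| ≤ 2 * epsL j := by
    rw [abs_le] at *; constructor <;> linarith
  have h6 : 8 * toL (scale n) * epsL j = epsL (k + 1 + 1) := by
    rw [epsL, epsL, ← scale_mul_eps n (k + 1 + 1), map_mul, map_mul, map_ofNat]
  have h7 : |weight (toL l) (toL (scale n)) (toL (val (x j))) - weight (toL l) (toL (scale n)) X| ≤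
      2 * epsL (k + 1 + 1) := by
    refine h4.trans ?_
    rw [← h6]
    have := mul_le_mul_of_nonneg_left h5 (mul_pos (by norm_num : (0 : M.L) < 8) (toL_scale_pos n)).le
    linarith
  have h8 : |toL b - toL a| ≤ 1 := by
    rw [← map_sub, ← toL_abs, ← map_one toL]; exact toL_le.2 hab
  rw [h, map_add, map_mul, toL_weight, map_sub] at h1
  set w := weight (toL l) (toL (scale n)) (toL (val (x j)))
  set w' := weight (toL l) (toL (scale n)) X
  have h9 : |(w - w') * (toL b - toL a)| ≤ 2 * epsL (k + 1 + 1) := by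
    rw [abs_mul]; exact (mul_le_of_le_one_right (abs_nonneg _) h8).trans h7
  have h10 : (w - w') * (toL b - toL a) = w * (toL b - toL a) - w' * (toL b - toL a) := sub_mul _ _ _
  have h11 := epsL_pos k
  rw [h10] at h9
  rw [epsL_succ, epsL_succ] at *
  rw [abs_le] at *
  constructor <;> linarith

theorem Interpolates.st_mem (h : Interpolates z x n l a b) :
    toL (min a b) ≤ st z ∧ st z ≤ toL (max a b) := by
  constructor
  · refine le_st 0 fun k _ => ?_
    rw [h]; exact add_weight_mem.1
  · refine st_le 0 fun k _ => ?_
    rw [h]; exact add_weight_mem.2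

end Interpolates

/-! ### The radius function -/

/-- The radius associated with the cylinder `[f̄G(f)]`. -/
noncomputable def rad (G : M.carrier Ty.two) (f : M.carrier Ty.one) : M.K := quart (G f) / 4

theorem rad_pos (G : M.carrier Ty.two) (f : M.carrier Ty.one) : 0 < rad G f :=
  div_pos (quart_pos _) (by norm_num)

theorem rad_le (G : M.carrier Ty.two) (f : M.carrier Ty.one) : rad G f ≤ 1 := by
  have := quart_mono (N_zero_le (G f))
  rw [quart_zero] at this
  rw [rad]; linarith

theorem abs_rad_sub_le (G : M.carrier Ty.two) (f g : M.carrier Ty.one) : |rad G g - rad G f| ≤ 1 := by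
  have := rad_pos G f
  have := rad_pos G g
  have := rad_le G f
  have := rad_le G g
  rw [abs_le]; constructor <;> linarith

/-- `n` is where `f` and `g` split. -/
def SplitAt (f g : M.carrier Ty.one) (n : M.N) : Prop := (∀ i < n, f i = g i) ∧ f n ≠ g n

theorem SplitAt.unique {f g : M.carrier Ty.one} {m n : M.N} (hm : SplitAt f g m) (hn : SplitAt f g n) :
    m = n :=
  le_antisymm (not_lt.1 fun h => hn.2 (hm.1 n h)) (not_lt.1 fun h => hm.2 (hn.1 m h))

theorem exists_splitAt {f g : M.carrier Ty.one} (h : f ≠ g) : ∃ n, SplitAt f g n := by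
  have : ∃ n, f n ≠ g n := by
    by_contra! h'
    exact h (M.ext _ _ h')
  obtain ⟨n, hn⟩ := this
  obtain ⟨m, hm, hm'⟩ := exists_least (P := fun n => f n ≠ g n)
    (Def.not (P := fun n => f n = g n) (by fun_prop)) hn
  exact ⟨m, fun i hi => not_not.1 (hm' i hi), hm⟩

/-- The two elements of Cantor space associated with a real number. -/
noncomputable def lowPath (x : M.carrier Ty.one) : M.carrier Ty.one := path (5 / 8) x

noncomputable def highPath (x : M.carrier Ty.one) : M.carrier Ty.one := path (3 / 8) x

/-- `Ψ` interpolates between the radii of the two paths of a real number, near the place where they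
split. -/
structure IsRadius (G N : M.carrier Ty.two) (Ψ : M.carrier (Ty.one ⇒ Ty.one)) : Prop where
  splitAt (x : M.carrier Ty.one) :
    G (lowPath x) = G (highPath x) ∨ SplitAt (lowPath x) (highPath x) (N x)
  interpolates (x : M.carrier Ty.one) : Interpolates (Ψ x) x (N x) (left (lowPath x) (N x))
    (rad G (lowPath x)) (rad G (highPath x))

/-- Coincidence of the two paths is not known to be internal, so it cannot be a case in a
definition. The disjunction used here is internal and always solvable: coinciding paths have the
same `G`-value, and then any `n` will do. -/
theorem exists_isRadius (G : M.carrier Ty.two) : ∃ N Ψ, IsRadius G N Ψ := by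
  have hdef : Def M (fun p : M.carrier Ty.one × M.N =>
      G (lowPath p.1) = G (highPath p.1) ∨ SplitAt (lowPath p.1) (highPath p.1) p.2) := by
    have h1 : Def M (fun p : M.carrier Ty.one × M.N => ∀ i < p.2, lowPath p.1 i = highPath p.1 i) := by
      refine Def.allLt ?_ (by fun_prop)
      unfold lowPath highPath; fun_prop
    unfold SplitAt lowPath highPath at *
    fun_prop
  obtain ⟨N, hN⟩ := choice (P := fun x n => G (lowPath x) = G (highPath x) ∨
    SplitAt (lowPath x) (highPath x) n) hdef fun x => by
    by_cases h : lowPath x = highPath x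
    · exact ⟨0, .inl (by rw [h])⟩
    · exact (exists_splitAt h).imp fun n hn => .inr hn
  obtain ⟨Ψ, hΨ⟩ := exists_codes (M := M) (σ := Ty.one) (c := fun x k => rad G (lowPath x) +
    weight (left (lowPath x) (N x)) (scale (N x)) (val (x (k + (N x + N x + 1 + 1 + 1)))) *
      (rad G (highPath x) - rad G (lowPath x))) (by
    unfold rad weight scale lowPath highPath
    simp only [div_eq_mul_inv]
    fun_prop)
  exact ⟨N, Ψ, hN, hΨ⟩

section IsRadius

variable {G N : M.carrier Ty.two} {Ψ : M.carrier (Ty.one ⇒ Ty.one)}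

theorem IsRadius.isReal (h : IsRadius G N Ψ) {x : M.carrier Ty.one} (hx : IsReal x) : IsReal (Ψ x) :=
  (h.interpolates x).isReal hx (abs_rad_sub_le _ _ _)

theorem IsRadius.isPositive (h : IsRadius G N Ψ) : IsPositive Ψ := fun x hx => by
  refine ⟨h.isReal hx, ?_⟩
  obtain ⟨n, hn⟩ := exists_epsL_lt (lt_min (rad_pos G (lowPath x)) (rad_pos G (highPath x)))
  exact ⟨n, hn.trans_le (h.interpolates x).st_mem.1⟩

theorem follows_lowPath {x : M.carrier Ty.one} (hx : IsReal x) {X : M.L}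
    (hX : ∀ n, |st x - X| ≤ epsL n) : Follows X (lowPath x) :=
  follows_path (by norm_num) le_rfl hx hX

theorem follows_highPath {x : M.carrier Ty.one} (hx : IsReal x) {X : M.L}
    (hX : ∀ n, |st x - X| ≤ epsL n) : Follows X (highPath x) :=
  follows_path le_rfl (by norm_num) hx hX

/-- Both paths of `z` follow `X`, so beyond the common prefix each is `f` or `g`. If they differ,
the interpolation is literally the stated one; if they agree, the thresholds place `X` where the
weight is constant, and it selects the right radius. The target does not involve `z`. -/
theorem IsRadius.near_target (h : IsRadius G N Ψ) {z : M.carrier Ty.one} (hz : IsReal z) {X : M.L}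
    (hX : ∀ k, |st z - X| ≤ epsL k) {f g : M.carrier Ty.one} (hf : Follows X f) (hg : Follows X g)
    {n : M.N} (hfg : ∀ i < n, f i = g i) (hfn : f n = 0) (hgn : g n ≠ 0)
    (h1 : ∀ i < n, f i = lowPath z i) (h2 : ∀ i < n, f i = highPath z i) (k : M.N) :
    |st (Ψ z) - (toL (rad G f) + weight (toL (left f n)) (toL (scale n)) X *
      (toL (rad G g) - toL (rad G f)))| ≤ epsL k := by
  have hl := follows_lowPath hz hX
  have hh := follows_highPath hz hX
  have e := left_congr hfg
  have e1 := left_congr h1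
  have e2 := left_congr h2
  have h3 := hf.le_of_eq hfn
  have h4 := hg.le_of_ne hgn
  rw [← e] at h4
  have key := (h.interpolates z).st_near hz (abs_rad_sub_le _ _ _) hX k
  have hq := quart_pos n
  have hnear : |st z - X| ≤ 1 / 64 * toL (quart n) := by
    have h := hX (n + n + 1 + 1 + 1 + 1 + 1 + 1)
    have : epsL (n + n + 1 + 1 + 1 + 1 + 1 + 1) = 1 / 64 * toL (quart n) := by
      rw [epsL_succ, epsL_succ, epsL_succ, epsL_succ, epsL_succ, epsL_succ, quart, epsL]; ring
    rwa [this] at h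
  have hqL : 0 < toL (quart n) := by rw [← map_zero toL]; exact toL_lt.2 hq
  rw [abs_le] at hnear
  have eqf : ∀ {p : M.carrier Ty.one}, Follows X p → (∀ i < n, f i = p i) → p n = 0 → p = f :=
    fun hp hfp h0 => (hf.eq hp hfp (hfn.trans h0.symm) h4 h3).symm
  have eqg : ∀ {p : M.carrier Ty.one}, Follows X p → (∀ i < n, f i = p i) → p n ≠ 0 → p = g :=
    fun hp hfp h0 => (hg.eq hp (fun i hi => (hfg i hi).symm.trans (hfp i hi))
      ((hg.inCantor.eq_one hgn).trans (hp.inCantor.eq_one h0).symm) (e ▸ h4) (e ▸ h3)).symm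
  by_cases hh0 : highPath z n = 0
  · have b2 := path_eq_zero hz hh0
    have ef := eqf hh h2 hh0
    change _ ≤ toL (left (highPath z) n + _) at b2
    rw [← e2] at b2
    simp only [map_add, map_mul, map_div₀, map_one, map_ofNat] at b2
    by_cases hl0 : lowPath z n = 0
    · rw [eqf hl h1 hl0, ef, sub_self, mul_zero, add_zero] at key
      rw [weight_eq_zero (toL_scale_pos n) (toL_scale_mul n) (by linarith), zero_mul, add_zero]
      exact key
    · have b1 := path_ne_zero hz hl0
      change toL (left (lowPath z) n + _) ≤ _ at b1
      rw [← e1] at b1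
      simp only [map_add, map_sub, map_mul, map_div₀, map_one, map_ofNat] at b1
      linarith
  · have eg := eqg hh h2 hh0
    by_cases hl0 : lowPath z n = 0
    · have ef := eqf hl h1 hl0
      -- Either the two radii agree and the place and the weight are irrelevant, or `N z` is the
      -- true splitting place and must be `n`.
      rcases h.splitAt z with hs | hs
      · have hr : rad G f = rad G g := by rw [← ef, ← eg, rad, hs, rad]
        rw [ef, eg, hr, sub_self, mul_zero] at key
        rw [hr, sub_self, mul_zero]; exact key
      · rw [ef, eg] at hs key
        rwa [hs.unique ⟨hfg, fun h => hgn (h ▸ hfn)⟩] at key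
    · have b1 := path_ne_zero hz hl0
      change toL (left (lowPath z) n + _) ≤ _ at b1
      rw [← e1] at b1
      simp only [map_add, map_sub, map_mul, map_div₀, map_one, map_ofNat] at b1
      rw [eqg hl h1 hl0, eg, sub_self, mul_zero, add_zero] at key
      rw [weight_eq_one (toL_scale_pos n) (toL_scale_mul n) (by linarith), one_mul,
        add_sub_cancel]
      exact key

/-- All four paths of `x` and `y` follow `st y`. If they coincide, both radii are the same constant.
Otherwise, at the least place where they are not all equal, two differing ones serve as `f` and `g`
in `near_target`, which gives `Ψ x` and `Ψ y` the same target. -/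
theorem IsRadius.near (h : IsRadius G N Ψ) {x y : M.carrier Ty.one} (hx : IsReal x) (hy : IsReal y)
    (hxy : ∀ n, |st x - st y| ≤ epsL n) (n : M.N) : |st (Ψ x) - st (Ψ y)| ≤ epsL n := by
  have hyy : ∀ n, |st y - st y| ≤ epsL n := fun n => by
    rw [sub_self, abs_zero]; exact (epsL_pos n).le
  have trans : ∀ {T : M.L}, (∀ n, |st (Ψ x) - T| ≤ epsL n) → (∀ n, |st (Ψ y) - T| ≤ epsL n) →
      |st (Ψ x) - st (Ψ y)| ≤ epsL n := fun h1 h2 => by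
    have h1 := abs_le.1 (h1 (n + 1))
    have h2 := abs_le.1 (h2 (n + 1))
    rw [epsL_succ] at h1 h2
    rw [abs_le]; constructor <;> linarith
  let P : M.N → Prop := fun m => ¬ (lowPath x m = highPath x m ∧ lowPath x m = lowPath y m ∧
    lowPath x m = highPath y m)
  have hP : Def M P := by
    refine Def.not (P := fun m => (lowPath x m = highPath x m ∧ lowPath x m = lowPath y m ∧
      lowPath x m = highPath y m)) ?_
    fun_prop
  by_cases hm : ∃ m, P m
  · obtain ⟨m, hm⟩ := hm
    obtain ⟨m, hm, hlt⟩ := exists_least hP hm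
    have hlt : ∀ i < m, lowPath x i = highPath x i ∧ lowPath x i = lowPath y i ∧
      lowPath x i = highPath y i := fun i hi => not_not.1 (hlt i hi)
    have f1 := follows_lowPath hx hxy
    have f2 := follows_highPath hx hxy
    have f3 := follows_lowPath hy hyy
    have f4 := follows_highPath hy hyy
    have main : ∀ {f g : M.carrier Ty.one}, Follows (st y) f → Follows (st y) g →
        (∀ i < m, lowPath x i = f i) → (∀ i < m, lowPath x i = g i) → f m ≠ g m →
        |st (Ψ x) - st (Ψ y)| ≤ epsL n := by
      have aux : ∀ {f g : M.carrier Ty.one}, Follows (st y) f → Follows (st y) g →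
          (∀ i < m, lowPath x i = f i) → (∀ i < m, lowPath x i = g i) → f m = 0 → g m ≠ 0 →
          |st (Ψ x) - st (Ψ y)| ≤ epsL n := fun {f g} hf hg hf' hg' h0 h1 =>
        trans
          (h.near_target hx hxy hf hg (fun i hi => (hf' i hi).symm.trans (hg' i hi)) h0 h1
            (fun i hi => (hf' i hi).symm) fun i hi => (hf' i hi).symm.trans (hlt i hi).1)
          (h.near_target hy hyy hf hg (fun i hi => (hf' i hi).symm.trans (hg' i hi)) h0 h1
            (fun i hi => (hf' i hi).symm.trans (hlt i hi).2.1)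
            fun i hi => (hf' i hi).symm.trans (hlt i hi).2.2)
      intro f g hf hg hf' hg' hne
      rcases eq_or_ne (f m) 0 with h0 | h0
      · exact aux hf hg hf' hg' h0 fun h1 => hne (h0.trans h1.symm)
      · exact aux hg hf hg' hf' ((hg.inCantor.eq m).resolve_right fun h1 =>
          hne ((hf.inCantor.eq_one h0).trans h1.symm)) h0
    by_cases h1 : lowPath x m = highPath x m
    · by_cases h2 : lowPath x m = lowPath y m
      · by_cases h3 : lowPath x m = highPath y m
        · exact absurd ⟨h1, h2, h3⟩ hm
        · exact main f1 f4 (fun _ _ => rfl) (fun i hi => (hlt i hi).2.2) h3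
      · exact main f1 f3 (fun _ _ => rfl) (fun i hi => (hlt i hi).2.1) h2
    · exact main f1 f2 (fun _ _ => rfl) (fun i hi => (hlt i hi).1) h1
  · have hall : ∀ m, lowPath x m = highPath x m ∧ lowPath x m = lowPath y m ∧
      lowPath x m = highPath y m := fun m => not_not.1 fun h => hm ⟨m, h⟩
    have e1 : highPath x = lowPath x := M.ext _ _ fun m => (hall m).1.symm
    have e2 : lowPath y = lowPath x := M.ext _ _ fun m => (hall m).2.1.symm
    have e3 : highPath y = lowPath x := M.ext _ _ fun m => (hall m).2.2.symm
    have k1 := (h.interpolates x).st_near hx (abs_rad_sub_le _ _ _) hxy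
    have k2 := (h.interpolates y).st_near hy (abs_rad_sub_le _ _ _) hyy
    simp only [e1, sub_self, mul_zero, add_zero] at k1
    simp only [e2, e3, sub_self, mul_zero, add_zero] at k2
    exact trans k1 k2

/-- The interval around `y` contains only points of the two cylinders given by the paths of `y`. -/
theorem IsRadius.mem_cylinder (h : IsRadius G N Ψ) {f y : M.carrier Ty.one} (hf : InCantor f)
    (hy : IsReal y) (hn : Near Ψ (point f) y) :
    (∀ i < G (lowPath y), f i = lowPath y i) ∨ ∀ i < G (highPath y), f i = highPath y i := by
  have far : ∀ {t : M.K}, 3 / 8 ≤ t → t ≤ 5 / 8 → ¬ (∀ i < G (path t y), f i = path t y i) →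
      toL (rad G (path t y)) ≤ |st (point f) - st y| := fun {t} ht ht' hne => by
    have hne' : f ≠ path t y := fun e => hne fun i _ => by rw [← e]
    obtain ⟨p, hp⟩ := exists_splitAt hne'
    have hp' : p + 1 ≤ G (path t y) := succ_le_iff.2 <| not_le.1 fun hle =>
      hne fun i hi => hp.1 i (hi.trans_le hle)
    -- The split occurs before `G (path t y)`, so the radius is at most `quart (p + 1) / 4`, which
    -- is `4/64` of `quart p` and thus below the `7/64` given by `far`.
    refine (toL_le.2 ?_).trans (hf.far hy ht ht' hp.1 hp.2)
    have h1 := quart_mono hp'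
    have h2 := quart_pos p
    rw [quart_succ] at h1
    rw [rad]; linarith
  by_contra! hcon
  have h1 := far (t := 5 / 8) (by norm_num) le_rfl fun h => by
    obtain ⟨i, hi, hi'⟩ := hcon.1
    exact hi' (h i hi)
  have h2 := far (t := 3 / 8) le_rfl (by norm_num) fun h => by
    obtain ⟨i, hi, hi'⟩ := hcon.2
    exact hi' (h i hi)
  obtain ⟨n, hn⟩ := hn
  -- An interpolated value never exceeds the larger radius, while the distance is at least both
  -- radii.
  have h3 := (h.interpolates y).st_mem.2
  have h4 := epsL_pos n
  rw [toL_max] at h3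
  have h5 : max (toL (rad G (lowPath y))) (toL (rad G (highPath y))) ≤ |st (point f) - st y| :=
    max_le h1 h2
  linarith

end IsRadius

end Model

end HigherOrderRM

namespace HigherOrderRM

namespace Model

variable {M : Model} [hM : M.IsRCA]

/-! ### Finite sub-coverings of Cantor space and the uniform bound. -/

@[simp] theorem sat_inCantor {Γ : Ctx} (e : M.Env Γ) (f : Term Γ Ty.one) :
    Sat e (inCantor f) ↔ InCantor (eval e f) := by
  simp [inCantor, leT, oneT, InCantor, eval_combK]

@[simp] theorem sat_inCylinder {Γ : Ctx} (e : M.Env Γ) (f g : Term Γ Ty.one) (n : Term Γ Ty.nat) :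
    Sat e (inCylinder f g n) ↔ ∀ i < eval e n, eval e f i = eval e g i := by
  simp [inCylinder, sat_allLt]

theorem holds_HBUc_iff : M.Holds HBUc ↔ ∀ G : M.carrier Ty.two, ∃ (k : M.N)
    (w : M.carrier (Ty.nat ⇒ Ty.one)), (∀ i < k, InCantor (w i)) ∧
      ∀ f, InCantor f → ∃ i < k, ∀ m < G (w i), f m = w i m := by
  simp [Holds, HBUc, sat_allLt, sat_exLt]

theorem holds_HBUc (h : M.Holds HBU) : M.Holds HBUc := by
  classical
  rw [holds_HBUc_iff]
  intro G
  obtain ⟨N, Ψ, hΨ⟩ := exists_isRadius G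
  rw [Holds, HBU, sat_all] at h
  have h := h Ψ
  rw [sat_imp, isPositiveRealFunction, sat_conj, sat_all, sat_all] at h
  have h := h ⟨fun x => by
    simp only [sat_imp, sat_conj, sat_isReal, sat_realLt, eval_app, eval_wk, eval_var, Env.cons_zero, Env.tail_cons]
    intro hx
    obtain ⟨h1, n, hn⟩ := hΨ.isPositive x hx
    refine ⟨h1, ?_⟩
    rw [rlt_iff (isReal_const (val_realZero _)) h1, st_const (val_realZero _), map_zero]
    exact ⟨n, by simpa using hn⟩, fun x => by
    rw [sat_all]
    intro y
    simp only [sat_imp, sat_isReal, sat_realEq, eval_app, eval_wk, eval_var, Env.cons_zero, Env.cons_succ,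
      Env.tail_cons]
    intro hx hy hxy
    rw [req_iff hx hy] at hxy
    exact (req_iff (hΨ.isReal hx) (hΨ.isReal hy)).2 (hΨ.near hx hy hxy)⟩
  rw [sat_ex] at h
  obtain ⟨k, h⟩ := h
  rw [sat_ex] at h
  obtain ⟨v, h⟩ := h
  simp only [sat_conj, sat_allLt, sat_exLt, sat_inUnitInterval, sat_all, sat_imp, eval_app, eval_var,
    Env.cons_zero, Env.cons_succ] at h
  obtain ⟨hv, hc⟩ := h
  -- Each of the `k` centres contributes two elements of Cantor space: low paths at indices below
  -- `k`, high paths at indices from `k` to `k + k`.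
  let w : M.carrier (Ty.nat ⇒ Ty.one) := Model.lam fun i => Model.lam fun n =>
    if i < k then lowPath (v i) n else highPath (v (monusM i k)) n
  have hw : ∀ i n, w i n = if i < k then lowPath (v i) n else highPath (v (monusM i k)) n := fun i n => by
    unfold w lowPath highPath
    rw [lam_app (by fun_prop), lam_app (by fun_prop)]
  have hlow : ∀ i < k, w i = lowPath (v i) := fun i hi => M.ext _ _ fun n => by rw [hw, if_pos hi]
  have hhigh : ∀ i, w (k + i) = highPath (v i) := fun i => M.ext _ _ fun n => by
    have hk : k ≤ k + i := le_add_of_nonneg_right (N_zero_le i)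
    rw [hw, if_neg (not_lt.2 hk), add_left_cancel (add_monusM hk)]
  refine ⟨k + k, w, fun i _ n => ?_, fun f hf => ?_⟩
  · rw [hw]
    split_ifs
    · exact inCantor_path _ _ n
    · exact inCantor_path _ _ n
  · obtain ⟨i, hi, hn⟩ := hc (point f) hf.inUnit_point
    rw [sat_inInterval] at hn
    · rcases hΨ.mem_cylinder hf (hv i hi).1 hn with h | h
      · exact ⟨i, hi.trans_le (le_add_of_nonneg_right (N_zero_le k)), by rw [hlow i hi]; exact h⟩
      · exact ⟨k + i, add_lt_add_right hi k, by rw [hhigh i]; exact h⟩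
    · exact hf.inUnit_point.1
    · exact (hv i hi).1
    · exact hΨ.isReal (hv i hi).1

/-! ## `HBU_c` implies `PIT_u` -/

/-- The sum of the values, formed by the recursor, is a bound; the number of terms may be
nonstandard, so internal induction is needed. -/
theorem exists_bound {c : M.N → M.N} (hc : Def M c) (n : M.N) : ∃ b, ∀ i < n, c i ≤ b := by
  refine ⟨recF (fun i s => s + c i) 0 n, ?_⟩
  induction n using induction
  · exact Def.allLt (P := fun n i => c i ≤ recF (fun i s => s + c i) 0 n) (by fun_prop) Def.id
  · exact fun i hi => absurd hi (N_zero_le i).not_gt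
  · rename_i n ih
    intro i hi
    rw [recF_succ (by fun_prop)]
    rcases (lt_succ_iff.1 hi).lt_or_eq with hi | rfl
    · exact (ih i hi).trans (le_add_of_nonneg_right (N_zero_le _))
    · exact le_add_of_nonneg_left (N_zero_le _)

/-- The bound is extracted from `G` and its finite sub-covering before `F` is introduced, which
gives the uniformity. -/
theorem holds_PITu (h : M.Holds HBUc) : M.Holds PITu := by
  rw [holds_HBUc_iff] at h
  rw [Holds, PITu, sat_all]
  intro G
  obtain ⟨k, w, hw, hc⟩ := h G
  obtain ⟨b, hb⟩ := exists_bound (c := fun i => G (w i)) (by fun_prop) k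
  rw [sat_ex]
  refine ⟨b, ?_⟩
  simp only [sat_all, sat_imp, LOC, sat_le, sat_inCantor, sat_inCylinder, eval_app, eval_wk, eval_var,
    Env.cons_zero, Env.cons_succ, Env.tail_cons]
  intro F hF g hg
  obtain ⟨i, hi, h⟩ := hc g hg
  exact (hF (w i) g (hw i hi) hg h).trans (hb i hi)

end Model

end HigherOrderRM

namespace HigherOrderRM

/-! ### From truth in all models back to derivability. -/

theorem proves_of_isRCA {T : Set Sentence} {φ : Sentence} (hT : RCA0omega ⊆ T)
    (h : ∀ M : Model, [M.IsRCA] → (∀ ψ ∈ T, M.Holds ψ) → M.Holds φ) : Proves T φ :=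
  Proves.of_models hT fun M hM =>
    have : M.IsRCA := ⟨fun φ hφ => hM φ (hT hφ)⟩
    h M hM

theorem Model.holds_imp {M : Model} {φ ψ : Sentence} : M.Holds (φ ⟹ ψ) ↔ (M.Holds φ → M.Holds ψ) :=
  Model.sat_imp _ _ _

end HigherOrderRM

theorem mainTheorem6 :
    (∀ ψ ∈ HigherOrderRM.LUB,
      HigherOrderRM.Proves HigherOrderRM.RCA0omega
        (HigherOrderRM.Form.imp HigherOrderRM.exists3 ψ)) ∧
    HigherOrderRM.Proves (HigherOrderRM.RCA0omega ∪ HigherOrderRM.LUB) HigherOrderRM.HBU ∧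
    HigherOrderRM.Proves HigherOrderRM.RCA0omega
      (HigherOrderRM.Form.imp HigherOrderRM.HBU HigherOrderRM.HBUc) ∧
    HigherOrderRM.Proves HigherOrderRM.RCA0omega
      (HigherOrderRM.Form.imp HigherOrderRM.HBUc HigherOrderRM.PITu) ∧
    HigherOrderRM.Proves HigherOrderRM.Z2Omega HigherOrderRM.PITu := by
  refine ⟨fun ψ hψ => ?_, ?_, ?_, ?_, ?_⟩
  · exact HigherOrderRM.proves_of_isRCA subset_rfl fun M _ _ => HigherOrderRM.Model.holds_imp.2
      fun h => HigherOrderRM.Model.holds_LUB (HigherOrderRM.Model.hasE3_of_holds h) hψ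
  · exact HigherOrderRM.proves_of_isRCA Set.subset_union_left fun M _ hM =>
      HigherOrderRM.Model.holds_HBU fun ψ hψ => hM ψ (.inr hψ)
  · exact HigherOrderRM.proves_of_isRCA subset_rfl fun M _ _ =>
      HigherOrderRM.Model.holds_imp.2 HigherOrderRM.Model.holds_HBUc
  · exact HigherOrderRM.proves_of_isRCA subset_rfl fun M _ _ =>
      HigherOrderRM.Model.holds_imp.2 HigherOrderRM.Model.holds_PITu
  · exact HigherOrderRM.proves_of_isRCA Set.subset_union_left fun M _ hM =>
      HigherOrderRM.Model.holds_PITu <| HigherOrderRM.Model.holds_HBUc <|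
        HigherOrderRM.Model.holds_HBU fun ψ hψ =>
          HigherOrderRM.Model.holds_LUB (HigherOrderRM.Model.hasE3_of_holds (hM _ (.inr rfl))) hψ
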